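/- Let $F$ be a field of characteristic zero, let $(g,d,[\,,\,])$ be a differential graded Lie algebra over $F$ ($\mathbb Z$-graded, $d$ of degree $-1$), let $H$ be a graded vector space with zero differential (for instance the homology $H(g)$), and let $$\bigl(H \underset{\nabla}{\overset{\pi}{\leftrightharpoons}} g,\ h\bigr)$$ be a contraction of chain complexes: $\pi,\nabla$ are chain maps, $h$ has degree $1$, $\pi\nabla=\mathrm{id}$, $dh+hd=\nabla\pi-\mathrm{id}$, $\pi h=0$, $h\nabla=0$, $hh=0$. (Then $H\cong H(g)$.) For a graded vector space $V$ let $S^c[V]$ be the graded symmetric coalgebra, with the signed unshuffle coproduct and filtered by word length, let $s$ denote the suspension, and let $\tau_V\colon S^c[sV]\to V$ be the projection onto $sV$ followed by desuspension. Every linear map $f\colon S^c[V]\to V$ of degree $-1$ determines a coderivation of $S^c[V]$ whose projection onto $V$ is $f$. On $S^c[sg]$ let $d$ be the coderivation determined by the differential of $g$ (that is, by $s\,d\,s^{-1}$), and let $\partial$ be the coderivation determined by the bracket, i.e. $\tau_g\partial=\tfrac12[\tau_g,\tau_g]$, where $[a,b]=[\,,\,]\circ(a\otimes b)\circ\Delta$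 is the cup bracket. Let $S^c\pi$, $S^c\nabla$ be the coalgebra maps induced by $\pi,\nabla$, and let $S^ch$ be the operator obtained by symmetrization from $\sum_i(\nabla\pi)^{\otimes(i-1)}\otimes h\otimes \mathrm{id}^{\otimes(n-i)}$ on $(sg)^{\otimes n}$. Define $\tau=\tau^1+\tau^2+\cdots\colon S^c[sH]\to g$ and the coderivation $D=D^1+D^2+\cdots$ of $S^c[sH]$ by $$\tau^1=\nabla\tau_H,\qquad \tau^b=\tfrac12 h\sum_{i=1}^{b-1}[\tau^i,\tau^{b-i}],\qquad \tau_HD^{b-1}=\tfrac12\pi\sum_{i=1}^{b-1}[\tau^i,\tau^{b-i}]\qquad(b\ge 2).$$ Let $(S^c\nabla)_\partial\colon S^c[sH]\to S^c[sg]$ be the adjoint of $\tau$, that is, the morphism of coaugmented coalgebras with $\tau_g(S^c\nabla)_\partial=\tau$, and let $(S^ch)_\partial=\sum_{n\ge0}S^ch\,(\partial\, S^ch)^n$ (a finite sum on each element). (a) Suppose that $\tilde D$ is a differential on $S^c[sH]$ turning it into a coaugmented differential graded coalgebra, and that $(S^c\pi)\partial=\tilde D(S^c\pi)$. Then $D=\tilde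 D$, and the perturbed projection $(S^c\pi)_\partial$ may be taken to be $S^c\pi$; that is, $S^c\pi$, $(S^c\nabla)_\partial$ and $(S^ch)_\partial$ form a filtered contraction of chain complexes of $(S^c[sg],d+\partial)$ onto $(S^c[sH],D)$. (b) In particular, if $(S^c\pi)\partial=0$, then $D=0$, and $S^c\pi$, $(S^c\nabla)_\partial$, $(S^ch)_\partial$ form a filtered contraction of $(S^c[sg],d+\partial)$ onto $(S^c[sH],0)$. (c) For example, $(S^c\pi)\partial=0$, and so the conclusion of (b) holds, when the composite $g\otimes g\xrightarrow{[\,,\,]}g\xrightarrow{\pi}H$ is zero. -/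

import Mathlib

open scoped DirectSum TensorProduct Polynomial

noncomputable section

namespace HPT

/-! ## Graded vector spaces -/

section Graded

variable {F V W X : Type*} [Field F] [AddCommGroup V] [Module F V] [AddCommGroup W] [Module F W]
  [AddCommGroup X] [Module F X]

/-- The linear map `f` is homogeneous of degree `k`. -/
def IsDeg (𝒱 : ℤ → Submodule F V) (𝒲 : ℤ → Submodule F W) (k : ℤ) (f : V →ₗ[F] W) : Prop :=
  ∀ i, ∀ x ∈ 𝒱 i, f x ∈ 𝒲 (i + k)

theorem IsDeg.zero_mem {𝒱 : ℤ → Submodule F V} {𝒲 : ℤ → Submodule F W} {f : V →ₗ[F] W}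
    (hf : IsDeg 𝒱 𝒲 0 f) {i : ℤ} {x : V} (hx : x ∈ 𝒱 i) : f x ∈ 𝒲 i := by
  simpa using hf i x hx

theorem IsDeg.comp_zero {𝒱 : ℤ → Submodule F V} {𝒲 : ℤ → Submodule F W}
    {𝒳 : ℤ → Submodule F X} {f : W →ₗ[F] X} {g : V →ₗ[F] W}
    (hf : IsDeg 𝒲 𝒳 0 f) (hg : IsDeg 𝒱 𝒲 0 g) : IsDeg 𝒱 𝒳 0 (f ∘ₗ g) := fun i x hx => by
  simpa using hf.zero_mem (hg.zero_mem hx)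

/-- `d` is a differential (of degree `-1`) on the graded vector space `(V, 𝒱)`. -/
structure IsDifferential (𝒱 : ℤ → Submodule F V) (d : V →ₗ[F] V) : Prop where
  deg : IsDeg 𝒱 𝒱 (-1) d
  sq : d ∘ₗ d = 0

/-- The suspension `sV`: the same vector space, with `(sV)_i = V_{i-1}`. The map `s : V → sV` of
degree `1` is the identity of the underlying vector spaces. -/
def susp (𝒱 : ℤ → Submodule F V) : ℤ → Submodule F V := fun i => 𝒱 (i - 1)

theorem IsDeg.susp {𝒱 : ℤ → Submodule F V} {𝒲 : ℤ → Submodule F W} {k : ℤ} {f : V →ₗ[F] W}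
    (hf : IsDeg 𝒱 𝒲 k f) : IsDeg (HPT.susp 𝒱) (HPT.susp 𝒲) k f := fun i x hx => by
  have := hf (i - 1) x hx
  rwa [show i - 1 + k = i + k - 1 by ring] at this

instance suspDecomposition (𝒱 : ℤ → Submodule F V) [DirectSum.Decomposition 𝒱] :
    DirectSum.Decomposition (susp 𝒱) :=
  have h : DirectSum.IsInternal (susp 𝒱) := by
    rw [DirectSum.isInternal_submodule_iff_iSupIndep_and_iSup_eq_top]
    have h0 := (DirectSum.isInternal_submodule_iff_iSupIndep_and_iSup_eq_top 𝒱).1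
      (DirectSum.Decomposition.isInternal 𝒱)
    refine ⟨h0.1.comp (f := fun i : ℤ => i - 1) (sub_left_injective), ?_⟩
    rw [← h0.2]
    exact (Equiv.subRight (1 : ℤ)).iSup_comp (g := 𝒱)
  h.chooseDecomposition

/-- The grading involution `x ↦ (-1)^{|x|} x`. -/
def parity (𝒱 : ℤ → Submodule F V) [DirectSum.Decomposition 𝒱] : V →ₗ[F] V :=
  DirectSum.toModule F ℤ V (fun i => ((-1 : ℤˣ) ^ i : ℤˣ) • (𝒱 i).subtype) ∘ₗ
    (DirectSum.decomposeLinearEquiv 𝒱).toLinearMap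

end Graded

/-! ## The graded symmetric coalgebra `S^c[V]` -/

section Sym

variable {F V W : Type*} [Field F] [AddCommGroup V] [Module F V] [AddCommGroup W] [Module F W]

/-- Graded commutativity: `x y = (-1)^{|x||y|} y x`. -/
inductive SymRel (𝒱 : ℤ → Submodule F V) : TensorAlgebra F V → TensorAlgebra F V → Prop
  | comm {i j : ℤ} {x y : V} (hx : x ∈ 𝒱 i) (hy : y ∈ 𝒱 j) :
      SymRel 𝒱 (TensorAlgebra.ι F x * TensorAlgebra.ι F y)
        (((-1 : ℤˣ) ^ (i * j) : ℤˣ) • (TensorAlgebra.ι F y * TensorAlgebra.ι F x))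

/-- The underlying vector space of `S^c[V]`, spanned by the graded-commutative words
`v₁ v₂ ⋯ vₙ`. -/
def SymC (𝒱 : ℤ → Submodule F V) : Type _ := RingQuot (SymRel 𝒱)

namespace SymC

variable (𝒱 : ℤ → Submodule F V) (𝒲 : ℤ → Submodule F W)

instance : Ring (SymC 𝒱) := inferInstanceAs (Ring (RingQuot (SymRel 𝒱)))

instance : Algebra F (SymC 𝒱) := inferInstanceAs (Algebra F (RingQuot (SymRel 𝒱)))

/-- The quotient map from the tensor algebra. -/
def mk : TensorAlgebra F V →ₐ[F] SymC 𝒱 := RingQuot.mkAlgHom F (SymRel 𝒱)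

/-- The inclusion of `V` as the words of length one. -/
def ι : V →ₗ[F] SymC 𝒱 := (mk 𝒱).toLinearMap ∘ₗ TensorAlgebra.ι F

variable {𝒱} in
theorem ι_mul_ι {i j : ℤ} {x y : V} (hx : x ∈ 𝒱 i) (hy : y ∈ 𝒱 j) :
    ι 𝒱 x * ι 𝒱 y = ((-1 : ℤˣ) ^ (i * j) : ℤˣ) • (ι 𝒱 y * ι 𝒱 x) := by
  have := RingQuot.mkAlgHom_rel F (SymRel.comm (𝒱 := 𝒱) hx hy)
  rw [Units.smul_def, map_zsmul, map_mul, map_mul] at this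
  rw [Units.smul_def]
  exact this

variable {𝒱} in
/-- A linear map with graded-commuting values extends to an algebra morphism. -/
def lift {A : Type*} [Ring A] [Algebra F A] (f : V →ₗ[F] A)
    (hf : ∀ (i j : ℤ) (x y : V), x ∈ 𝒱 i → y ∈ 𝒱 j →
      f x * f y = ((-1 : ℤˣ) ^ (i * j) : ℤˣ) • (f y * f x)) : SymC 𝒱 →ₐ[F] A :=
  RingQuot.liftAlgHom F ⟨TensorAlgebra.lift F f, fun a b hab => by
    cases hab with
    | comm hx hy =>
      rw [Units.smul_def, map_zsmul, map_mul, map_mul]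
      simpa [Units.smul_def] using hf _ _ _ _ hx hy⟩

variable {𝒱} in
@[simp]
theorem lift_ι {A : Type*} [Ring A] [Algebra F A] (f : V →ₗ[F] A)
    (hf : ∀ (i j : ℤ) (x y : V), x ∈ 𝒱 i → y ∈ 𝒱 j →
      f x * f y = ((-1 : ℤˣ) ^ (i * j) : ℤˣ) • (f y * f x)) (v : V) :
    lift f hf (ι 𝒱 v) = f v := by
  have := RingQuot.liftAlgHom_mkAlgHom_apply F (TensorAlgebra.lift F f) (s := SymRel 𝒱)
    (fun a b hab => by
      cases hab with
      | comm hx hy =>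
        rw [Units.smul_def, map_zsmul, map_mul, map_mul]
        simpa [Units.smul_def] using hf _ _ _ _ hx hy) (TensorAlgebra.ι F v)
  rw [TensorAlgebra.lift_ι_apply] at this
  exact this

variable {𝒱} in
theorem hom_ext {A : Type*} [Ring A] [Algebra F A] {f g : SymC 𝒱 →ₐ[F] A}
    (h : ∀ v, f (ι 𝒱 v) = g (ι 𝒱 v)) : f = g := by
  refine RingQuot.ringQuot_ext' F f g ?_
  refine TensorAlgebra.hom_ext ?_
  ext v
  exact h v

/-- The total degree: `S^c[V]_n` is spanned by the words `v₁ ⋯ vₖ` in homogeneous letters with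
`|v₁| + ⋯ + |vₖ| = n`. -/
def deg (n : ℤ) : Submodule F (SymC 𝒱) :=
  Submodule.span F {x | ∃ l : List (Σ i, 𝒱 i),
    (l.map fun v => v.1).sum = n ∧ x = (l.map fun v => ι 𝒱 (v.2 : V)).prod}

theorem ι_mem_deg {i : ℤ} {x : V} (hx : x ∈ 𝒱 i) : ι 𝒱 x ∈ deg 𝒱 i :=
  Submodule.subset_span ⟨[⟨i, x, hx⟩], by simp, by simp⟩

instance : SetLike.GradedMonoid (deg 𝒱) where
  one_mem := Submodule.subset_span ⟨[], by simp, by simp⟩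
  mul_mem i j x y hx hy := by
    have : x * y ∈ deg 𝒱 i * deg 𝒱 j := Submodule.mul_mem_mul hx hy
    refine (?_ : deg 𝒱 i * deg 𝒱 j ≤ deg 𝒱 (i + j)) this
    rw [deg, deg, Submodule.span_mul_span]
    refine Submodule.span_le.2 ?_
    rintro _ ⟨_, ⟨l, rfl, rfl⟩, _, ⟨l', rfl, rfl⟩, rfl⟩
    exact Submodule.subset_span ⟨l ++ l', by simp, by simp⟩

section Decomp

variable [DirectSum.Decomposition 𝒱]

/-- Auxiliary: the letters, placed in their degrees. -/
def ιDeg : V →ₗ[F] ⨁ i, deg 𝒱 i :=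
  DirectSum.toModule F ℤ _ (fun i => DirectSum.lof F ℤ (fun i => deg 𝒱 i) i ∘ₗ
    ((ι 𝒱 ∘ₗ (𝒱 i).subtype).codRestrict (deg 𝒱 i) fun x => ι_mem_deg 𝒱 x.2)) ∘ₗ
      (DirectSum.decomposeLinearEquiv 𝒱).toLinearMap

theorem ιDeg_of_mem {i : ℤ} {x : V} (hx : x ∈ 𝒱 i) :
    ιDeg 𝒱 x = DirectSum.of (fun i => deg 𝒱 i) i ⟨ι 𝒱 x, ι_mem_deg 𝒱 hx⟩ := by
  have : DirectSum.decompose 𝒱 x = DirectSum.of (fun i => 𝒱 i) i ⟨x, hx⟩ :=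
    DirectSum.decompose_of_mem 𝒱 hx
  simp only [ιDeg, LinearMap.comp_apply, LinearEquiv.coe_coe,
    DirectSum.decomposeLinearEquiv_apply, this]
  rw [← DirectSum.lof_eq_of F, DirectSum.toModule_lof]
  rfl

/-- Auxiliary: the decomposition of `S^c[V]` by total degree. -/
def decomposeHom : SymC 𝒱 →ₐ[F] ⨁ i, deg 𝒱 i :=
  lift (𝒱 := 𝒱) (A := ⨁ i, deg 𝒱 i) (ιDeg 𝒱) fun i j x y hx hy => by
    rw [ιDeg_of_mem 𝒱 hx, ιDeg_of_mem 𝒱 hy, DirectSum.of_mul_of, DirectSum.of_mul_of]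
    have key := ι_mul_ι (𝒱 := 𝒱) hx hy
    rcases Int.units_eq_one_or ((-1 : ℤˣ) ^ (i * j)) with h | h
    · rw [h, one_smul] at key ⊢
      exact DirectSum.of_eq_of_gradedMonoid_eq (Sigma.subtype_ext (add_comm _ _) key)
    · rw [h, Units.neg_smul, one_smul] at key
      rw [h, Units.smul_def, Units.val_neg, Units.val_one, neg_one_zsmul]
      refine Eq.trans ?_ (map_neg (DirectSum.of (fun i => deg 𝒱 i) (j + i)) _)
      exact DirectSum.of_eq_of_gradedMonoid_eq (Sigma.subtype_ext (add_comm _ _) key)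

instance gradedAlgebra : GradedAlgebra (deg 𝒱) :=
  GradedAlgebra.ofAlgHom (deg 𝒱) (decomposeHom 𝒱)
    (by
      refine hom_ext fun v => ?_
      simp only [AlgHom.comp_apply, decomposeHom, lift_ι, AlgHom.id_apply]
      induction v using DirectSum.Decomposition.inductionOn 𝒱 with
      | zero => simp
      | homogeneous x => rw [ιDeg_of_mem 𝒱 x.2, DirectSum.coeAlgHom_of]
      | add x y hx hy => simp [hx, hy])
    (by
      rintro i ⟨x, hx⟩
      dsimp only
      induction hx using Submodule.span_induction with
      | mem x hx =>
        obtain ⟨l, rfl, rfl⟩ := hx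
        induction l with
        | nil => exact map_one _
        | cons v l ih =>
          simp only [List.map_cons, List.prod_cons, map_mul]
          have h1 : decomposeHom 𝒱 (ι 𝒱 (v.2 : V)) = _ :=
            (lift_ι _ _ _).trans (ιDeg_of_mem 𝒱 v.2.2)
          rw [h1, ih, DirectSum.of_mul_of]
          rfl
      | zero => rw [map_zero]; exact (map_zero (DirectSum.of (fun i => deg 𝒱 i) i)).symm
      | add x y hx hy ihx ihy => rw [map_add, ihx, ihy, ← map_add]; rfl
      | smul a x hx ih =>
        rw [map_smul, ih, ← DirectSum.lof_eq_of F, ← map_smul]; rfl)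

/-- The comultiplication of `S^c[V]`: the letters are primitive, and `Δ` is multiplicative for the
product `(a ⊗ b)(a' ⊗ b') = (-1)^{|b||a'|} a a' ⊗ b b'`. On words this is the signed unshuffle
coproduct `Δ(v₁ ⋯ vₙ) = ∑ ± v_{σ(1)} ⋯ v_{σ(i)} ⊗ v_{σ(i+1)} ⋯ v_{σ(n)}`. -/
def comulHom : SymC 𝒱 →ₐ[F] (deg 𝒱) ᵍ⊗[F] (deg 𝒱) :=
  lift ((GradedTensorProduct.includeLeft (deg 𝒱) (deg 𝒱)).toLinearMap ∘ₗ ι 𝒱 +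
      (GradedTensorProduct.includeRight (deg 𝒱) (deg 𝒱)).toLinearMap ∘ₗ ι 𝒱)
    fun i j x y hx hy => by
      have key : ∀ {i j : ℤ} {x y : V}, x ∈ 𝒱 i → y ∈ 𝒱 j →
          ((ι 𝒱 x ᵍ⊗ₜ[F] 1 + 1 ᵍ⊗ₜ[F] ι 𝒱 x) * (ι 𝒱 y ᵍ⊗ₜ[F] 1 + 1 ᵍ⊗ₜ[F] ι 𝒱 y) :
            (deg 𝒱) ᵍ⊗[F] (deg 𝒱)) =
          ((ι 𝒱 x * ι 𝒱 y) ᵍ⊗ₜ[F] 1 + 1 ᵍ⊗ₜ[F] (ι 𝒱 x * ι 𝒱 y)) +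
            (ι 𝒱 x ᵍ⊗ₜ[F] ι 𝒱 y + ((-1 : ℤˣ) ^ (i * j) : ℤˣ) • (ι 𝒱 y ᵍ⊗ₜ[F] ι 𝒱 x)) := by
        intro i j x y hx hy
        have h1 := GradedTensorProduct.tmul_coe_mul_coe_tmul (deg 𝒱) (deg 𝒱) (R := F) 1
          ⟨ι 𝒱 x, ι_mem_deg 𝒱 hx⟩ ⟨ι 𝒱 y, ι_mem_deg 𝒱 hy⟩ 1
        have h2 := GradedTensorProduct.tmul_one_mul_coe_tmul (deg 𝒱) (deg 𝒱) (R := F) (ι 𝒱 x)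
          ⟨ι 𝒱 y, ι_mem_deg 𝒱 hy⟩ 1
        have h3 := GradedTensorProduct.tmul_coe_mul_one_tmul (deg 𝒱) (deg 𝒱) (R := F) 1
          ⟨ι 𝒱 x, ι_mem_deg 𝒱 hx⟩ (ι 𝒱 y)
        have h4 := GradedTensorProduct.tmul_one_mul_one_tmul (deg 𝒱) (deg 𝒱) (R := F) (ι 𝒱 x)
          (ι 𝒱 y)
        simp only [one_mul, mul_one] at h1 h2 h3 h4
        rw [add_mul, mul_add, mul_add, h1, h2, h3, h4]
        abel
      simp only [LinearMap.add_apply, LinearMap.comp_apply, AlgHom.toLinearMap_apply,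
        GradedTensorProduct.includeLeft_apply, GradedTensorProduct.includeRight_apply]
      rw [key hx hy, key hy hx, ι_mul_ι hx hy, mul_comm j i]
      rcases Int.units_eq_one_or ((-1 : ℤˣ) ^ (i * j)) with h | h
      · simp only [h, one_smul]
        abel
      · simp only [h, Units.neg_smul, one_smul, GradedTensorProduct.tmul, TensorProduct.neg_tmul,
          TensorProduct.tmul_neg, map_neg]
        abel

/-- The comultiplication of `S^c[V]`, with values in the ordinary tensor product. -/
def comul : SymC 𝒱 →ₗ[F] SymC 𝒱 ⊗[F] SymC 𝒱 :=
  (GradedTensorProduct.of F (deg 𝒱) (deg 𝒱)).symm.toLinearMap ∘ₗ (comulHom 𝒱).toLinearMap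

end Decomp

/-- The counit of `S^c[V]`: the projection onto the ground field. -/
def counit : SymC 𝒱 →ₐ[F] F := lift 0 fun _ _ _ _ _ _ => by simp

/-- The projection of `S^c[V]` onto the words of length one, as a map to `V`. -/
def proj : SymC 𝒱 →ₗ[F] V :=
  letI : Module Fᵐᵒᵖ V := Module.compHom _ ((RingHom.id F).fromOpposite mul_comm)
  haveI : IsCentralScalar F V := ⟨fun _ _ => rfl⟩
  TrivSqZeroExt.sndHom F V ∘ₗ
    (lift (𝒱 := 𝒱) (TrivSqZeroExt.inrHom F V) fun _ _ _ _ _ _ => by simp).toLinearMap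

theorem proj_ι (v : V) : proj 𝒱 (ι 𝒱 v) = v := by
  simp [proj]

/-- The filtration of `S^c[V]` by word length: `F_n` is spanned by the words with at most `n`
letters. -/
def filt (n : ℕ) : Submodule F (SymC 𝒱) := ⨆ k ≤ n, LinearMap.range (ι 𝒱) ^ k

/-- The morphism `S^c f : S^c[V] → S^c[W]`, `v₁ ⋯ vₙ ↦ f(v₁) ⋯ f(vₙ)`, induced by a morphism
`f : V → W` of degree zero. -/
def map {𝒱 : ℤ → Submodule F V} {𝒲 : ℤ → Submodule F W} (f : V →ₗ[F] W) (hf : IsDeg 𝒱 𝒲 0 f) :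
    SymC 𝒱 →ₐ[F] SymC 𝒲 :=
  lift (ι 𝒲 ∘ₗ f) fun _ _ _ _ hx hy => ι_mul_ι (hf.zero_mem hx) (hf.zero_mem hy)

/-- Counting letters: `v₁ ⋯ vₙ ↦ v₁ ⋯ vₙ Xⁿ`. -/
def wordLength : SymC 𝒱 →ₐ[F] (SymC 𝒱)[X] :=
  lift ((Polynomial.monomial 1).restrictScalars F ∘ₗ ι 𝒱) fun _ _ _ _ hx hy => by
    simp only [LinearMap.comp_apply, LinearMap.restrictScalars_apply,
      Polynomial.monomial_mul_monomial, ι_mul_ι hx hy, Units.smul_def, map_zsmul]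

/-- The linear map `∑ₖ aₖ Xᵏ ↦ ∑ₖ fₖ(aₖ)`. -/
def polySum {A : Type*} [Ring A] [Algebra F A] (f : ℕ → A →ₗ[F] W) : A[X] →ₗ[F] W where
  toFun p := p.sum fun k a => f k a
  map_add' p q := Polynomial.sum_add_index p q _ (by simp) (by simp)
  map_smul' c p := by
    rw [Polynomial.sum_smul_index' _ _ _ (by simp)]
    simp [Polynomial.smul_sum]

/-- The linear map `f₀ + f₁ + f₂ + ⋯` on `S^c[V]` with `fₖ` applied to the words of length `k`. -/
def total (f : ℕ → SymC 𝒱 →ₗ[F] W) : SymC 𝒱 →ₗ[F] W :=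
  polySum f ∘ₗ (wordLength 𝒱).toLinearMap

section Coder

variable [DirectSum.Decomposition 𝒱]

/-- The coderivation of `S^c[V]` determined by its projection `f : S^c[V] → V` onto the letters:
`v₁ ⋯ vₙ ↦ ∑ ± f(v_{σ(1)} ⋯ v_{σ(i)}) v_{σ(i+1)} ⋯ v_{σ(n)}`, the sum being over all
unshuffles. -/
def coder (f : SymC 𝒱 →ₗ[F] V) : SymC 𝒱 →ₗ[F] SymC 𝒱 :=
  LinearMap.mul' F (SymC 𝒱) ∘ₗ TensorProduct.map (ι 𝒱 ∘ₗ f) LinearMap.id ∘ₗ comul 𝒱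

/-- `D` is a differential on `S^c[V]` turning it into a coaugmented differential graded coalgebra:
`D` has degree `-1` and square zero, is a coderivation, `Δ D = (D ⊗ 1 + 1 ⊗ D) Δ` (where
`(1 ⊗ D)(a ⊗ b) = (-1)^{|a|} a ⊗ D b`), and is compatible with counit and coaugmentation. -/
structure IsCoalgDifferential (D : SymC 𝒱 →ₗ[F] SymC 𝒱) : Prop where
  isDifferential : IsDifferential (deg 𝒱) D
  coderivation : comul 𝒱 ∘ₗ D =
    (TensorProduct.map D LinearMap.id + TensorProduct.map (parity (deg 𝒱)) D) ∘ₗ comul 𝒱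
  counit_comp : (counit 𝒱).toLinearMap ∘ₗ D = 0
  map_one : D 1 = 0

/-- `f` is a morphism of coaugmented graded coalgebras. -/
structure IsCoalgHom [DirectSum.Decomposition 𝒲] (f : SymC 𝒱 →ₗ[F] SymC 𝒲) : Prop where
  deg : IsDeg (SymC.deg 𝒱) (SymC.deg 𝒲) 0 f
  comul_comp : comul 𝒲 ∘ₗ f = TensorProduct.map f f ∘ₗ comul 𝒱
  counit_comp : (counit 𝒲).toLinearMap ∘ₗ f = (counit 𝒱).toLinearMap
  map_one : f 1 = 1

/-- For an operator `h` of degree `1` and a morphism `P` of degree `0` on `V` (below, `P = ∇π`),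
the operator on `S^c[V]` obtained by symmetrization from the operator
`∑ᵢ P^{⊗(i-1)} ⊗ h ⊗ 1^{⊗(n-i)}` on `V^{⊗n}`: it sends `v₁ ⋯ vₙ` to the average, over all orderings
of the letters, of the signed words in which one letter is hit by `h`, the letters before it
are hit by `P`, and those after it are unchanged.
For a letter `vᵢ` hit by `h`, and a given set of `a` letters hit by `P`, with `b` letters unchanged,
the proportion of the orderings concerned is `a! b! / (a + b + 1)! = ∫₀¹ tᵃ (1 - t)ᵇ dt`. So
the operator is `∫₀¹ μ (h ⊗ φ_t) Δ dt`, where `h` is extended by zero from the letters to all words,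
and `φ_t` is the morphism of algebras `v ↦ (1 - t) v + t P v`; here `t` is the polynomial variable,
and `∫₀¹ tᵏ dt = 1 / (k + 1)`. -/
def symHomotopy {𝒱 : ℤ → Submodule F V} [DirectSum.Decomposition 𝒱] (h P : V →ₗ[F] V)
    (hP : IsDeg 𝒱 𝒱 0 P) : SymC 𝒱 →ₗ[F] SymC 𝒱 :=
  let φ : SymC 𝒱 →ₐ[F] (SymC 𝒱)[X] :=
    lift ((Polynomial.monomial 0).restrictScalars F ∘ₗ ι 𝒱 +
        (Polynomial.monomial 1).restrictScalars F ∘ₗ ι 𝒱 ∘ₗ (P - LinearMap.id))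
      fun i j x y hx hy => by
        have hx' := Submodule.sub_mem _ (hP.zero_mem hx) hx
        have hy' := Submodule.sub_mem _ (hP.zero_mem hy) hy
        simp only [LinearMap.add_apply, LinearMap.comp_apply, LinearMap.restrictScalars_apply,
          LinearMap.sub_apply, LinearMap.id_apply, add_mul, mul_add,
          Polynomial.monomial_mul_monomial, ι_mul_ι hx hy, ι_mul_ι hx hy', ι_mul_ι hx' hy,
          ι_mul_ι hx' hy', Units.smul_def, map_zsmul, zsmul_add]
        abel
  polySum (fun k => ((k : F) + 1)⁻¹ • LinearMap.id) ∘ₗ LinearMap.mul' F (SymC 𝒱)[X] ∘ₗ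
    TensorProduct.map ((Polynomial.monomial 0).restrictScalars F ∘ₗ ι 𝒱 ∘ₗ h ∘ₗ proj 𝒱)
      φ.toLinearMap ∘ₗ comul 𝒱

end Coder

end SymC

end Sym

/-! ## Differential graded Lie algebras and contractions -/

section DGLA

variable {F g H : Type*} [Field F] [AddCommGroup g] [Module F g] [AddCommGroup H] [Module F H]

/-- A differential graded Lie algebra structure on the graded vector space `(g, 𝒢)`, over a field
of characteristic zero, with a differential of degree `-1`. -/
structure DGLA (𝒢 : ℤ → Submodule F g) where
  d : g →ₗ[F] g
  bracket : g →ₗ[F] g →ₗ[F] g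
  isDifferential : IsDifferential 𝒢 d
  bracket_mem : ∀ i j x y, x ∈ 𝒢 i → y ∈ 𝒢 j → bracket x y ∈ 𝒢 (i + j)
  skew : ∀ i j x y, x ∈ 𝒢 i → y ∈ 𝒢 j →
    bracket x y = -(((-1 : ℤˣ) ^ (i * j) : ℤˣ) • bracket y x)
  jacobi : ∀ i j x y z, x ∈ 𝒢 i → y ∈ 𝒢 j →
    bracket x (bracket y z) =
      bracket (bracket x y) z + ((-1 : ℤˣ) ^ (i * j) : ℤˣ) • bracket y (bracket x z)
  leibniz : ∀ i x y, x ∈ 𝒢 i →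
    d (bracket x y) = bracket (d x) y + ((-1 : ℤˣ) ^ i : ℤˣ) • bracket x (d y)

/-- A contraction `(M ⇄ N, h)` of the chain complex `(N, dN)` onto the chain complex `(M, dM)`. -/
structure Contraction {M N : Type*} [AddCommGroup M] [Module F M] [AddCommGroup N] [Module F N]
    (𝓜 : ℤ → Submodule F M) (𝓝 : ℤ → Submodule F N) (dM : M →ₗ[F] M) (dN : N →ₗ[F] N) where
  π : N →ₗ[F] M
  incl : M →ₗ[F] N
  h : N →ₗ[F] N
  dM_isDifferential : IsDifferential 𝓜 dM
  dN_isDifferential : IsDifferential 𝓝 dN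
  π_deg : IsDeg 𝓝 𝓜 0 π
  incl_deg : IsDeg 𝓜 𝓝 0 incl
  h_deg : IsDeg 𝓝 𝓝 1 h
  π_chain : π ∘ₗ dN = dM ∘ₗ π
  incl_chain : incl ∘ₗ dM = dN ∘ₗ incl
  π_incl : π ∘ₗ incl = LinearMap.id
  homotopy : dN ∘ₗ h + h ∘ₗ dN = incl ∘ₗ π - LinearMap.id
  π_h : π ∘ₗ h = 0
  h_incl : h ∘ₗ incl = 0
  h_h : h ∘ₗ h = 0

/-- The contraction is filtered: all its maps preserve the given filtrations. -/
structure Contraction.IsFiltered {M N : Type*} [AddCommGroup M] [Module F M] [AddCommGroup N]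
    [Module F N] {𝓜 : ℤ → Submodule F M} {𝓝 : ℤ → Submodule F N} {dM : M →ₗ[F] M}
    {dN : N →ₗ[F] N} (K : Contraction 𝓜 𝓝 dM dN) (FM : ℕ → Submodule F M)
    (FN : ℕ → Submodule F N) : Prop where
  dM_mem : ∀ n, ∀ x ∈ FM n, dM x ∈ FM n
  dN_mem : ∀ n, ∀ x ∈ FN n, dN x ∈ FN n
  π_mem : ∀ n, ∀ x ∈ FN n, K.π x ∈ FM n
  incl_mem : ∀ n, ∀ x ∈ FM n, K.incl x ∈ FN n
  h_mem : ∀ n, ∀ x ∈ FN n, K.h x ∈ FN n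

variable {𝒢 : ℤ → Submodule F g} [DirectSum.Decomposition 𝒢] (L : DGLA 𝒢)

/-- The cup bracket `[a, b] = [ , ] ∘ (a ⊗ b) ∘ Δ` of two maps `a, b : S^c[V] → g` of odd degree;
`(a ⊗ b)(x ⊗ y) = (-1)^{|x|} a(x) ⊗ b(y)`. -/
def DGLA.cup {V : Type*} [AddCommGroup V] [Module F V] {𝒱 : ℤ → Submodule F V}
    [DirectSum.Decomposition 𝒱] (a b : SymC 𝒱 →ₗ[F] g) : SymC 𝒱 →ₗ[F] g :=
  TensorProduct.lift L.bracket ∘ₗ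
    TensorProduct.map (a ∘ₗ parity (SymC.deg 𝒱)) b ∘ₗ SymC.comul 𝒱

/-- The universal Lie algebra twisting cochain `S^c[sV] → V` of degree `-1`: the projection onto
`sV`, followed by the desuspension. -/
def univ {V : Type*} [AddCommGroup V] [Module F V] (𝒱 : ℤ → Submodule F V) :
    SymC (susp 𝒱) →ₗ[F] V :=
  SymC.proj (susp 𝒱)

/-- The differential on `S^c[sg]` induced by the differential `d` of `g`. -/
def DGLA.dS : SymC (susp 𝒢) →ₗ[F] SymC (susp 𝒢) :=
  SymC.coder (susp 𝒢) (L.d ∘ₗ univ 𝒢)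

/-- The coderivation `∂` of `S^c[sg]` induced by the bracket of `g`: its projection to the letters
is `½[τ_g, τ_g]` for the universal twisting cochain `τ_g`, that is,
`sx sy ↦ (-1)^{|sx|} s[x, y]`, and zero on the words of length different from two. -/
def DGLA.partial : SymC (susp 𝒢) →ₗ[F] SymC (susp 𝒢) :=
  SymC.coder (susp 𝒢) ((2 : F)⁻¹ • L.cup (univ 𝒢) (univ 𝒢))

/-! In what follows `C` is a contraction of `(g, d)` onto a graded vector space `H` with zero
differential, for instance the homology `H(g)`; such an `H` is always isomorphic to `H(g)`, by
`π` and `∇ = C.incl`. -/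

variable {L} {𝓗 : ℤ → Submodule F H} [DirectSum.Decomposition 𝓗] (C : Contraction 𝓗 𝒢 0 L.d)

namespace Contraction

/-- `S^cπ : S^c[sg] → S^c[sH]`. -/
def Sπ : SymC (susp 𝒢) →ₗ[F] SymC (susp 𝓗) := (SymC.map C.π C.π_deg.susp).toLinearMap

/-- `S^ch` on `S^c[sg]`. -/
def Sh : SymC (susp 𝒢) →ₗ[F] SymC (susp 𝒢) :=
  SymC.symHomotopy C.h (C.incl ∘ₗ C.π) (C.incl_deg.comp_zero C.π_deg).susp

/-- The components `τ¹ = ∇ τ_H` and `τᵇ = ½ h ([τ¹, τᵇ⁻¹] + ⋯ + [τᵇ⁻¹, τ¹])`, `b ≥ 2`. -/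
def tauComp : ℕ → (SymC (susp 𝓗) →ₗ[F] g)
  | 0 => 0
  | 1 => C.incl ∘ₗ univ 𝓗
  | b + 2 => (2 : F)⁻¹ • C.h ∘ₗ
      ∑ i : Fin (b + 1), L.cup (tauComp (i + 1)) (tauComp (b + 1 - i))
  termination_by b => b
  decreasing_by all_goals omega

/-- The twisting cochain `τ = τ¹ + τ² + ⋯ : S^c[sH] → g`. -/
def tau : SymC (susp 𝓗) →ₗ[F] g := SymC.total (susp 𝓗) C.tauComp

/-- The perturbed differential `D = D¹ + D² + ⋯` on `S^c[sH]`, where `Dᵇ⁻¹` is the coderivation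
with `τ_H Dᵇ⁻¹ = ½ π ([τ¹, τᵇ⁻¹] + ⋯ + [τᵇ⁻¹, τ¹])`, `b ≥ 2`. -/
def D : SymC (susp 𝓗) →ₗ[F] SymC (susp 𝓗) :=
  SymC.coder (susp 𝓗) (SymC.total (susp 𝓗) fun b =>
    (2 : F)⁻¹ • C.π ∘ₗ ∑ i ∈ Finset.Ico 1 b, L.cup (C.tauComp i) (C.tauComp (b - i)))

/-- The new contraction of `S^c_∂[sg]`, with differential `d + ∂`, onto `S^c_D[sH]` may be taken to
have the projection `p`: there is a filtered contraction whose projection is `p`, whose inclusion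
is the adjoint `(S^c∇)_∂` of `τ`, that is, the morphism of coaugmented coalgebras with
`τ_g (S^c∇)_∂ = τ`, and whose homotopy is the perturbation
`(S^ch)_∂ = ∑ₙ S^ch (∂ S^ch)ⁿ` of `S^ch` (a finite sum on each element). -/
def HasPerturbedContraction (p : SymC (susp 𝒢) →ₗ[F] SymC (susp 𝓗)) : Prop :=
  ∃ K : Contraction (SymC.deg (susp 𝓗)) (SymC.deg (susp 𝒢)) C.D (L.dS + L.partial),
    K.IsFiltered (SymC.filt (susp 𝓗)) (SymC.filt (susp 𝒢)) ∧
    K.π = p ∧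
    SymC.IsCoalgHom (susp 𝓗) (susp 𝒢) K.incl ∧
    univ 𝒢 ∘ₗ K.incl = C.tau ∧
    ∀ x, ∃ n₀ : ℕ, ∀ n ≥ n₀,
      K.h x = ∑ k ∈ Finset.range n, (C.Sh ∘ₗ (L.partial ∘ₗ C.Sh) ^ k) x

end Contraction

end DGLA

end HPT

end

/-! Write δ = d + ∂, P = ∇π and E = (S^c∇)_∂. The operator ∂ shortens words by one and S^ch does not
lengthen them, so ∂ S^ch is locally nilpotent and the perturbation lemma applies to the contraction
of (S^c[sg], d) onto S^c[sH]. From S^cπ ∂ = D' S^cπ and S^cπ S^ch = 0 follows S^cπ ∂ S^ch = 0, so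
the projection receives no correction. What remains is to recognise E and D as the perturbed
inclusion and differential.

Summing the recursion gives τ = ∇τ_H + h(½[τ,τ]) (`tau_eq`), whence πτ = τ_H and hτ = 0. Three
identities follow for every ∂ coming from a bracket: S^cπ E = id, because both sides are coalgebra
morphisms with the same projection to the letters (`Sπ_comp_tauAdjoint`); D = S^cπ ∂ E
(`D_eq_Sπ_partial_tauAdjoint`); S^ch ∂ E = E - S^c∇ (`Sh_partial_tauAdjoint`), the fixed-point
equation of a perturbed inclusion. For the last one, S^ch is an integral over t in [0, 1] of
operators H_t which hit one letter by h and the others by (1 - t) + tP. The equation for τ turns H_t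
∂ E into minus the t-derivative of S^c((1 - t) + tP) E, and the fundamental theorem of calculus
evaluates the integral as (id - S^cP) E = E - S^c∇.

Now D = S^cπ ∂ E = D' S^cπ E = D'. The ring identity `perturbed_homotopy` gives the homotopy
relation between E S^cπ and id; it implies that E is a chain map. The equation D² = 0 descends from
δ² = 0 along the surjection S^cπ. Finally δ² = 0 is d² = 0, the Leibniz rule and the Jacobi identity
(`DGLA.chevalley_comp_coder`). Part (b) is the case D' = 0, and in (c) every word in the image of ∂
contains a bracket, which π kills. -/

open scoped DirectSum TensorProduct Polynomial

noncomputable section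

namespace HPT

/-! ### Koszul signs as scalars -/

section Sign

variable (F : Type*) [Field F]

/-- The sign `(-1)^n`, as a scalar. -/
def sgn (n : ℤ) : F := if Even n then 1 else -1

variable {F}

/-- With signs taken in F, linear maps commute with them and `smul_smul`, `sgn_add` merge them into
one. -/
theorem units_smul_eq {M : Type*} [AddCommGroup M] [Module F M] (n : ℤ) (x : M) :
    ((-1 : ℤˣ) ^ n : ℤˣ) • x = sgn F n • x := by
  unfold sgn
  split_ifs with h
  · rw [h.neg_one_zpow, one_smul, one_smul]
  · rw [(Int.not_even_iff_odd.1 h).neg_one_zpow, Units.neg_smul, one_smul, neg_smul, one_smul]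

theorem sgn_add (m n : ℤ) : sgn F (m + n) = sgn F m * sgn F n := by
  unfold sgn
  by_cases hm : Even m <;> by_cases hn : Even n <;> simp [Int.even_add, hm, hn]

theorem sgn_of_even {n : ℤ} (h : Even n) : sgn F n = 1 := if_pos h

theorem sgn_of_odd {n : ℤ} (h : Odd n) : sgn F n = -1 := if_neg (Int.not_even_iff_odd.2 h)

@[simp]
theorem sgn_zero : sgn F 0 = 1 := sgn_of_even (by simp)

@[simp]
theorem sgn_one : sgn F 1 = -1 := sgn_of_odd (by simp)

@[simp]
theorem sgn_mul_self (n : ℤ) : sgn F n * sgn F n = 1 := by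
  rw [← sgn_add, sgn_of_even (by simp)]

/-- Together with `sgn_eq_neg`, this reduces sign comparisons to propositional statements about
parities, which `tauto` can settle. -/
theorem sgn_congr {m n : ℤ} (h : Even m ↔ Even n) : sgn F m = sgn F n := by
  simp [sgn, h]

theorem sgn_eq_neg {m n : ℤ} (h : Even m ↔ ¬ Even n) : sgn F m = -sgn F n := by
  unfold sgn
  by_cases hn : Even n <;> simp [h, hn]

end Sign

/-! ### Gradings, the parity operator and homogeneous maps -/

section Twist

variable {F V W : Type*} [Field F] [AddCommGroup V] [Module F V] [AddCommGroup W] [Module F W]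

/-- Multiplication of the elements of degree `i` by `(-1)^{ki}`. -/
def twist (𝒱 : ℤ → Submodule F V) [DirectSum.Decomposition 𝒱] (k : ℤ) : V →ₗ[F] V :=
  DirectSum.toModule F ℤ V (fun i => sgn F (k * i) • (𝒱 i).subtype) ∘ₗ
    (DirectSum.decomposeLinearEquiv 𝒱).toLinearMap

variable {𝒱 : ℤ → Submodule F V} [DirectSum.Decomposition 𝒱]

theorem twist_apply {i : ℤ} {x : V} (hx : x ∈ 𝒱 i) (k : ℤ) :
    twist 𝒱 k x = sgn F (k * i) • x := by
  have : DirectSum.decompose 𝒱 x = DirectSum.of (fun i => 𝒱 i) i ⟨x, hx⟩ :=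
    DirectSum.decompose_of_mem 𝒱 hx
  simp only [twist, LinearMap.comp_apply, LinearEquiv.coe_coe,
    DirectSum.decomposeLinearEquiv_apply, this]
  rw [← DirectSum.lof_eq_of F, DirectSum.toModule_lof]
  rfl

theorem parity_eq_twist : parity 𝒱 = twist 𝒱 1 := by
  unfold parity twist
  congr 1
  congr 1
  funext i
  ext x
  simp [units_smul_eq (F := F)]

theorem parity_apply {i : ℤ} {x : V} (hx : x ∈ 𝒱 i) : parity 𝒱 x = sgn F i • x := by
  rw [parity_eq_twist, twist_apply hx, one_mul]

theorem hom_ext_deg {f g : V →ₗ[F] W} (h : ∀ i, ∀ x ∈ 𝒱 i, f x = g x) : f = g := by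
  ext x
  induction x using DirectSum.Decomposition.inductionOn 𝒱 with
  | zero => simp
  | homogeneous x => exact h _ _ x.2
  | add x y hx hy => simp [hx, hy]

theorem parity_comp_parity : parity 𝒱 ∘ₗ parity 𝒱 = LinearMap.id :=
  hom_ext_deg (𝒱 := 𝒱) fun i x hx => by
    simp [parity_apply hx, smul_smul]

theorem IsDeg.comp_parity {𝒲 : ℤ → Submodule F W} {k : ℤ} {f : V →ₗ[F] W} (hf : IsDeg 𝒱 𝒲 k f) :
    IsDeg 𝒱 𝒲 k (f ∘ₗ parity 𝒱) := fun i x hx => by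
  rw [LinearMap.comp_apply, parity_apply hx, map_smul]
  exact Submodule.smul_mem _ _ (hf i x hx)

theorem parity_comp {𝒲 : ℤ → Submodule F W} [DirectSum.Decomposition 𝒲] {k : ℤ} {f : V →ₗ[F] W}
    (hf : IsDeg 𝒱 𝒲 k f) : parity 𝒲 ∘ₗ f = sgn F k • (f ∘ₗ parity 𝒱) :=
  hom_ext_deg (𝒱 := 𝒱) fun i x hx => by
    simp [parity_apply hx, parity_apply (hf i x hx), smul_smul, sgn_add, mul_comm]

theorem IsDeg.comp {X : Type*} [AddCommGroup X] [Module F X] {𝒱 : ℤ → Submodule F V}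
    {𝒲 : ℤ → Submodule F W} {𝒳 : ℤ → Submodule F X} {k l : ℤ} {f : W →ₗ[F] X} {g : V →ₗ[F] W}
    (hf : IsDeg 𝒲 𝒳 k f) (hg : IsDeg 𝒱 𝒲 l g) : IsDeg 𝒱 𝒳 (l + k) (f ∘ₗ g) := fun i x hx => by
  rw [← add_assoc]
  exact hf _ _ (hg i x hx)

theorem IsDeg.add {𝒱 : ℤ → Submodule F V} {𝒲 : ℤ → Submodule F W} {k : ℤ} {f g : V →ₗ[F] W}
    (hf : IsDeg 𝒱 𝒲 k f) (hg : IsDeg 𝒱 𝒲 k g) : IsDeg 𝒱 𝒲 k (f + g) := fun i x hx =>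
  Submodule.add_mem _ (hf i x hx) (hg i x hx)

theorem IsDeg.smul {𝒱 : ℤ → Submodule F V} {𝒲 : ℤ → Submodule F W} {k : ℤ} {f : V →ₗ[F] W}
    (hf : IsDeg 𝒱 𝒲 k f) (c : F) : IsDeg 𝒱 𝒲 k (c • f) := fun i x hx =>
  Submodule.smul_mem _ c (hf i x hx)

theorem IsDeg.sum {ι : Type*} {s : Finset ι} {𝒱 : ℤ → Submodule F V} {𝒲 : ℤ → Submodule F W}
    {k : ℤ} {f : ι → V →ₗ[F] W} (hf : ∀ a ∈ s, IsDeg 𝒱 𝒲 k (f a)) :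
    IsDeg 𝒱 𝒲 k (∑ a ∈ s, f a) := fun i x hx => by
  rw [LinearMap.sum_apply]
  exact Submodule.sum_mem _ fun a ha => hf a ha i x hx

theorem isDeg_id {𝒱 : ℤ → Submodule F V} : IsDeg 𝒱 𝒱 0 (LinearMap.id : V →ₗ[F] V) :=
  fun i x hx => by simpa using hx

end Twist

/-! ### Words in homogeneous letters, degree and filtration -/

namespace SymC

variable {F V W : Type*} [Field F] [AddCommGroup V] [Module F V] [AddCommGroup W] [Module F W]
  {𝒱 : ℤ → Submodule F V} {𝒲 : ℤ → Submodule F W}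

theorem ι_mul_ι' {i j : ℤ} {x y : V} (hx : x ∈ 𝒱 i) (hy : y ∈ 𝒱 j) :
    ι 𝒱 x * ι 𝒱 y = sgn F (i * j) • (ι 𝒱 y * ι 𝒱 x) := by
  rw [ι_mul_ι hx hy, units_smul_eq (F := F)]

variable (𝒱) in
/-- `x` is a word of length `n` in homogeneous letters, of total degree `m`. -/
inductive IsWord : ℕ → ℤ → SymC 𝒱 → Prop
  | one : IsWord 0 0 1
  | mul {i m : ℤ} {n : ℕ} {v : V} {x : SymC 𝒱} (hv : v ∈ 𝒱 i) (hx : IsWord n m x) :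
      IsWord (n + 1) (i + m) (ι 𝒱 v * x)

theorem isWord_prod (l : List (Σ i, 𝒱 i)) :
    IsWord 𝒱 l.length (l.map fun v => v.1).sum (l.map fun v => ι 𝒱 (v.2 : V)).prod := by
  induction l with
  | nil => simpa using IsWord.one
  | cons v l ih => simpa using IsWord.mul v.2.2 ih

theorem IsWord.mem_deg {n : ℕ} {m : ℤ} {x : SymC 𝒱} (hx : IsWord 𝒱 n m x) : x ∈ deg 𝒱 m := by
  induction hx with
  | one => exact SetLike.GradedOne.one_mem
  | mul hv _ ih => exact SetLike.GradedMul.mul_mem (ι_mem_deg 𝒱 hv) ih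

theorem deg_eq_span (m : ℤ) : deg 𝒱 m = Submodule.span F {x | ∃ n, IsWord 𝒱 n m x} := by
  refine le_antisymm (Submodule.span_mono ?_) (Submodule.span_le.2 ?_)
  · rintro _ ⟨l, rfl, rfl⟩
    exact ⟨_, isWord_prod l⟩
  · rintro x ⟨n, hx⟩
    exact hx.mem_deg

theorem IsWord.mem_pow {n : ℕ} {m : ℤ} {x : SymC 𝒱} (hx : IsWord 𝒱 n m x) :
    x ∈ LinearMap.range (ι 𝒱) ^ n := by
  induction hx with
  | one => rw [pow_zero]; exact Submodule.one_le.1 le_rfl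
  | mul hv _ ih => rw [pow_succ']; exact Submodule.mul_mem_mul ⟨_, rfl⟩ ih

theorem IsWord.mem_filt {n N : ℕ} {m : ℤ} {x : SymC 𝒱} (hx : IsWord 𝒱 n m x) (h : n ≤ N) :
    x ∈ filt 𝒱 N :=
  Submodule.mem_iSup_of_mem n (Submodule.mem_iSup_of_mem h hx.mem_pow)

theorem filt_mono {m n : ℕ} (h : m ≤ n) : filt 𝒱 m ≤ filt 𝒱 n :=
  iSup₂_le fun k hk => le_iSup₂_of_le k (hk.trans h) le_rfl

theorem filt_zero : filt 𝒱 0 = Submodule.span F {1} := by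
  simp [filt, Submodule.one_eq_span]

theorem isDeg_of_word {f : SymC 𝒱 →ₗ[F] W} {k : ℤ}
    (h : ∀ n m x, IsWord 𝒱 n m x → f x ∈ 𝒲 (m + k)) : IsDeg (deg 𝒱) 𝒲 k f := by
  intro i
  have : deg 𝒱 i ≤ (𝒲 (i + k)).comap f := by
    rw [deg_eq_span, Submodule.span_le]
    rintro x ⟨n, hx⟩
    exact h n i x hx
  exact this

section Decomp

variable [DirectSum.Decomposition 𝒱] [DirectSum.Decomposition 𝒲]

theorem pow_eq_span (n : ℕ) :
    LinearMap.range (ι 𝒱) ^ n = Submodule.span F {x | ∃ m, IsWord 𝒱 n m x} := by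
  refine le_antisymm ?_ (Submodule.span_le.2 fun x ⟨m, hx⟩ => hx.mem_pow)
  induction n with
  | zero =>
    rw [pow_zero, Submodule.one_le]
    exact Submodule.subset_span ⟨0, IsWord.one⟩
  | succ n ih =>
    have h1 : LinearMap.range (ι 𝒱) ≤ Submodule.span F {x | ∃ m, ∃ v ∈ 𝒱 m, x = ι 𝒱 v} := by
      rintro _ ⟨v, rfl⟩
      induction v using DirectSum.Decomposition.inductionOn 𝒱 with
      | zero => simp
      | homogeneous x => exact Submodule.subset_span ⟨_, x, x.2, rfl⟩
      | add x y hx hy => rw [map_add]; exact Submodule.add_mem _ hx hy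
    rw [pow_succ']
    refine (mul_le_mul' h1 ih).trans ?_
    rw [Submodule.span_mul_span, Submodule.span_le]
    rintro _ ⟨_, ⟨i, v, hv, rfl⟩, _, ⟨m, hx⟩, rfl⟩
    exact Submodule.subset_span ⟨_, IsWord.mul hv hx⟩

theorem filt_eq_span (N : ℕ) :
    filt 𝒱 N = Submodule.span F {x | ∃ n m, n ≤ N ∧ IsWord 𝒱 n m x} := by
  refine le_antisymm (iSup₂_le fun k hk => ?_) (Submodule.span_le.2 ?_)
  · rw [pow_eq_span]
    exact Submodule.span_mono fun x ⟨m, hx⟩ => ⟨k, m, hk, hx⟩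
  · rintro x ⟨n, m, hn, hx⟩
    exact hx.mem_filt hn

theorem mem_span_isWord (x : SymC 𝒱) : x ∈ Submodule.span F {x | ∃ n m, IsWord 𝒱 n m x} := by
  induction x using DirectSum.Decomposition.inductionOn (deg 𝒱) with
  | zero => simp
  | homogeneous x =>
    have := (deg_eq_span (𝒱 := 𝒱) _).le x.2
    refine Submodule.span_mono ?_ this
    rintro x ⟨n, hx⟩
    exact ⟨n, _, hx⟩
  | add x y hx hy => exact Submodule.add_mem _ hx hy

theorem hom_ext_word {f g : SymC 𝒱 →ₗ[F] W} (h : ∀ n m x, IsWord 𝒱 n m x → f x = g x) : f = g :=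
  LinearMap.ext fun x => by
    refine (Submodule.span_le (p := LinearMap.eqLocus f g)).2 ?_ (mem_span_isWord x)
    rintro x ⟨n, m, hx⟩
    exact h n m x hx

theorem exists_mem_filt (x : SymC 𝒱) : ∃ n, x ∈ filt 𝒱 n := by
  induction mem_span_isWord x using Submodule.span_induction with
  | mem x hx => obtain ⟨n, m, hx⟩ := hx; exact ⟨n, hx.mem_filt le_rfl⟩
  | zero => exact ⟨0, Submodule.zero_mem _⟩
  | add x y _ _ hx hy =>
    obtain ⟨a, ha⟩ := hx
    obtain ⟨b, hb⟩ := hy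
    exact ⟨max a b, Submodule.add_mem _ (filt_mono (le_max_left _ _) ha)
      (filt_mono (le_max_right _ _) hb)⟩
  | smul c x _ hx => obtain ⟨a, ha⟩ := hx; exact ⟨a, Submodule.smul_mem _ _ ha⟩

theorem mapsTo_filt {f : SymC 𝒱 →ₗ[F] W} {N : ℕ} {P : Submodule F W}
    (h : ∀ n m x, n ≤ N → IsWord 𝒱 n m x → f x ∈ P) : ∀ x ∈ filt 𝒱 N, f x ∈ P := by
  have : filt 𝒱 N ≤ P.comap f := by
    rw [filt_eq_span, Submodule.span_le]
    rintro x ⟨n, m, hn, hx⟩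
    exact h n m x hn hx
  exact this

/-! ### The comultiplication on words -/

@[simp]
theorem comul_one : comul 𝒱 1 = 1 ⊗ₜ[F] 1 := by
  simp only [comul, LinearMap.comp_apply, AlgHom.toLinearMap_apply, map_one]
  rfl

theorem comulHom_ι (v : V) :
    comulHom 𝒱 (ι 𝒱 v) = (ι 𝒱 v ᵍ⊗ₜ[F] 1 + 1 ᵍ⊗ₜ[F] ι 𝒱 v : (deg 𝒱) ᵍ⊗[F] (deg 𝒱)) := by
  rw [comulHom, lift_ι]
  simp

theorem comul_ι (v : V) : comul 𝒱 (ι 𝒱 v) = ι 𝒱 v ⊗ₜ[F] 1 + 1 ⊗ₜ[F] ι 𝒱 v := by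
  simp only [comul, LinearMap.comp_apply, AlgHom.toLinearMap_apply, comulHom_ι]
  rfl

theorem graded_left_mul (a : SymC 𝒱) (t : SymC 𝒱 ⊗[F] SymC 𝒱) :
    (a ᵍ⊗ₜ[F] 1 * GradedTensorProduct.of F (deg 𝒱) (deg 𝒱) t : (deg 𝒱) ᵍ⊗[F] (deg 𝒱)) =
      GradedTensorProduct.of F (deg 𝒱) (deg 𝒱)
        (TensorProduct.map (LinearMap.mulLeft F a) LinearMap.id t) := by
  induction t with
  | zero => simp
  | add x y hx hy => rw [map_add, mul_add, hx, hy, map_add, map_add]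
  | tmul x y =>
    induction x using DirectSum.Decomposition.inductionOn (deg 𝒱) with
    | zero => simp
    | homogeneous x => exact GradedTensorProduct.tmul_one_mul_coe_tmul (R := F) _ _ a x y
    | add x y hx hy => rw [TensorProduct.add_tmul, map_add, mul_add, hx, hy, map_add, map_add]

theorem graded_right_mul {i : ℤ} {a : SymC 𝒱} (ha : a ∈ deg 𝒱 i) (t : SymC 𝒱 ⊗[F] SymC 𝒱) :
    (1 ᵍ⊗ₜ[F] a * GradedTensorProduct.of F (deg 𝒱) (deg 𝒱) t : (deg 𝒱) ᵍ⊗[F] (deg 𝒱)) =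
      GradedTensorProduct.of F (deg 𝒱) (deg 𝒱)
        (TensorProduct.map (twist (deg 𝒱) i) (LinearMap.mulLeft F a) t) := by
  induction t with
  | zero => simp
  | add x y hx hy => rw [map_add, mul_add, hx, hy, map_add, map_add]
  | tmul x y =>
    induction x using DirectSum.Decomposition.inductionOn (deg 𝒱) with
    | zero => simp
    | @homogeneous j x =>
      have := GradedTensorProduct.tmul_coe_mul_coe_tmul (R := F) (deg 𝒱) (deg 𝒱) 1 ⟨a, ha⟩ x y
      refine this.trans ?_
      rw [units_smul_eq (F := F), TensorProduct.map_tmul, twist_apply x.2, one_mul,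
        ← TensorProduct.smul_tmul', map_smul]
      rfl
    | add x y hx hy => rw [TensorProduct.add_tmul, map_add, mul_add, hx, hy, map_add, map_add]

/-- Δ is multiplicative and v is primitive; `twist` records the sign of moving v past the left
tensor factor. This recursion drives the inductions on word length. -/
theorem comul_ι_mul {i : ℤ} {v : V} (hv : v ∈ 𝒱 i) (x : SymC 𝒱) :
    comul 𝒱 (ι 𝒱 v * x) =
      TensorProduct.map (LinearMap.mulLeft F (ι 𝒱 v)) LinearMap.id (comul 𝒱 x) +
      TensorProduct.map (twist (deg 𝒱) i) (LinearMap.mulLeft F (ι 𝒱 v)) (comul 𝒱 x) := by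
  apply (GradedTensorProduct.of F (deg 𝒱) (deg 𝒱)).injective
  rw [map_add, ← graded_left_mul, ← graded_right_mul (ι_mem_deg 𝒱 hv), ← add_mul]
  simp only [comul, LinearMap.comp_apply, AlgHom.toLinearMap_apply, map_mul, comulHom_ι]
  rfl

/-- Unshuffling distributes both the letters and the degree, so an identity between maps out of the
tensor square, evaluated on Δ(x), need only be tested on pairs of words of complementary length and
degree. -/
theorem IsWord.comul_mem {n : ℕ} {m : ℤ} {x : SymC 𝒱} (hx : IsWord 𝒱 n m x) :
    comul 𝒱 x ∈ Submodule.span F {t | ∃ n₁ n₂ m₁ m₂ y z, IsWord 𝒱 n₁ m₁ y ∧ IsWord 𝒱 n₂ m₂ z ∧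
      n₁ + n₂ = n ∧ m₁ + m₂ = m ∧ t = y ⊗ₜ[F] z} := by
  induction hx with
  | one =>
    rw [comul_one]
    exact Submodule.subset_span ⟨0, 0, 0, 0, 1, 1, IsWord.one, IsWord.one, rfl, rfl, rfl⟩
  | @mul i m n v x hv hx ih =>
    rw [comul_ι_mul hv]
    generalize comul 𝒱 x = t at ih
    induction ih using Submodule.span_induction with
    | zero => simp
    | add t t' _ _ h h' =>
      rw [map_add, map_add, add_add_add_comm]
      exact Submodule.add_mem _ h h'
    | smul c t _ h =>
      rw [map_smul, map_smul, ← smul_add]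
      exact Submodule.smul_mem _ _ h
    | mem t ht =>
      obtain ⟨n₁, n₂, m₁, m₂, y, z, hy, hz, rfl, rfl, rfl⟩ := ht
      rw [TensorProduct.map_tmul, TensorProduct.map_tmul, twist_apply hy.mem_deg,
        ← TensorProduct.smul_tmul']
      refine Submodule.add_mem _ (Submodule.subset_span
        ⟨n₁ + 1, n₂, i + m₁, m₂, _, _, .mul hv hy, hz, by omega, by omega, rfl⟩)
        (Submodule.smul_mem _ _ (Submodule.subset_span
        ⟨n₁, n₂ + 1, m₁, i + m₂, _, _, hy, .mul hv hz, by omega, by omega, rfl⟩))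

theorem IsWord.comul_induction {n : ℕ} {m : ℤ} {x : SymC 𝒱} (hx : IsWord 𝒱 n m x)
    {Φ : SymC 𝒱 ⊗[F] SymC 𝒱 →ₗ[F] W} {P : Submodule F W}
    (h : ∀ n₁ n₂ m₁ m₂ y z, IsWord 𝒱 n₁ m₁ y → IsWord 𝒱 n₂ m₂ z → n₁ + n₂ = n → m₁ + m₂ = m →
      Φ (y ⊗ₜ[F] z) ∈ P) : Φ (comul 𝒱 x) ∈ P := by
  refine (Submodule.span_le (p := P.comap Φ)).2 ?_ hx.comul_mem
  rintro _ ⟨n₁, n₂, m₁, m₂, y, z, hy, hz, hn, hm, rfl⟩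
  exact h _ _ _ _ _ _ hy hz hn hm

theorem IsWord.comul_congr {n : ℕ} {m : ℤ} {x : SymC 𝒱} (hx : IsWord 𝒱 n m x)
    {Φ Ψ : SymC 𝒱 ⊗[F] SymC 𝒱 →ₗ[F] W}
    (h : ∀ n₁ n₂ m₁ m₂ y z, IsWord 𝒱 n₁ m₁ y → IsWord 𝒱 n₂ m₂ z → n₁ + n₂ = n → m₁ + m₂ = m →
      Φ (y ⊗ₜ[F] z) = Ψ (y ⊗ₜ[F] z)) : Φ (comul 𝒱 x) = Ψ (comul 𝒱 x) := by
  refine (Submodule.span_le (p := LinearMap.eqLocus Φ Ψ)).2 ?_ hx.comul_mem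
  rintro _ ⟨n₁, n₂, m₁, m₂, y, z, hy, hz, hn, hm, rfl⟩
  exact h _ _ _ _ _ _ hy hz hn hm

/-- Equality of linear maps, by induction on the length of the words. -/
theorem hom_ext_ι_mul {f g : SymC 𝒱 →ₗ[F] W} (h1 : f 1 = g 1)
    (h : ∀ i, ∀ v ∈ 𝒱 i, ∀ x, f x = g x → f (ι 𝒱 v * x) = g (ι 𝒱 v * x)) : f = g :=
  hom_ext_word fun n m x hx => by
    induction hx with
    | one => exact h1
    | mul hv _ ih => exact h _ _ hv _ ih

end Decomp

end SymC

/-! ### Counit, coassociativity and cocommutativity -/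

namespace SymC

section Coalg

variable {F V W : Type*} [Field F] [AddCommGroup V] [Module F V] [AddCommGroup W] [Module F W]
  {𝒱 : ℤ → Submodule F V} [DirectSum.Decomposition 𝒱]

omit [DirectSum.Decomposition 𝒱] in
@[simp]
theorem counit_ι (v : V) : counit 𝒱 (ι 𝒱 v) = 0 := by simp [counit]

omit [DirectSum.Decomposition 𝒱] in
theorem IsWord.counit_eq_zero {n : ℕ} {m : ℤ} {x : SymC 𝒱} (hx : IsWord 𝒱 n m x) (h : n ≠ 0) :
    counit 𝒱 x = 0 := by
  cases hx with
  | one => exact absurd rfl h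
  | mul hv _ => simp

theorem twist_one (k : ℤ) : twist (deg 𝒱) k (1 : SymC 𝒱) = 1 := by
  rw [twist_apply (SetLike.GradedOne.one_mem : (1 : SymC 𝒱) ∈ deg 𝒱 0)]
  simp

theorem counit_twist (k : ℤ) (x : SymC 𝒱) : counit 𝒱 (twist (deg 𝒱) k x) = counit 𝒱 x := by
  have : (counit 𝒱).toLinearMap ∘ₗ twist (deg 𝒱) k = (counit 𝒱).toLinearMap :=
    hom_ext_word fun n m x hx => by
      rcases eq_or_ne n 0 with rfl | h
      · cases hx
        simp [twist_one]
      · simp [twist_apply hx.mem_deg, hx.counit_eq_zero h]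
  exact LinearMap.congr_fun this x

theorem comul_twist (k : ℤ) : comul 𝒱 ∘ₗ twist (deg 𝒱) k =
    TensorProduct.map (twist (deg 𝒱) k) (twist (deg 𝒱) k) ∘ₗ comul 𝒱 :=
  hom_ext_word fun n m x hx => by
    simp only [LinearMap.comp_apply, twist_apply hx.mem_deg, map_smul]
    change (sgn F (k * m) • (LinearMap.id : SymC 𝒱 ⊗[F] SymC 𝒱 →ₗ[F] _)) (comul 𝒱 x) = _
    refine hx.comul_congr fun n₁ n₂ m₁ m₂ y z hy hz _ hm => ?_
    simp [twist_apply hy.mem_deg, twist_apply hz.mem_deg, TensorProduct.smul_tmul', smul_smul,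
      TensorProduct.tmul_smul, ← hm, mul_add, sgn_add, mul_comm]

/-- Both iterated coproducts of vx arise from those of x by one and the same operator, so induction
on the length applies. -/
theorem comul_coassoc :
    (TensorProduct.assoc F (SymC 𝒱) (SymC 𝒱) (SymC 𝒱)).toLinearMap ∘ₗ
      (comul 𝒱).rTensor (SymC 𝒱) ∘ₗ comul 𝒱 = (comul 𝒱).lTensor (SymC 𝒱) ∘ₗ comul 𝒱 := by
  refine hom_ext_ι_mul (by simp) fun i v hv x ih => ?_
  have h1 : comul 𝒱 ∘ₗ LinearMap.mulLeft F (ι 𝒱 v) =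
      TensorProduct.map (LinearMap.mulLeft F (ι 𝒱 v)) LinearMap.id ∘ₗ comul 𝒱 +
      TensorProduct.map (twist (deg 𝒱) i) (LinearMap.mulLeft F (ι 𝒱 v)) ∘ₗ comul 𝒱 :=
    LinearMap.ext fun x => comul_ι_mul hv x
  have h2 := comul_twist (𝒱 := 𝒱) i
  set l := LinearMap.mulLeft F (ι 𝒱 v)
  set t := twist (deg 𝒱) i
  -- M is multiplication by v ⊗ 1 ⊗ 1 + 1 ⊗ v ⊗ 1 + 1 ⊗ 1 ⊗ v, with Koszul signs.
  set M : SymC 𝒱 ⊗[F] (SymC 𝒱 ⊗[F] SymC 𝒱) →ₗ[F] SymC 𝒱 ⊗[F] (SymC 𝒱 ⊗[F] SymC 𝒱) :=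
    TensorProduct.map l LinearMap.id +
      TensorProduct.map t (TensorProduct.map l LinearMap.id + TensorProduct.map t l) with hM
  have hl : ∀ u : SymC 𝒱 ⊗[F] SymC 𝒱, TensorProduct.assoc F _ _ _ ((comul 𝒱).rTensor _
      (TensorProduct.map l LinearMap.id u + TensorProduct.map t l u)) =
      M (TensorProduct.assoc F _ _ _ ((comul 𝒱).rTensor _ u)) := by
    intro u
    induction u with
    | zero => simp only [map_zero, add_zero]
    | add a b ha hb =>
      simp only [map_add] at ha hb ⊢
      linear_combination (norm := abel) ha + hb
    | tmul a b =>
      have e1 := LinearMap.congr_fun h1 a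
      have e2 := LinearMap.congr_fun h2 a
      simp only [LinearMap.comp_apply, LinearMap.add_apply] at e1 e2
      simp only [TensorProduct.map_tmul, map_add, LinearMap.rTensor_tmul, LinearMap.id_apply, e1, e2,
        TensorProduct.add_tmul]
      generalize comul 𝒱 a = w
      induction w with
      | zero => simp only [map_zero, add_zero, TensorProduct.zero_tmul]
      | add c d hc hd =>
        simp only [map_add, TensorProduct.add_tmul] at hc hd ⊢
        linear_combination (norm := abel) hc + hd
      | tmul c d =>
        simp only [TensorProduct.map_tmul, TensorProduct.assoc_tmul, hM, LinearMap.add_apply,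
          LinearMap.id_apply, TensorProduct.tmul_add, add_assoc]
  have hr : ∀ u : SymC 𝒱 ⊗[F] SymC 𝒱, (comul 𝒱).lTensor _
      (TensorProduct.map l LinearMap.id u + TensorProduct.map t l u) =
      M ((comul 𝒱).lTensor _ u) := by
    intro u
    induction u with
    | zero => simp only [map_zero, add_zero]
    | add a b ha hb =>
      simp only [map_add] at ha hb ⊢
      linear_combination (norm := abel) ha + hb
    | tmul a b =>
      have e1 := LinearMap.congr_fun h1 b
      simp only [LinearMap.comp_apply, LinearMap.add_apply] at e1
      simp only [TensorProduct.map_tmul, map_add, LinearMap.lTensor_tmul, LinearMap.id_apply, e1,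
        TensorProduct.tmul_add, LinearMap.add_apply, hM]
  simp only [LinearMap.comp_apply, LinearEquiv.coe_coe] at ih ⊢
  rw [comul_ι_mul hv, hl, hr, ih]

theorem rTensor_counit : (counit 𝒱).toLinearMap.rTensor (SymC 𝒱) ∘ₗ comul 𝒱 =
    TensorProduct.mk F F (SymC 𝒱) 1 :=
  hom_ext_ι_mul (by simp) fun i v hv x ih => by
    have h : ∀ u : SymC 𝒱 ⊗[F] SymC 𝒱, (counit 𝒱).toLinearMap.rTensor (SymC 𝒱)
        (TensorProduct.map (LinearMap.mulLeft F (ι 𝒱 v)) LinearMap.id u +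
          TensorProduct.map (twist (deg 𝒱) i) (LinearMap.mulLeft F (ι 𝒱 v)) u) =
        (LinearMap.mulLeft F (ι 𝒱 v)).lTensor F ((counit 𝒱).toLinearMap.rTensor (SymC 𝒱) u) := by
      intro u
      induction u with
      | zero => simp
      | add a b ha hb =>
        simp only [map_add] at ha hb ⊢
        linear_combination (norm := abel) ha + hb
      | tmul a b => simp [counit_twist]
    simp only [LinearMap.comp_apply] at ih ⊢
    rw [comul_ι_mul hv, h, ih]
    simp

theorem lTensor_counit : (counit 𝒱).toLinearMap.lTensor (SymC 𝒱) ∘ₗ comul 𝒱 =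
    (TensorProduct.mk F (SymC 𝒱) F).flip 1 :=
  hom_ext_ι_mul (by simp) fun i v hv x ih => by
    have h : ∀ u : SymC 𝒱 ⊗[F] SymC 𝒱, (counit 𝒱).toLinearMap.lTensor (SymC 𝒱)
        (TensorProduct.map (LinearMap.mulLeft F (ι 𝒱 v)) LinearMap.id u +
          TensorProduct.map (twist (deg 𝒱) i) (LinearMap.mulLeft F (ι 𝒱 v)) u) =
        (LinearMap.mulLeft F (ι 𝒱 v)).rTensor F ((counit 𝒱).toLinearMap.lTensor (SymC 𝒱) u) := by
      intro u
      induction u with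
      | zero => simp
      | add a b ha hb =>
        simp only [map_add] at ha hb ⊢
        linear_combination (norm := abel) ha + hb
      | tmul a b => simp
    simp only [LinearMap.comp_apply] at ih ⊢
    rw [comul_ι_mul hv, h, ih]
    simp

/-- Graded cocommutativity. -/
theorem comul_comm {X : Type*} [AddCommGroup X] [Module F X]
    {Φ Ψ : SymC 𝒱 ⊗[F] SymC 𝒱 →ₗ[F] X}
    (h : ∀ i j, ∀ x ∈ deg 𝒱 i, ∀ y ∈ deg 𝒱 j, Φ (x ⊗ₜ y) = sgn F (i * j) • Ψ (y ⊗ₜ x)) :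
    Φ ∘ₗ comul 𝒱 = Ψ ∘ₗ comul 𝒱 := by
  set c := GradedTensorProduct.comm (R := F) (deg 𝒱) (deg 𝒱)
  have hc : ∀ i j, ∀ x ∈ deg 𝒱 i, ∀ y ∈ deg 𝒱 j, (c (x ᵍ⊗ₜ[F] y) : (deg 𝒱) ᵍ⊗[F] (deg 𝒱)) =
      sgn F (i * j) • (y ᵍ⊗ₜ[F] x) := fun i j x hx y hy => by
    have := GradedTensorProduct.comm_coe_tmul_coe (R := F) (deg 𝒱) (deg 𝒱) ⟨x, hx⟩ ⟨y, hy⟩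
    rw [units_smul_eq (F := F), mul_comm] at this
    exact this
  -- The signed swap c is an algebra morphism fixing v ⊗ 1 + 1 ⊗ v, hence it fixes every coproduct.
  have h1 : c.toAlgHom.comp (comulHom 𝒱) = comulHom 𝒱 := by
    refine hom_ext fun v => ?_
    rw [AlgHom.comp_apply, comulHom_ι]
    induction v using DirectSum.Decomposition.inductionOn 𝒱 with
    | zero => simp [GradedTensorProduct.tmul]
    | homogeneous v =>
      have h0 : (1 : SymC 𝒱) ∈ deg 𝒱 0 := SetLike.GradedOne.one_mem
      have e1 := hc _ _ _ (ι_mem_deg 𝒱 v.2) _ h0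
      have e2 := hc _ _ _ h0 _ (ι_mem_deg 𝒱 v.2)
      rw [map_add]
      refine (congr_arg₂ _ e1 e2).trans ?_
      simp [add_comm]
    | add v w hv hw =>
      simp only [map_add, GradedTensorProduct.tmul, TensorProduct.add_tmul,
        TensorProduct.tmul_add] at hv hw ⊢
      linear_combination (norm := abel) hv + hw
  have h2 : ∀ t : (deg 𝒱) ᵍ⊗[F] (deg 𝒱), Φ ((GradedTensorProduct.of F (deg 𝒱) (deg 𝒱)).symm t) =
      Ψ ((GradedTensorProduct.of F (deg 𝒱) (deg 𝒱)).symm (c t)) := by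
    intro t
    obtain ⟨t, rfl⟩ := (GradedTensorProduct.of F (deg 𝒱) (deg 𝒱)).surjective t
    induction t with
    | zero => simp
    | add a b ha hb => simp only [map_add] at ha hb ⊢; rw [ha, hb]
    | tmul x y =>
      induction x using DirectSum.Decomposition.inductionOn (deg 𝒱) with
      | zero => simp
      | add x x' hx hx' => simp only [TensorProduct.add_tmul, map_add] at hx hx' ⊢; rw [hx, hx']
      | homogeneous x =>
        induction y using DirectSum.Decomposition.inductionOn (deg 𝒱) with
        | zero => simp
        | add y y' hy hy' => simp only [TensorProduct.tmul_add, map_add] at hy hy' ⊢; rw [hy, hy']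
        | homogeneous y =>
          refine (h _ _ _ x.2 _ y.2).trans ?_
          rw [← map_smul]
          congr 1
          exact (congr_arg (GradedTensorProduct.of F (deg 𝒱) (deg 𝒱)).symm
            (hc _ _ _ x.2 _ y.2)).symm
  ext x
  have := h2 (comulHom 𝒱 x)
  rw [show c (comulHom 𝒱 x) = comulHom 𝒱 x from DFunLike.congr_fun h1 x] at this
  exact this

end Coalg

end SymC

/-! ### Calculus of convolution products -/

namespace SymC

section Conv

variable {F V W A A' A'' B B' C X : Type*} [Field F] [AddCommGroup V] [Module F V]
  [AddCommGroup W] [Module F W]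
  [AddCommGroup A] [Module F A] [AddCommGroup A'] [Module F A'] [AddCommGroup A''] [Module F A'']
  [AddCommGroup B] [Module F B] [AddCommGroup B'] [Module F B'] [AddCommGroup C] [Module F C]
  [AddCommGroup X] [Module F X]
  {𝒱 : ℤ → Submodule F V} [DirectSum.Decomposition 𝒱]
  {𝒲 : ℤ → Submodule F W} [DirectSum.Decomposition 𝒲]

/-- The convolution product `μ (f ⊗ g) Δ` with respect to a bilinear map `μ`. -/
def conv (μ : A →ₗ[F] B →ₗ[F] C) (f : SymC 𝒱 →ₗ[F] A) (g : SymC 𝒱 →ₗ[F] B) : SymC 𝒱 →ₗ[F] C :=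
  TensorProduct.lift μ ∘ₗ TensorProduct.map f g ∘ₗ comul 𝒱

theorem conv_mk (f : SymC 𝒱 →ₗ[F] A) (g : SymC 𝒱 →ₗ[F] B) :
    conv (TensorProduct.mk F A B) f g = TensorProduct.map f g ∘ₗ comul 𝒱 := by
  rw [conv, TensorProduct.lift_mk, LinearMap.id_comp]

theorem IsWord.conv_congr {n : ℕ} {m : ℤ} {x : SymC 𝒱} (hx : IsWord 𝒱 n m x)
    {μ : A →ₗ[F] B →ₗ[F] C} {μ' : A' →ₗ[F] B' →ₗ[F] C}
    {f : SymC 𝒱 →ₗ[F] A} {g : SymC 𝒱 →ₗ[F] B} {f' : SymC 𝒱 →ₗ[F] A'} {g' : SymC 𝒱 →ₗ[F] B'}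
    (h : ∀ n₁ n₂ m₁ m₂ y z, IsWord 𝒱 n₁ m₁ y → IsWord 𝒱 n₂ m₂ z → n₁ + n₂ = n → m₁ + m₂ = m →
      μ (f y) (g z) = μ' (f' y) (g' z)) : conv μ f g x = conv μ' f' g' x :=
  hx.comul_congr (Φ := TensorProduct.lift μ ∘ₗ TensorProduct.map f g)
    (Ψ := TensorProduct.lift μ' ∘ₗ TensorProduct.map f' g') (by simpa using h)

theorem IsWord.conv_mem {n : ℕ} {m : ℤ} {x : SymC 𝒱} (hx : IsWord 𝒱 n m x)
    {μ : A →ₗ[F] B →ₗ[F] C} {f : SymC 𝒱 →ₗ[F] A} {g : SymC 𝒱 →ₗ[F] B} {P : Submodule F C}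
    (h : ∀ n₁ n₂ m₁ m₂ y z, IsWord 𝒱 n₁ m₁ y → IsWord 𝒱 n₂ m₂ z → n₁ + n₂ = n → m₁ + m₂ = m →
      μ (f y) (g z) ∈ P) : conv μ f g x ∈ P :=
  hx.comul_induction (Φ := TensorProduct.lift μ ∘ₗ TensorProduct.map f g) (by simpa using h)

theorem conv_congr_deg {μ : A →ₗ[F] B →ₗ[F] C} {μ' : A' →ₗ[F] B' →ₗ[F] C}
    {f : SymC 𝒱 →ₗ[F] A} {g : SymC 𝒱 →ₗ[F] B} {f' : SymC 𝒱 →ₗ[F] A'} {g' : SymC 𝒱 →ₗ[F] B'}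
    (h : ∀ i j, ∀ x ∈ deg 𝒱 i, ∀ y ∈ deg 𝒱 j, μ (f x) (g y) = μ' (f' x) (g' y)) :
    conv μ f g = conv μ' f' g' :=
  hom_ext_word fun _ _ _ hx => hx.conv_congr fun _ _ _ _ _ _ hy hz _ _ =>
    h _ _ _ hy.mem_deg _ hz.mem_deg

theorem conv_congr {μ : A →ₗ[F] B →ₗ[F] C} {μ' : A' →ₗ[F] B' →ₗ[F] C}
    {f : SymC 𝒱 →ₗ[F] A} {g : SymC 𝒱 →ₗ[F] B} {f' : SymC 𝒱 →ₗ[F] A'} {g' : SymC 𝒱 →ₗ[F] B'}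
    (h : ∀ x y, μ (f x) (g y) = μ' (f' x) (g' y)) : conv μ f g = conv μ' f' g' :=
  conv_congr_deg fun _ _ x _ y _ => h x y

theorem comp_conv_deg {μ : A →ₗ[F] B →ₗ[F] X} {μ' : A' →ₗ[F] B' →ₗ[F] C} {T : X →ₗ[F] C}
    {f : SymC 𝒱 →ₗ[F] A} {g : SymC 𝒱 →ₗ[F] B} {f' : SymC 𝒱 →ₗ[F] A'} {g' : SymC 𝒱 →ₗ[F] B'}
    (h : ∀ i j, ∀ x ∈ deg 𝒱 i, ∀ y ∈ deg 𝒱 j, T (μ (f x) (g y)) = μ' (f' x) (g' y)) :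
    T ∘ₗ conv μ f g = conv μ' f' g' := by
  have : T ∘ₗ conv μ f g = conv (μ.compr₂ T) f g := by
    rw [conv, conv, ← LinearMap.comp_assoc, ← TensorProduct.lift_compr₂]
  rw [this]
  exact conv_congr_deg (by simpa using h)

theorem comp_conv {μ : A →ₗ[F] B →ₗ[F] X} {μ' : A' →ₗ[F] B' →ₗ[F] C} {T : X →ₗ[F] C}
    {f : SymC 𝒱 →ₗ[F] A} {g : SymC 𝒱 →ₗ[F] B} {f' : SymC 𝒱 →ₗ[F] A'} {g' : SymC 𝒱 →ₗ[F] B'}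
    (h : ∀ x y, T (μ (f x) (g y)) = μ' (f' x) (g' y)) : T ∘ₗ conv μ f g = conv μ' f' g' :=
  comp_conv_deg fun _ _ x _ y _ => h x y

theorem conv_add_left (μ : A →ₗ[F] B →ₗ[F] C) (f f' : SymC 𝒱 →ₗ[F] A) (g : SymC 𝒱 →ₗ[F] B) :
    conv μ (f + f') g = conv μ f g + conv μ f' g := by
  simp [conv, TensorProduct.map_add_left, LinearMap.comp_add, LinearMap.add_comp]

theorem conv_add_right (μ : A →ₗ[F] B →ₗ[F] C) (f : SymC 𝒱 →ₗ[F] A) (g g' : SymC 𝒱 →ₗ[F] B) :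
    conv μ f (g + g') = conv μ f g + conv μ f g' := by
  simp [conv, TensorProduct.map_add_right, LinearMap.comp_add, LinearMap.add_comp]

theorem conv_smul_left (μ : A →ₗ[F] B →ₗ[F] C) (c : F) (f : SymC 𝒱 →ₗ[F] A)
    (g : SymC 𝒱 →ₗ[F] B) : conv μ (c • f) g = c • conv μ f g := by
  simp [conv, TensorProduct.map_smul_left, LinearMap.comp_smul, LinearMap.smul_comp]

theorem conv_smul_right (μ : A →ₗ[F] B →ₗ[F] C) (c : F) (f : SymC 𝒱 →ₗ[F] A)
    (g : SymC 𝒱 →ₗ[F] B) : conv μ f (c • g) = c • conv μ f g := by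
  simp [conv, TensorProduct.map_smul_right, LinearMap.comp_smul, LinearMap.smul_comp]

theorem conv_zero_left (μ : A →ₗ[F] B →ₗ[F] C) (g : SymC 𝒱 →ₗ[F] B) :
    conv μ (0 : SymC 𝒱 →ₗ[F] A) g = 0 := by
  simp [conv]

theorem conv_zero_right (μ : A →ₗ[F] B →ₗ[F] C) (f : SymC 𝒱 →ₗ[F] A) :
    conv μ f (0 : SymC 𝒱 →ₗ[F] B) = 0 := by
  simp [conv]

theorem conv_neg_left (μ : A →ₗ[F] B →ₗ[F] C) (f : SymC 𝒱 →ₗ[F] A) (g : SymC 𝒱 →ₗ[F] B) :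
    conv μ (-f) g = -conv μ f g := by
  simpa using conv_smul_left μ (-1) f g

theorem conv_neg_right (μ : A →ₗ[F] B →ₗ[F] C) (f : SymC 𝒱 →ₗ[F] A) (g : SymC 𝒱 →ₗ[F] B) :
    conv μ f (-g) = -conv μ f g := by
  simpa using conv_smul_right μ (-1) f g

theorem conv_sub_right (μ : A →ₗ[F] B →ₗ[F] C) (f : SymC 𝒱 →ₗ[F] A) (g g' : SymC 𝒱 →ₗ[F] B) :
    conv μ f (g - g') = conv μ f g - conv μ f g' := by
  rw [sub_eq_add_neg, conv_add_right, conv_neg_right, ← sub_eq_add_neg]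

theorem conv_apply_one (μ : A →ₗ[F] B →ₗ[F] C) (f : SymC 𝒱 →ₗ[F] A) (g : SymC 𝒱 →ₗ[F] B) :
    conv μ f g 1 = μ (f 1) (g 1) := by
  simp [conv]

theorem conv_apply_ι (μ : A →ₗ[F] B →ₗ[F] C) (f : SymC 𝒱 →ₗ[F] A) (g : SymC 𝒱 →ₗ[F] B) (v : V) :
    conv μ f g (ι 𝒱 v) = μ (f (ι 𝒱 v)) (g 1) + μ (f 1) (g (ι 𝒱 v)) := by
  simp [conv, comul_ι]

theorem conv_comm {μ : A →ₗ[F] B →ₗ[F] C} {μ' : B' →ₗ[F] A' →ₗ[F] C}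
    {f : SymC 𝒱 →ₗ[F] A} {g : SymC 𝒱 →ₗ[F] B} {f' : SymC 𝒱 →ₗ[F] A'} {g' : SymC 𝒱 →ₗ[F] B'}
    (h : ∀ i j, ∀ x ∈ deg 𝒱 i, ∀ y ∈ deg 𝒱 j,
      μ (f x) (g y) = sgn F (i * j) • μ' (g' y) (f' x)) : conv μ f g = conv μ' g' f' :=
  comul_comm (Φ := TensorProduct.lift μ ∘ₗ TensorProduct.map f g)
    (Ψ := TensorProduct.lift μ' ∘ₗ TensorProduct.map g' f') (by simpa using h)

theorem conv_assoc {μ₁ : X →ₗ[F] A'' →ₗ[F] C} {μ₂ : A →ₗ[F] A' →ₗ[F] X}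
    {μ₃ : A →ₗ[F] B →ₗ[F] C} {μ₄ : A' →ₗ[F] A'' →ₗ[F] B}
    (h : ∀ a b c, μ₁ (μ₂ a b) c = μ₃ a (μ₄ b c))
    (f : SymC 𝒱 →ₗ[F] A) (g : SymC 𝒱 →ₗ[F] A') (k : SymC 𝒱 →ₗ[F] A'') :
    conv μ₁ (conv μ₂ f g) k = conv μ₃ f (conv μ₄ g k) := by
  have h1 : conv μ₁ (conv μ₂ f g) k =
      (TensorProduct.lift μ₁ ∘ₗ TensorProduct.map (TensorProduct.lift μ₂ ∘ₗ TensorProduct.map f g) k)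
        ∘ₗ (comul 𝒱).rTensor (SymC 𝒱) ∘ₗ comul 𝒱 := by
    simp only [conv, LinearMap.rTensor, ← LinearMap.comp_assoc]
    congr 1
    exact TensorProduct.ext' fun x y => by simp
  have h2 : conv μ₃ f (conv μ₄ g k) =
      (TensorProduct.lift μ₃ ∘ₗ TensorProduct.map f (TensorProduct.lift μ₄ ∘ₗ TensorProduct.map g k))
        ∘ₗ (comul 𝒱).lTensor (SymC 𝒱) ∘ₗ comul 𝒱 := by
    simp only [conv, LinearMap.lTensor, ← LinearMap.comp_assoc]
    congr 1
    exact TensorProduct.ext' fun x y => by simp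
  rw [h1, h2, ← comul_coassoc]
  simp only [← LinearMap.comp_assoc]
  congr 2
  refine TensorProduct.ext_threefold fun a b c => ?_
  simp [h]

/-- Coassociativity lets the first two factors be convolved alone, with values in operators on the
third; there cocommutativity exchanges them. -/
theorem conv_left_comm {μ₁ : A →ₗ[F] X →ₗ[F] C} {μ₂ : B →ₗ[F] A'' →ₗ[F] X}
    {Y : Type*} [AddCommGroup Y] [Module F Y]
    {μ₃ : B' →ₗ[F] Y →ₗ[F] C} {μ₄ : A' →ₗ[F] A'' →ₗ[F] Y}
    {f : SymC 𝒱 →ₗ[F] A} {g : SymC 𝒱 →ₗ[F] B} {f' : SymC 𝒱 →ₗ[F] A'} {g' : SymC 𝒱 →ₗ[F] B'}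
    (h : ∀ i j, ∀ x ∈ deg 𝒱 i, ∀ y ∈ deg 𝒱 j, ∀ c,
      μ₁ (f x) (μ₂ (g y) c) = sgn F (i * j) • μ₃ (g' y) (μ₄ (f' x) c))
    (k : SymC 𝒱 →ₗ[F] A'') :
    conv μ₁ f (conv μ₂ g k) = conv μ₃ g' (conv μ₄ f' k) := by
  rw [← conv_assoc (μ₁ := LinearMap.id)
      (μ₂ := LinearMap.mk₂ F (fun a b => μ₁ a ∘ₗ μ₂ b)
        (by intros; ext; simp) (by intros; ext; simp) (by intros; ext; simp)
        (by intros; ext; simp)) (fun _ _ _ => rfl),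
    ← conv_assoc (μ₁ := LinearMap.id)
      (μ₂ := LinearMap.mk₂ F (fun a b => μ₃ a ∘ₗ μ₄ b)
        (by intros; ext; simp) (by intros; ext; simp) (by intros; ext; simp)
        (by intros; ext; simp)) (fun _ _ _ => rfl)]
  congr 1
  refine conv_comm fun i j x hx y hy => LinearMap.ext fun c => ?_
  exact h i j x hx y hy c

theorem conv_comp_hom {E : SymC 𝒱 →ₗ[F] SymC 𝒲}
    (hE : comul 𝒲 ∘ₗ E = TensorProduct.map E E ∘ₗ comul 𝒱)
    (μ : A →ₗ[F] B →ₗ[F] C) (f : SymC 𝒲 →ₗ[F] A) (g : SymC 𝒲 →ₗ[F] B) :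
    conv μ f g ∘ₗ E = conv μ (f ∘ₗ E) (g ∘ₗ E) := by
  rw [conv, conv, LinearMap.comp_assoc, LinearMap.comp_assoc, hE, TensorProduct.map_comp]
  simp only [LinearMap.comp_assoc]

/-- The hypothesis makes D a coderivation along E. Ordinary coderivations have E = id; composing ∂
with a coalgebra morphism E gives the other case needed. -/
theorem conv_comp_coderivation {D E : SymC 𝒱 →ₗ[F] SymC 𝒲}
    (hD : comul 𝒲 ∘ₗ D =
      (TensorProduct.map D E + TensorProduct.map (parity (deg 𝒲) ∘ₗ E) D) ∘ₗ comul 𝒱)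
    (μ : A →ₗ[F] B →ₗ[F] C) (f : SymC 𝒲 →ₗ[F] A) (g : SymC 𝒲 →ₗ[F] B) :
    conv μ f g ∘ₗ D =
      conv μ (f ∘ₗ D) (g ∘ₗ E) + conv μ (f ∘ₗ parity (deg 𝒲) ∘ₗ E) (g ∘ₗ D) := by
  rw [conv, conv, conv, LinearMap.comp_assoc, LinearMap.comp_assoc, hD, TensorProduct.map_comp,
    TensorProduct.map_comp]
  simp only [LinearMap.comp_assoc, LinearMap.add_comp, LinearMap.comp_add]

theorem conv_counit_right (f : SymC 𝒱 →ₗ[F] A) {μ : A →ₗ[F] F →ₗ[F] C} {T : A →ₗ[F] C}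
    (h : ∀ a c, μ a c = c • T a) : conv μ f (counit 𝒱).toLinearMap = T ∘ₗ f := by
  have h1 : conv μ f (counit 𝒱).toLinearMap = (TensorProduct.lift μ ∘ₗ f.rTensor F) ∘ₗ
      (counit 𝒱).toLinearMap.lTensor (SymC 𝒱) ∘ₗ comul 𝒱 := by
    simp only [conv, LinearMap.lTensor, LinearMap.rTensor, ← LinearMap.comp_assoc]
    congr 1
    rw [LinearMap.comp_assoc, ← TensorProduct.map_comp, LinearMap.comp_id, LinearMap.id_comp]
  rw [h1, lTensor_counit]
  ext x
  simp [h]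

theorem conv_counit_left (g : SymC 𝒱 →ₗ[F] B) {μ : F →ₗ[F] B →ₗ[F] C} {T : B →ₗ[F] C}
    (h : ∀ c b, μ c b = c • T b) : conv μ (counit 𝒱).toLinearMap g = T ∘ₗ g := by
  have h1 : conv μ (counit 𝒱).toLinearMap g = (TensorProduct.lift μ ∘ₗ g.lTensor F) ∘ₗ
      (counit 𝒱).toLinearMap.rTensor (SymC 𝒱) ∘ₗ comul 𝒱 := by
    simp only [conv, LinearMap.lTensor, LinearMap.rTensor, ← LinearMap.comp_assoc]
    congr 1
    rw [LinearMap.comp_assoc, ← TensorProduct.map_comp, LinearMap.comp_id, LinearMap.id_comp]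
  rw [h1, rTensor_counit]
  ext x
  simp [h]

theorem isDeg_conv {𝒜 : ℤ → Submodule F A} {ℬ : ℤ → Submodule F B} {𝒞 : ℤ → Submodule F C}
    {μ : A →ₗ[F] B →ₗ[F] C} (hμ : ∀ i j, ∀ x ∈ 𝒜 i, ∀ y ∈ ℬ j, μ x y ∈ 𝒞 (i + j))
    {k l : ℤ} {f : SymC 𝒱 →ₗ[F] A} {g : SymC 𝒱 →ₗ[F] B} (hf : IsDeg (deg 𝒱) 𝒜 k f)
    (hg : IsDeg (deg 𝒱) ℬ l g) : IsDeg (deg 𝒱) 𝒞 (k + l) (conv μ f g) :=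
  isDeg_of_word fun n m x hx => hx.conv_mem fun n₁ n₂ m₁ m₂ y z hy hz _ hm => by
    rw [← hm, add_add_add_comm]
    exact hμ _ _ _ (hf _ _ hy.mem_deg) _ (hg _ _ hz.mem_deg)

end Conv

end SymC

/-! ### Coderivations determined by their projection to the letters -/

namespace SymC

section Coder

variable {F V W A : Type*} [Field F] [AddCommGroup V] [Module F V] [AddCommGroup W] [Module F W]
  [AddCommGroup A] [Module F A] {𝒱 : ℤ → Submodule F V} {𝒲 : ℤ → Submodule F W}

/-- `proj` is the square-zero component of an algebra morphism to the trivial extension of F by V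
whose scalar component is `counit`; the formula is the product of that extension. -/
theorem proj_mul (x y : SymC 𝒱) :
    proj 𝒱 (x * y) = counit 𝒱 x • proj 𝒱 y + counit 𝒱 y • proj 𝒱 x := by
  let : Module Fᵐᵒᵖ V := Module.compHom _ ((RingHom.id F).fromOpposite mul_comm)
  have : IsCentralScalar F V := ⟨fun _ _ => rfl⟩
  set φ : SymC 𝒱 →ₐ[F] TrivSqZeroExt F V :=
    lift (𝒱 := 𝒱) (TrivSqZeroExt.inrHom F V) fun _ _ _ _ _ _ => by simp with hφ
  have h1 : ∀ x, proj 𝒱 x = (φ x).snd := fun x => rfl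
  have h2 : (TrivSqZeroExt.fstHom F F V).comp φ = counit 𝒱 :=
    hom_ext fun v => by simp [hφ, counit]
  have h3 : ∀ x, counit 𝒱 x = (φ x).fst := fun x => by rw [← h2]; rfl
  rw [h1, h1, h1, h3, h3, map_mul, TrivSqZeroExt.snd_mul]
  rfl

theorem proj_one : proj 𝒱 1 = 0 := by
  have := proj_mul (1 : SymC 𝒱) 1
  simpa using this

theorem proj_ι_mul (v : V) (x : SymC 𝒱) : proj 𝒱 (ι 𝒱 v * x) = counit 𝒱 x • v := by
  have : counit 𝒱 (ι 𝒱 v) = 0 := by simp [counit]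
  rw [proj_mul, proj_ι, this, zero_smul, zero_add]

theorem IsWord.proj_eq_zero {n : ℕ} {m : ℤ} {x : SymC 𝒱} (hx : IsWord 𝒱 n m x) (h : n ≠ 1) :
    proj 𝒱 x = 0 := by
  cases hx with
  | one => exact proj_one
  | mul hv hx' =>
    cases hx' with
    | one => exact absurd rfl h
    | mul _ _ => rw [proj_ι_mul]; simp [counit]

theorem IsWord.eq_ι {m : ℤ} {x : SymC 𝒱} (hx : IsWord 𝒱 1 m x) : ∃ v ∈ 𝒱 m, x = ι 𝒱 v := by
  generalize hn : 1 = n at hx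
  cases hx with
  | one => simp at hn
  | @mul i m n v x hv hx =>
    obtain rfl : n = 0 := by omega
    cases hx
    exact ⟨v, by simpa using hv, by simp⟩

theorem isDeg_proj : IsDeg (deg 𝒱) 𝒱 0 (proj 𝒱) :=
  isDeg_of_word fun n m x hx => by
    rcases eq_or_ne n 1 with rfl | h
    · obtain ⟨v, hv, rfl⟩ := hx.eq_ι
      rwa [proj_ι, add_zero]
    · rw [hx.proj_eq_zero h]
      exact Submodule.zero_mem _

theorem isDeg_ι : IsDeg 𝒱 (deg 𝒱) 0 (ι 𝒱) := fun i x hx => by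
  rw [add_zero]
  exact ι_mem_deg 𝒱 hx

/-- Letters commute with homogeneous elements, up to sign. -/
theorem ι_mul_comm {i j : ℤ} {v : V} (hv : v ∈ 𝒱 i) {x : SymC 𝒱} (hx : x ∈ deg 𝒱 j) :
    ι 𝒱 v * x = sgn F (i * j) • (x * ι 𝒱 v) := by
  rw [deg_eq_span] at hx
  induction hx using Submodule.span_induction with
  | zero => simp
  | add x y _ _ hx hy => rw [mul_add, hx, hy, add_mul, smul_add]
  | smul c x _ hx => rw [mul_smul_comm, hx, smul_mul_assoc, smul_comm]
  | mem x hx =>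
    obtain ⟨n, hx⟩ := hx
    induction hx with
    | one => simp
    | mul hw _ ih =>
      rw [← mul_assoc, ι_mul_ι' hv hw, smul_mul_assoc, mul_assoc, ih, mul_smul_comm, smul_smul,
        mul_assoc, mul_add, sgn_add]

theorem mul_comm_deg {i j : ℤ} {x y : SymC 𝒱} (hx : x ∈ deg 𝒱 i) (hy : y ∈ deg 𝒱 j) :
    x * y = sgn F (i * j) • (y * x) := by
  rw [deg_eq_span] at hx
  induction hx using Submodule.span_induction with
  | zero => simp
  | add x y _ _ hx hy => rw [add_mul, hx, hy, mul_add, smul_add]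
  | smul c x _ hx => rw [mul_smul_comm, smul_mul_assoc, hx, smul_comm]
  | mem x hx =>
    obtain ⟨n, hx⟩ := hx
    induction hx with
    | one => simp
    | mul hw _ ih =>
      rw [mul_assoc, ih, mul_smul_comm, ← mul_assoc, ι_mul_comm hw hy, smul_mul_assoc, mul_assoc,
        smul_smul, add_mul, sgn_add, mul_comm]

variable [DirectSum.Decomposition 𝒱] [DirectSum.Decomposition 𝒲]

theorem coder_eq_conv (f : SymC 𝒱 →ₗ[F] V) :
    coder 𝒱 f = conv (LinearMap.mul F (SymC 𝒱)) (ι 𝒱 ∘ₗ f) LinearMap.id := rfl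

theorem coder_comp_hom {E : SymC 𝒱 →ₗ[F] SymC 𝒲}
    (hE : comul 𝒲 ∘ₗ E = TensorProduct.map E E ∘ₗ comul 𝒱) (f : SymC 𝒲 →ₗ[F] W) :
    coder 𝒲 f ∘ₗ E = conv (LinearMap.mul F (SymC 𝒲)) (ι 𝒲 ∘ₗ f ∘ₗ E) E := by
  rw [coder_eq_conv, conv_comp_hom hE, LinearMap.comp_assoc, LinearMap.id_comp]

omit [DirectSum.Decomposition 𝒱] in
-- A letter times a word contributes a single letter only through the counit of the word, and the
-- counit law collapses what is left.
theorem proj_comp_conv (f : SymC 𝒲 →ₗ[F] V) {E : SymC 𝒲 →ₗ[F] SymC 𝒱}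
    (hE : (counit 𝒱).toLinearMap ∘ₗ E = (counit 𝒲).toLinearMap) :
    proj 𝒱 ∘ₗ conv (LinearMap.mul F (SymC 𝒱)) (ι 𝒱 ∘ₗ f) E = f := by
  rw [comp_conv (μ' := (LinearMap.lsmul F V).flip) (f' := f) (g' := (counit 𝒱).toLinearMap ∘ₗ E)
    (fun x y => by simp [proj_ι_mul]), hE,
    conv_counit_right f (T := LinearMap.id) (fun a c => by simp), LinearMap.id_comp]

theorem proj_comp_coder (f : SymC 𝒱 →ₗ[F] V) : proj 𝒱 ∘ₗ coder 𝒱 f = f :=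
  proj_comp_conv f (LinearMap.comp_id _)

theorem coder_add (f g : SymC 𝒱 →ₗ[F] V) : coder 𝒱 (f + g) = coder 𝒱 f + coder 𝒱 g := by
  simp only [coder_eq_conv, LinearMap.comp_add, conv_add_left]

theorem coder_zero : coder 𝒱 (0 : SymC 𝒱 →ₗ[F] V) = 0 := by
  simp only [coder_eq_conv, LinearMap.comp_zero, conv_zero_left]

theorem isDeg_coder {f : SymC 𝒱 →ₗ[F] V} {k : ℤ} (hf : IsDeg (deg 𝒱) 𝒱 k f) :
    IsDeg (deg 𝒱) (deg 𝒱) k (coder 𝒱 f) := by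
  have := isDeg_conv (𝒞 := deg 𝒱) (μ := LinearMap.mul F (SymC 𝒱))
    (fun i j x hx y hy => SetLike.GradedMul.mul_mem hx hy) (isDeg_ι.comp hf) isDeg_id
  rwa [add_zero, add_zero] at this

/-- The multiplication of `S^c[V] ⊗ S^c[V]` as a graded tensor product of algebras. -/
def gradedMul (𝒱 : ℤ → Submodule F V) [DirectSum.Decomposition 𝒱] :
    SymC 𝒱 ⊗[F] SymC 𝒱 →ₗ[F] SymC 𝒱 ⊗[F] SymC 𝒱 →ₗ[F] SymC 𝒱 ⊗[F] SymC 𝒱 :=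
  ((GradedTensorProduct.mulHom (deg 𝒱) (deg 𝒱)).compl₁₂
    (GradedTensorProduct.of F (deg 𝒱) (deg 𝒱)).toLinearMap
    (GradedTensorProduct.of F (deg 𝒱) (deg 𝒱)).toLinearMap).compr₂
    (GradedTensorProduct.of F (deg 𝒱) (deg 𝒱)).symm.toLinearMap

theorem comul_mul (x y : SymC 𝒱) :
    comul 𝒱 (x * y) = gradedMul 𝒱 (comul 𝒱 x) (comul 𝒱 y) := by
  simp only [comul, LinearMap.comp_apply, AlgHom.toLinearMap_apply, map_mul]
  rfl

theorem gradedMul_left (a : SymC 𝒱) (t : SymC 𝒱 ⊗[F] SymC 𝒱) :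
    gradedMul 𝒱 (a ⊗ₜ 1) t = TensorProduct.map (LinearMap.mulLeft F a) LinearMap.id t :=
  congr_arg (GradedTensorProduct.of F (deg 𝒱) (deg 𝒱)).symm (graded_left_mul a t)

theorem gradedMul_right {i : ℤ} {a : SymC 𝒱} (ha : a ∈ deg 𝒱 i) (t : SymC 𝒱 ⊗[F] SymC 𝒱) :
    gradedMul 𝒱 (1 ⊗ₜ a) t =
      TensorProduct.map (twist (deg 𝒱) i) (LinearMap.mulLeft F a) t :=
  congr_arg (GradedTensorProduct.of F (deg 𝒱) (deg 𝒱)).symm (graded_right_mul ha t)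

theorem comul_comp_conv (f : SymC 𝒱 →ₗ[F] W) (G : SymC 𝒱 →ₗ[F] SymC 𝒲) :
    comul 𝒲 ∘ₗ conv (LinearMap.mul F (SymC 𝒲)) (ι 𝒲 ∘ₗ f) G =
      conv (gradedMul 𝒲) ((TensorProduct.mk F _ _).flip 1 ∘ₗ ι 𝒲 ∘ₗ f) (comul 𝒲 ∘ₗ G) +
      conv (gradedMul 𝒲) (TensorProduct.mk F _ _ 1 ∘ₗ ι 𝒲 ∘ₗ f) (comul 𝒲 ∘ₗ G) := by
  rw [← conv_add_left]
  exact comp_conv fun x y => by simp [comul_mul, comul_ι]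

theorem conv_gradedMul_left (f : SymC 𝒱 →ₗ[F] W) (P Q : SymC 𝒱 →ₗ[F] SymC 𝒲) :
    conv (gradedMul 𝒲) ((TensorProduct.mk F _ _).flip 1 ∘ₗ ι 𝒲 ∘ₗ f)
      (TensorProduct.map P Q ∘ₗ comul 𝒱) =
    TensorProduct.map (conv (LinearMap.mul F (SymC 𝒲)) (ι 𝒲 ∘ₗ f) P) Q ∘ₗ comul 𝒱 := by
  rw [← conv_mk, ← conv_mk, conv_assoc (μ₃ := gradedMul 𝒲 ∘ₗ (TensorProduct.mk F _ _).flip 1)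
    (μ₄ := TensorProduct.mk F _ _) (fun a b c => by simp [gradedMul_left])]
  exact conv_congr fun x y => rfl

/-- Moving f(x), of degree |x| + k, past P(y) costs (|x| + k)|y|; cocommutativity pays for |x||y|,
which leaves the twist by k. -/
theorem conv_gradedMul_right {k : ℤ} {f : SymC 𝒱 →ₗ[F] W} (hf : IsDeg (deg 𝒱) 𝒲 k f)
    {P : SymC 𝒱 →ₗ[F] SymC 𝒲} (hP : IsDeg (deg 𝒱) (deg 𝒲) 0 P) (Q : SymC 𝒱 →ₗ[F] SymC 𝒲) :
    conv (gradedMul 𝒲) (TensorProduct.mk F _ _ 1 ∘ₗ ι 𝒲 ∘ₗ f)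
      (TensorProduct.map P Q ∘ₗ comul 𝒱) =
    TensorProduct.map (P ∘ₗ twist (deg 𝒱) k) (conv (LinearMap.mul F (SymC 𝒲)) (ι 𝒲 ∘ₗ f) Q) ∘ₗ
      comul 𝒱 := by
  rw [← conv_mk, ← conv_mk]
  refine conv_left_comm (fun i j x hx y hy c => ?_) _
  have hfx := ι_mem_deg 𝒲 (hf i x hx)
  simp only [LinearMap.comp_apply, TensorProduct.mk_apply, gradedMul_right hfx,
    TensorProduct.map_tmul, twist_apply (hP.zero_mem hy), twist_apply hy, map_smul,
    LinearMap.mulLeft_apply, LinearMap.mul_apply', ← TensorProduct.smul_tmul', smul_smul, LinearMap.smul_apply]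
  rw [← sgn_add, add_mul]

/-- The operators `coder f`, for `f` of odd degree, are coderivations. -/
theorem comul_comp_coder {f : SymC 𝒱 →ₗ[F] V} (hf : IsDeg (deg 𝒱) 𝒱 (-1) f) :
    comul 𝒱 ∘ₗ coder 𝒱 f =
      (TensorProduct.map (coder 𝒱 f) LinearMap.id +
        TensorProduct.map (parity (deg 𝒱)) (coder 𝒱 f)) ∘ₗ comul 𝒱 := by
  have h : parity (deg 𝒱) = LinearMap.id ∘ₗ twist (deg 𝒱) (-1) :=
    hom_ext_deg (𝒱 := deg 𝒱) fun i x hx => by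
      rw [LinearMap.comp_apply, parity_apply hx, twist_apply hx, LinearMap.id_apply]
      congr 1
      exact sgn_congr (by simp)
  have h1 : comul 𝒱 ∘ₗ LinearMap.id =
      TensorProduct.map LinearMap.id LinearMap.id ∘ₗ comul 𝒱 := by
    rw [TensorProduct.map_id, LinearMap.id_comp, LinearMap.comp_id]
  rw [coder_eq_conv, comul_comp_conv, h1, conv_gradedMul_left, conv_gradedMul_right hf isDeg_id,
    LinearMap.add_comp, ← h]

theorem coder_apply_one {f : SymC 𝒱 →ₗ[F] V} (hf : f 1 = 0) : coder 𝒱 f 1 = 0 := by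
  simp [coder_eq_conv, conv_apply_one, hf]

omit [DirectSum.Decomposition 𝒲] in
/-- Maps of odd degree anticommute under convolution. -/
theorem conv_conv_self_of_odd [CharZero F] {f : SymC 𝒱 →ₗ[F] W} {k : ℤ} (hk : Odd k)
    (hf : IsDeg (deg 𝒱) 𝒲 k f) (G : SymC 𝒱 →ₗ[F] SymC 𝒲) :
    conv (LinearMap.mul F (SymC 𝒲)) (ι 𝒲 ∘ₗ f ∘ₗ parity (deg 𝒱))
      (conv (LinearMap.mul F (SymC 𝒲)) (ι 𝒲 ∘ₗ f) G) = 0 := by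
  set Q := conv (LinearMap.mul F (SymC 𝒲)) (ι 𝒲 ∘ₗ f ∘ₗ parity (deg 𝒱))
      (conv (LinearMap.mul F (SymC 𝒲)) (ι 𝒲 ∘ₗ f) G) with hQ
  -- Exchanging two values of a map of odd degree costs one minus sign beyond those absorbed by
  -- cocommutativity and by `parity`.
  have h2 : Q = -Q := by
    rw [hQ, ← conv_neg_left]
    refine conv_left_comm (fun i j x hx y hy c => ?_) _
    have hfx := ι_mem_deg 𝒲 (hf i x hx)
    have hfy := ι_mem_deg 𝒲 (hf j y hy)
    simp only [LinearMap.comp_apply, parity_apply hx, parity_apply hy, LinearMap.mul_apply',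
      map_smul, LinearMap.neg_apply, LinearMap.smul_apply, smul_mul_assoc, neg_mul, ← mul_assoc]
    rw [mul_comm_deg hfx hfy, smul_mul_assoc, smul_smul, ← neg_smul, smul_smul, mul_neg, ← sgn_add,
      ← sgn_add]
    congr 1
    have hk' := Int.not_even_iff_odd.2 hk
    exact sgn_eq_neg (by simp [Int.even_add, Int.even_mul, hk', -Int.not_even_iff_odd]; tauto)
  have h3 : (2 : F) • Q = 0 := by
    rw [two_smul]
    nth_rw 1 [h2]
    exact neg_add_cancel _
  exact (smul_eq_zero_iff_right two_ne_zero).1 h3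

/-- The square of a coderivation of odd degree. -/
theorem coder_comp_self [CharZero F] {f : SymC 𝒱 →ₗ[F] V} (hf : IsDeg (deg 𝒱) 𝒱 (-1) f) :
    coder 𝒱 f ∘ₗ coder 𝒱 f = coder 𝒱 (f ∘ₗ coder 𝒱 f) := by
  -- The second summand collects the terms where the two applications of f act on disjoint sets of
  -- letters; they cancel in pairs by oddness.
  have h1 : coder 𝒱 f ∘ₗ coder 𝒱 f = coder 𝒱 (f ∘ₗ coder 𝒱 f) +
      conv (LinearMap.mul F (SymC 𝒱)) (ι 𝒱 ∘ₗ f ∘ₗ parity (deg 𝒱)) (coder 𝒱 f) := by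
    nth_rw 1 [coder_eq_conv]
    exact conv_comp_coderivation (E := LinearMap.id)
      (by rw [comul_comp_coder hf, LinearMap.comp_id]) _ _ _
  have h2 := conv_conv_self_of_odd (by simp) hf LinearMap.id
  rw [← coder_eq_conv] at h2
  rw [h1, h2, add_zero]

end Coder

end SymC

namespace SymC

variable {F V A B C : Type*} [Field F] [AddCommGroup V] [Module F V]
  [AddCommGroup A] [Module F A] [AddCommGroup B] [Module F B] [AddCommGroup C] [Module F C]
  {𝒱 : ℤ → Submodule F V} [DirectSum.Decomposition 𝒱]

theorem conv_comp_parity (μ : A →ₗ[F] B →ₗ[F] C) (f : SymC 𝒱 →ₗ[F] A) (g : SymC 𝒱 →ₗ[F] B) :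
    conv μ f g ∘ₗ parity (deg 𝒱) = conv μ (f ∘ₗ parity (deg 𝒱)) (g ∘ₗ parity (deg 𝒱)) :=
  conv_comp_hom (by rw [parity_eq_twist, comul_twist]) μ f g

end SymC

/-! ### The cup bracket and the square of d + ∂ -/

section Bracket

variable {F g V : Type*} [Field F] [AddCommGroup g] [Module F g] [AddCommGroup V] [Module F V]
  {𝒢 : ℤ → Submodule F g} [DirectSum.Decomposition 𝒢] (L : DGLA 𝒢)
  {𝒱 : ℤ → Submodule F V} [DirectSum.Decomposition 𝒱]

open SymC

omit [DirectSum.Decomposition 𝒢] in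
theorem DGLA.cup_eq_conv (a b : SymC 𝒱 →ₗ[F] g) :
    L.cup a b = conv L.bracket (a ∘ₗ parity (deg 𝒱)) b := rfl

omit [DirectSum.Decomposition 𝒢] in
theorem isDeg_cup {a b : SymC 𝒱 →ₗ[F] g} (ha : IsDeg (deg 𝒱) 𝒢 (-1) a)
    (hb : IsDeg (deg 𝒱) 𝒢 (-1) b) : IsDeg (deg 𝒱) 𝒢 (-2) (L.cup a b) :=
  isDeg_conv (fun i j x hx y hy => L.bracket_mem i j x y hx hy) ha.comp_parity hb

omit [DirectSum.Decomposition 𝒢] in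
theorem isDeg_univ : IsDeg (deg (susp 𝒢)) 𝒢 (-1) (univ 𝒢) := fun i x hx => by
  have := isDeg_proj i x hx
  rwa [add_zero] at this

omit [DirectSum.Decomposition 𝒢] in
/-- The bracket is graded commutative under convolution. -/
theorem DGLA.conv_bracket_swap {a f : SymC 𝒱 →ₗ[F] g} (ha : IsDeg (deg 𝒱) 𝒢 (-1) a)
    (hf : IsDeg (deg 𝒱) 𝒢 (-2) f) :
    conv L.bracket a f = -conv L.bracket (f ∘ₗ parity (deg 𝒱)) a := by
  rw [← conv_neg_left]
  refine conv_comm fun i j x hx y hy => ?_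
  rw [L.skew _ _ _ _ (ha i x hx) (hf j y hy), units_smul_eq (F := F)]
  simp only [LinearMap.neg_apply, LinearMap.comp_apply, parity_apply hy, map_neg, map_smul,
    LinearMap.smul_apply, smul_neg, smul_smul, ← sgn_add]
  congr 2
  exact sgn_congr (by simp [Int.even_add, Int.even_mul, -Int.not_even_iff_odd]; tauto)

theorem DGLA.d_comp_conv_bracket (f h : SymC 𝒱 →ₗ[F] g) :
    L.d ∘ₗ conv L.bracket f h =
      conv L.bracket (L.d ∘ₗ f) h + conv L.bracket (parity 𝒢 ∘ₗ f) (L.d ∘ₗ h) := by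
  have key : ∀ u v, L.d (L.bracket u v) = L.bracket (L.d u) v + L.bracket (parity 𝒢 u) (L.d v) := by
    intro u v
    induction u using DirectSum.Decomposition.inductionOn 𝒢 with
    | zero => simp
    | @homogeneous i u =>
      rw [L.leibniz _ _ _ u.2, units_smul_eq (F := F), parity_apply u.2, map_smul,
        LinearMap.smul_apply]
    | add u u' hu hu' =>
      simp only [map_add, LinearMap.add_apply, hu, hu']
      abel
  simp only [conv, ← LinearMap.comp_assoc]
  rw [← LinearMap.add_comp]
  congr 1
  exact TensorProduct.ext' fun x y => by simp [key]

omit [DirectSum.Decomposition 𝒢] in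
-- By Jacobi the adjoint of a bracket is a graded commutator. Its two terms agree after convolution,
-- since a is odd and Δ is cocommutative; this is the factor 2.
theorem DGLA.bracket_comp_cup_self {a : SymC 𝒱 →ₗ[F] g} (ha : IsDeg (deg 𝒱) 𝒢 (-1) a) :
    L.bracket ∘ₗ L.cup a a = (2 : F) • conv (LinearMap.mul F (Module.End F g))
      (L.bracket ∘ₗ a ∘ₗ parity (deg 𝒱)) (L.bracket ∘ₗ a) := by
  set M := TensorProduct.lift (LinearMap.mul F (Module.End F g)) ∘ₗ
    TensorProduct.map (L.bracket ∘ₗ a ∘ₗ parity (deg 𝒱)) (L.bracket ∘ₗ a) with hM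
  set N : SymC 𝒱 ⊗[F] SymC 𝒱 →ₗ[F] Module.End F g := L.bracket ∘ₗ TensorProduct.lift L.bracket ∘ₗ
    TensorProduct.map (a ∘ₗ parity (deg 𝒱)) a with hN
  have h : (M - N) ∘ₗ comul 𝒱 = (-M) ∘ₗ comul 𝒱 := by
    refine comul_comm fun i j x hx y hy => LinearMap.ext fun z => ?_
    simp only [hM, hN, LinearMap.sub_apply, LinearMap.neg_apply, LinearMap.comp_apply,
      TensorProduct.map_tmul, TensorProduct.lift.tmul, parity_apply hx, parity_apply hy,
      LinearMap.mul_apply', map_smul, LinearMap.smul_apply, Module.End.mul_apply,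
      L.jacobi _ _ _ _ z (ha i x hx) (ha j y hy), units_smul_eq (F := F), smul_add, smul_neg,
      smul_smul, ← sgn_add, add_sub_cancel_left]
    rw [← neg_smul]
    congr 1
    exact sgn_eq_neg (by simp [Int.even_add, Int.even_mul, -Int.not_even_iff_odd]; tauto)
  have h1 : L.bracket ∘ₗ L.cup a a = N ∘ₗ comul 𝒱 := rfl
  have h2 : conv (LinearMap.mul F (Module.End F g))
      (L.bracket ∘ₗ a ∘ₗ parity (deg 𝒱)) (L.bracket ∘ₗ a) = M ∘ₗ comul 𝒱 := rfl
  rw [h1, h2, two_smul]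
  rw [LinearMap.sub_comp, LinearMap.neg_comp] at h
  rw [← sub_eq_zero, ← neg_eq_zero, ← sub_eq_zero.2 h]
  abel

omit [DirectSum.Decomposition 𝒢] in
/-- The Jacobi identity: `[[a, a], a] = 0`. -/
theorem DGLA.cup_cup_self [CharZero F] {a : SymC 𝒱 →ₗ[F] g} (ha : IsDeg (deg 𝒱) 𝒢 (-1) a) :
    conv L.bracket (L.cup a a ∘ₗ parity (deg 𝒱)) a = 0 := by
  set K := conv L.bracket (L.cup a a ∘ₗ parity (deg 𝒱)) a with hK
  -- Skew symmetry gives [a,[a,a]] = -K up to the `parity` conventions, while Jacobi gives K =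
  -- 2[a,[a,a]].
  have h1 : conv L.bracket a (L.cup a a) = -K := L.conv_bracket_swap ha (isDeg_cup L ha ha)
  have h2 : K = (2 : F) • conv L.bracket a (L.cup a a) := by
    have e1 : K = conv LinearMap.id ((L.bracket ∘ₗ L.cup a a) ∘ₗ parity (deg 𝒱)) a :=
      conv_congr fun x y => rfl
    rw [e1, L.bracket_comp_cup_self ha, LinearMap.smul_comp, conv_smul_left, conv_comp_parity,
      conv_assoc (μ₃ := LinearMap.id) (μ₄ := LinearMap.id) (fun _ _ _ => rfl)]
    congr 1
    have e2 : conv LinearMap.id ((L.bracket ∘ₗ a) ∘ₗ parity (deg 𝒱)) a = L.cup a a :=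
      conv_congr fun x y => rfl
    rw [e2, LinearMap.comp_assoc, LinearMap.comp_assoc, parity_comp_parity, LinearMap.comp_id]
    exact conv_congr fun x y => rfl
  rw [h1] at h2
  -- Combined, K = -2K.
  have h3 : (3 : F) • K = 0 := by
    rw [show (3 : F) = 1 + 2 by norm_num, add_smul, one_smul]
    nth_rw 1 [h2]
    rw [smul_neg, neg_add_cancel]
  exact (smul_eq_zero_iff_right three_ne_zero).1 h3

/-- The projection of `d + ∂` to the letters. -/
def DGLA.chevalley (L : DGLA 𝒢) : SymC (susp 𝒢) →ₗ[F] g :=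
  L.d ∘ₗ univ 𝒢 + (2 : F)⁻¹ • L.cup (univ 𝒢) (univ 𝒢)

theorem DGLA.dS_add_partial : L.dS + L.partial = coder (susp 𝒢) L.chevalley :=
  (coder_add _ _).symm

omit [DirectSum.Decomposition 𝒢] in
theorem isDeg_d_univ : IsDeg (deg (susp 𝒢)) 𝒢 (-2) (L.d ∘ₗ univ 𝒢) :=
  L.isDifferential.deg.comp isDeg_univ

theorem DGLA.isDeg_chevalley : IsDeg (deg (susp 𝒢)) 𝒢 (-2) L.chevalley :=
  (isDeg_d_univ L).add ((isDeg_cup L isDeg_univ isDeg_univ).smul _)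

omit [DirectSum.Decomposition 𝒢] [DirectSum.Decomposition 𝒱] in
theorem isDeg_susp {f : SymC 𝒱 →ₗ[F] g} {k l : ℤ} (hf : IsDeg (deg 𝒱) 𝒢 k f) (h : k + 1 = l) :
    IsDeg (deg 𝒱) (susp 𝒢) l f := fun i x hx => by
  have := hf i x hx
  rwa [show i + k = i + l - 1 by omega] at this

/-- With f the projection of d + ∂ and D its coderivation, f D = d f + ½[τ,τ] D for the universal τ.
The linear part dies by d² = 0, the cubic part by Jacobi, and the two quadratic parts cancel by the
Leibniz rule. -/
theorem DGLA.chevalley_comp_coder [CharZero F] :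
    L.chevalley ∘ₗ coder (susp 𝒢) L.chevalley = 0 := by
  set f := L.chevalley with hf
  set τ := univ 𝒢
  set D := coder (susp 𝒢) f with hD
  have hf2 : IsDeg (deg (susp 𝒢)) 𝒢 (-2) f := L.isDeg_chevalley
  have hf1 : IsDeg (deg (susp 𝒢)) (susp 𝒢) (-1) f := isDeg_susp hf2 (by norm_num)
  have hτ : IsDeg (deg (susp 𝒢)) 𝒢 (-1) τ := isDeg_univ
  have hτD : τ ∘ₗ D = f := proj_comp_coder f
  have hpar : parity (deg (susp 𝒢)) ∘ₗ D = -(D ∘ₗ parity (deg (susp 𝒢))) := by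
    rw [parity_comp (isDeg_coder hf1), sgn_of_odd (by simp)]
    exact neg_one_smul F (D ∘ₗ parity (deg (susp 𝒢)))
  set P := parity (deg (susp 𝒢)) with hP
  have hPP : P ∘ₗ P = LinearMap.id := parity_comp_parity
  -- the bracket part
  have h1 : L.cup τ τ ∘ₗ D = (-2 : F) • conv L.bracket ((L.d ∘ₗ τ) ∘ₗ P) τ := by
    rw [L.cup_eq_conv, conv_comp_coderivation (E := LinearMap.id)
      (by rw [comul_comp_coder hf1, LinearMap.comp_id]), LinearMap.comp_id, LinearMap.comp_id,
      LinearMap.comp_assoc, LinearMap.comp_assoc, ← hP, hPP, hpar, LinearMap.comp_neg,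
      ← LinearMap.comp_assoc, hτD, LinearMap.comp_id, conv_neg_left, L.conv_bracket_swap hτ hf2,
      ← hP, hf, DGLA.chevalley, LinearMap.add_comp, conv_add_left, LinearMap.smul_comp,
      conv_smul_left, L.cup_cup_self hτ, smul_zero, add_zero]
    module
  have h2 : L.d ∘ₗ L.cup τ τ = (2 : F) • conv L.bracket ((L.d ∘ₗ τ) ∘ₗ P) τ := by
    rw [L.cup_eq_conv, L.d_comp_conv_bracket, ← LinearMap.comp_assoc, ← LinearMap.comp_assoc,
      parity_comp hτ, ← hP, sgn_of_odd (by simp), LinearMap.smul_comp, LinearMap.comp_assoc P P τ,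
      hPP, conv_smul_left, LinearMap.comp_id, L.conv_bracket_swap hτ (isDeg_d_univ L)]
    module
  have h3 : L.d ∘ₗ f = (2 : F)⁻¹ • L.d ∘ₗ L.cup τ τ := by
    rw [hf, DGLA.chevalley, LinearMap.comp_add, ← LinearMap.comp_assoc, L.isDifferential.sq,
      LinearMap.zero_comp, zero_add, LinearMap.comp_smul]
  conv_lhs => rw [hf, DGLA.chevalley]
  rw [LinearMap.add_comp, LinearMap.comp_assoc, hτD, LinearMap.smul_comp, h3, h1, h2]
  module

theorem DGLA.isDifferential_dS_add_partial [CharZero F] :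
    IsDifferential (deg (susp 𝒢)) (L.dS + L.partial) := by
  have hf1 : IsDeg (deg (susp 𝒢)) (susp 𝒢) (-1) L.chevalley :=
    isDeg_susp L.isDeg_chevalley (by norm_num)
  rw [L.dS_add_partial]
  exact ⟨isDeg_coder hf1, by rw [coder_comp_self hf1, L.chevalley_comp_coder, coder_zero]⟩

/-- The differential induced by the differential of `g` alone. -/
theorem DGLA.dS_comp_dS [CharZero F] : L.dS ∘ₗ L.dS = 0 := by
  have hf1 : IsDeg (deg (susp 𝒢)) (susp 𝒢) (-1) (L.d ∘ₗ univ 𝒢) :=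
    isDeg_susp (isDeg_d_univ L) (by norm_num)
  rw [DGLA.dS, coder_comp_self hf1, LinearMap.comp_assoc, univ, proj_comp_coder,
    ← LinearMap.comp_assoc, L.isDifferential.sq, LinearMap.zero_comp, coder_zero]

end Bracket

/-! ### Word length, derivations and coalgebra morphisms -/

namespace SymC

variable {F V W A B C : Type*} [Field F] [AddCommGroup V] [Module F V]
  [AddCommGroup W] [Module F W]
  [AddCommGroup A] [Module F A] [AddCommGroup B] [Module F B] [AddCommGroup C] [Module F C]
  {𝒱 : ℤ → Submodule F V} {𝒲 : ℤ → Submodule F W}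

theorem IsWord.eq_one {m : ℤ} {x : SymC 𝒱} (hx : IsWord 𝒱 0 m x) : x = 1 := by
  cases hx; rfl

theorem IsWord.wordLength_eq {n : ℕ} {m : ℤ} {x : SymC 𝒱} (hx : IsWord 𝒱 n m x) :
    wordLength 𝒱 x = Polynomial.monomial n x := by
  induction hx with
  | one => simp
  | mul hv _ ih =>
    rw [map_mul, ih, wordLength, lift_ι]
    simp [Polynomial.monomial_mul_monomial, add_comm]

theorem IsWord.total_eq {n : ℕ} {m : ℤ} {x : SymC 𝒱} (hx : IsWord 𝒱 n m x)
    (f : ℕ → SymC 𝒱 →ₗ[F] W) : total 𝒱 f x = f n x := by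
  simp only [total, LinearMap.comp_apply, AlgHom.toLinearMap_apply, hx.wordLength_eq]
  exact Polynomial.sum_monomial_index _ _ (by simp)

variable [DirectSum.Decomposition 𝒱] [DirectSum.Decomposition 𝒲]

theorem conv_ι_mul {i : ℤ} {v : V} (hv : v ∈ 𝒱 i) (μ : A →ₗ[F] B →ₗ[F] C) (f : SymC 𝒱 →ₗ[F] A)
    (g : SymC 𝒱 →ₗ[F] B) (x : SymC 𝒱) :
    conv μ f g (ι 𝒱 v * x) = conv μ (f ∘ₗ LinearMap.mulLeft F (ι 𝒱 v)) g x +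
      conv μ (f ∘ₗ twist (deg 𝒱) i) (g ∘ₗ LinearMap.mulLeft F (ι 𝒱 v)) x := by
  simp only [conv, LinearMap.comp_apply, comul_ι_mul hv, map_add, TensorProduct.map_comp]
  congr 1
  congr 1
  rw [← LinearMap.comp_apply, ← TensorProduct.map_comp, LinearMap.comp_id]

omit [DirectSum.Decomposition 𝒲] in
/-- The convolution of an operator on the letters with a morphism of algebras `φ` is a
`φ`-derivation. -/
theorem conv_proj_ι_mul {k : ℤ} {f : V →ₗ[F] W} (hf : IsDeg 𝒱 𝒲 k f) (φ : SymC 𝒱 →ₐ[F] SymC 𝒲)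
    (hφ : ∀ i, ∀ v ∈ 𝒱 i, φ (ι 𝒱 v) ∈ deg 𝒲 i) {i : ℤ} {v : V} (hv : v ∈ 𝒱 i) (x : SymC 𝒱) :
    conv (LinearMap.mul F (SymC 𝒲)) (ι 𝒲 ∘ₗ f ∘ₗ proj 𝒱) φ.toLinearMap (ι 𝒱 v * x) =
      ι 𝒲 (f v) * φ x + sgn F (k * i) • (φ (ι 𝒱 v) *
        conv (LinearMap.mul F (SymC 𝒲)) (ι 𝒲 ∘ₗ f ∘ₗ proj 𝒱) φ.toLinearMap x) := by
  rw [conv_ι_mul hv]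
  congr 1
  -- If v lies in the factor met by `proj`, the rest of that factor must be a scalar: the counit law
  -- applies.
  · have h1 : conv (LinearMap.mul F (SymC 𝒲))
        ((ι 𝒲 ∘ₗ f ∘ₗ proj 𝒱) ∘ₗ LinearMap.mulLeft F (ι 𝒱 v)) φ.toLinearMap =
        conv ((LinearMap.lsmul F (SymC 𝒲)).compl₂ (LinearMap.mulLeft F (ι 𝒲 (f v))))
          (counit 𝒱).toLinearMap φ.toLinearMap :=
      conv_congr fun y z => by simp [proj_ι_mul]
    rw [h1, conv_counit_left _ (T := LinearMap.mulLeft F (ι 𝒲 (f v))) (fun c b => by simp)]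
    rfl
  · have h2 : (sgn F (k * i) • LinearMap.mulLeft F (φ (ι 𝒱 v))) ∘ₗ
        conv (LinearMap.mul F (SymC 𝒲)) (ι 𝒲 ∘ₗ f ∘ₗ proj 𝒱) φ.toLinearMap =
        conv (LinearMap.mul F (SymC 𝒲)) ((ι 𝒲 ∘ₗ f ∘ₗ proj 𝒱) ∘ₗ twist (deg 𝒱) i)
          (φ.toLinearMap ∘ₗ LinearMap.mulLeft F (ι 𝒱 v)) :=
      comp_conv_deg fun j l y hy z hz => by
        have h3 := hf j _ (isDeg_proj.zero_mem hy)
        simp only [LinearMap.smul_apply, LinearMap.comp_apply, LinearMap.mulLeft_apply,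
          twist_apply hy, map_smul, LinearMap.mul_apply', AlgHom.toLinearMap_apply, map_mul,
          ← mul_assoc]
        rw [ι_mul_comm h3 (hφ i v hv), smul_mul_assoc, smul_smul]
        congr 1
        rw [← sgn_add]
        exact sgn_congr (by simp [Int.even_add, Int.even_mul]; tauto)
    rw [← h2]
    rfl

/-! ### Uniqueness of morphisms of coalgebras -/

/-- This coderivation is the Euler operator: it is also a derivation, and it fixes the letters. -/
theorem IsWord.coder_proj {n : ℕ} {m : ℤ} {x : SymC 𝒱} (hx : IsWord 𝒱 n m x) :
    coder 𝒱 (proj 𝒱) x = (n : F) • x := by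
  induction hx with
  | one => simp [coder_apply_one proj_one]
  | mul hv hx ih =>
    have := conv_proj_ι_mul (k := 0) (isDeg_id (𝒱 := 𝒱)) (AlgHom.id F (SymC 𝒱))
      (fun i v hv => ι_mem_deg 𝒱 hv) hv
    rw [LinearMap.id_comp] at this
    refine (this _).trans ?_
    have h2 : conv (LinearMap.mul F (SymC 𝒱)) (ι 𝒱 ∘ₗ proj 𝒱) (AlgHom.id F (SymC 𝒱)).toLinearMap =
      coder 𝒱 (proj 𝒱) := rfl
    rw [h2, ih]
    simp [add_smul, add_comm]

/-- On words of length at most N + 1, the Euler operator minus N + 1 lowers the filtration. An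
element of its kernel therefore descends to the scalars, where the counit detects it. -/
theorem eq_zero_of_coder_proj [CharZero F] {x : SymC 𝒱} (h : coder 𝒱 (proj 𝒱) x = 0)
    (h' : counit 𝒱 x = 0) : x = 0 := by
  obtain ⟨N, hN⟩ := exists_mem_filt x
  have h0 : x ∈ filt 𝒱 0 := by
    induction N with
    | zero => exact hN
    | succ N ih =>
      refine ih ?_
      have := mapsTo_filt (N := N + 1) (P := filt 𝒱 N)
        (f := coder 𝒱 (proj 𝒱) - ((N + 1 : ℕ) : F) • LinearMap.id) (fun n m y hn hy => by
          rw [LinearMap.sub_apply, hy.coder_proj, LinearMap.smul_apply, LinearMap.id_apply,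
            ← sub_smul]
          rcases hn.eq_or_lt with rfl | hn
          · simp
          · exact Submodule.smul_mem _ _ (hy.mem_filt (by omega))) x hN
      rw [LinearMap.sub_apply, h, zero_sub, Submodule.neg_mem_iff, LinearMap.smul_apply,
        LinearMap.id_apply] at this
      exact (Submodule.smul_mem_iff _ (Nat.cast_ne_zero.2 N.succ_ne_zero)).1 this
  rw [filt_zero, Submodule.mem_span_singleton] at h0
  obtain ⟨c, rfl⟩ := h0
  rw [map_smul, map_one, smul_eq_mul, mul_one] at h'
  rw [h', zero_smul]

/-- The Euler operator applied to f - f' is the convolution of the common projection with f - f'.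
That projection vanishes at 1, so only shorter words reach f - f', and induction on the length
applies. -/
theorem coalgHom_ext [CharZero F] {f f' : SymC 𝒱 →ₗ[F] SymC 𝒲}
    (hf : comul 𝒲 ∘ₗ f = TensorProduct.map f f ∘ₗ comul 𝒱)
    (hf' : comul 𝒲 ∘ₗ f' = TensorProduct.map f' f' ∘ₗ comul 𝒱)
    (hε : (counit 𝒲).toLinearMap ∘ₗ f = (counit 𝒲).toLinearMap ∘ₗ f')
    (h1 : f 1 = 1) (h : proj 𝒲 ∘ₗ f = proj 𝒲 ∘ₗ f') : f = f' := by
  have key : coder 𝒲 (proj 𝒲) ∘ₗ (f - f') =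
      conv (LinearMap.mul F (SymC 𝒲)) (ι 𝒲 ∘ₗ proj 𝒲 ∘ₗ f) (f - f') := by
    rw [LinearMap.comp_sub, coder_comp_hom hf, coder_comp_hom hf', conv_sub_right, h]
  rw [← sub_eq_zero]
  refine hom_ext_word fun n => ?_
  induction n using Nat.strong_induction_on with
  | _ n ih =>
    intro m x hx
    refine eq_zero_of_coder_proj ?_ ?_
    · rw [← LinearMap.comp_apply, key]
      refine (Submodule.mem_bot F).1 (hx.conv_mem fun n₁ n₂ m₁ m₂ y z hy hz hn _ => ?_)
      rcases Nat.eq_zero_or_pos n₁ with rfl | hn₁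
      · rw [hy.eq_one]
        simp [h1, proj_one]
      · rw [ih n₂ (by omega) _ _ hz]
        simp
    · have := LinearMap.congr_fun hε x
      simpa [sub_eq_zero] using this

/-! ### Existence of morphisms of coalgebras -/

/-- The divided powers of `a` with respect to the convolution product. -/
def divPow (a : SymC 𝒱 →ₗ[F] W) : ℕ → (SymC 𝒱 →ₗ[F] SymC 𝒲)
  | 0 => Algebra.linearMap F (SymC 𝒲) ∘ₗ (counit 𝒱).toLinearMap
  | n + 1 => ((n + 1 : ℕ) : F)⁻¹ • conv (LinearMap.mul F (SymC 𝒲)) (ι 𝒲 ∘ₗ a) (divPow a n)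

variable {a : SymC 𝒱 →ₗ[F] W}

omit [DirectSum.Decomposition 𝒲] in
theorem divPow_zero_apply (x : SymC 𝒱) : divPow (𝒲 := 𝒲) a 0 x = counit 𝒱 x • 1 := by
  simp [divPow, Algebra.algebraMap_eq_smul_one]

omit [DirectSum.Decomposition 𝒲] in
theorem smul_divPow_succ [CharZero F] (n : ℕ) : ((n + 1 : ℕ) : F) • divPow (𝒲 := 𝒲) a (n + 1) =
    conv (LinearMap.mul F (SymC 𝒲)) (ι 𝒲 ∘ₗ a) (divPow a n) := by
  rw [divPow, smul_smul, mul_inv_cancel₀ (Nat.cast_ne_zero.2 n.succ_ne_zero), one_smul]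

omit [DirectSum.Decomposition 𝒲] in
theorem isDeg_divPow (ha : IsDeg (deg 𝒱) 𝒲 0 a) (n : ℕ) :
    IsDeg (deg 𝒱) (deg 𝒲) 0 (divPow (𝒲 := 𝒲) a n) := by
  induction n with
  | zero =>
    refine isDeg_of_word fun n m x hx => ?_
    rw [divPow_zero_apply]
    rcases eq_or_ne n 0 with rfl | hn
    · cases hx
      rw [add_zero]
      exact Submodule.smul_mem _ _ SetLike.GradedOne.one_mem
    · simp [hx.counit_eq_zero hn]
  | succ n ih =>
    have := isDeg_conv (𝒞 := deg 𝒲) (μ := LinearMap.mul F (SymC 𝒲))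
      (fun i j x hx y hy => SetLike.GradedMul.mul_mem hx hy) (isDeg_ι.comp ha) ih
    rw [add_zero, add_zero] at this
    exact this.smul _

omit [DirectSum.Decomposition 𝒲] in
-- Each of the k factors a must consume at least one letter.
theorem IsWord.divPow_eq_zero (ha : a 1 = 0) {n k : ℕ} {m : ℤ} {x : SymC 𝒱}
    (hx : IsWord 𝒱 n m x) (h : n < k) : divPow (𝒲 := 𝒲) a k x = 0 := by
  induction k generalizing n m x with
  | zero => omega
  | succ k ih =>
    rw [divPow, LinearMap.smul_apply]
    refine (Submodule.mem_bot F).1 (Submodule.smul_mem _ _ (hx.conv_mem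
      fun n₁ n₂ m₁ m₂ y z hy hz hn _ => ?_))
    rcases Nat.eq_zero_or_pos n₁ with rfl | hn₁
    · rw [hy.eq_one]
      simp [ha]
    · rw [ih hz (by omega)]
      simp

omit [DirectSum.Decomposition 𝒲] in
theorem divPow_mem_filt (k : ℕ) (x : SymC 𝒱) : divPow (𝒲 := 𝒲) a k x ∈ filt 𝒲 k := by
  suffices ∀ x, divPow (𝒲 := 𝒲) a k x ∈ LinearMap.range (ι 𝒲) ^ k from
    (le_iSup₂_of_le k le_rfl le_rfl : LinearMap.range (ι 𝒲) ^ k ≤ filt 𝒲 k) (this x)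
  clear x
  induction k with
  | zero =>
    intro x
    rw [divPow_zero_apply, pow_zero]
    exact Submodule.smul_mem _ _ (Submodule.one_le.1 le_rfl)
  | succ k ih =>
    intro x
    refine (Submodule.span_le (p := (LinearMap.range (ι 𝒲) ^ (k + 1)).comap
      (divPow (𝒲 := 𝒲) a (k + 1)))).2 ?_ (mem_span_isWord x)
    rintro x ⟨n, m, hx⟩
    change divPow (𝒲 := 𝒲) a (k + 1) x ∈ LinearMap.range (ι 𝒲) ^ (k + 1)
    rw [divPow, LinearMap.smul_apply]
    refine Submodule.smul_mem _ _ (hx.conv_mem fun n₁ n₂ m₁ m₂ y z hy hz hn _ => ?_)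
    rw [pow_succ']
    exact Submodule.mul_mem_mul ⟨_, rfl⟩ (ih z)

/-- The usual coproduct of divided powers: by primitivity each new letter joins the left or the
right factor, and the normalisation 1/n! absorbs the binomial coefficients. -/
theorem comul_divPow [CharZero F] (ha : IsDeg (deg 𝒱) 𝒲 0 a) (n : ℕ) :
    comul 𝒲 ∘ₗ divPow (𝒲 := 𝒲) a n = ∑ p ∈ Finset.HasAntidiagonal.antidiagonal n,
      TensorProduct.map (divPow (𝒲 := 𝒲) a p.1) (divPow (𝒲 := 𝒲) a p.2) ∘ₗ comul 𝒱 := by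
  induction n with
  | zero =>
    rw [Finset.Nat.antidiagonal_zero, Finset.sum_singleton]
    refine hom_ext_word fun n m x hx => ?_
    simp only [LinearMap.comp_apply, divPow_zero_apply, map_smul, comul_one]
    have h1 : TensorProduct.map (divPow (𝒲 := 𝒲) a 0) (divPow (𝒲 := 𝒲) a 0) ∘ₗ comul 𝒱 =
        (LinearMap.toSpanSingleton F (SymC 𝒲 ⊗[F] SymC 𝒲) (1 ⊗ₜ[F] 1)) ∘ₗ
          (counit 𝒱).toLinearMap := by
      rw [← conv_mk, ← conv_counit_left (𝒱 := 𝒱) (counit 𝒱).toLinearMap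
        (μ := (LinearMap.lsmul F _).compl₂
          (LinearMap.toSpanSingleton F (SymC 𝒲 ⊗[F] SymC 𝒲) (1 ⊗ₜ[F] 1)))
        (T := LinearMap.toSpanSingleton F (SymC 𝒲 ⊗[F] SymC 𝒲) (1 ⊗ₜ[F] 1)) (fun _ _ => rfl)]
      refine conv_congr fun x y => ?_
      simp [divPow_zero_apply, TensorProduct.smul_tmul', smul_smul,
        mul_comm]
    exact (LinearMap.congr_fun h1 x).symm
  | succ n ih =>
    set p := divPow (𝒲 := 𝒲) a with hp
    have hne : ((n + 1 : ℕ) : F) ≠ 0 := Nat.cast_ne_zero.2 n.succ_ne_zero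
    have hid : ∀ q : SymC 𝒱 →ₗ[F] SymC 𝒲, q ∘ₗ twist (deg 𝒱) 0 = q := fun q =>
      hom_ext_deg (𝒱 := deg 𝒱) fun i x hx => by simp [twist_apply hx]
    have hsum : ∀ (μ : SymC 𝒲 ⊗[F] SymC 𝒲 →ₗ[F] SymC 𝒲 ⊗[F] SymC 𝒲 →ₗ[F] SymC 𝒲 ⊗[F] SymC 𝒲) f
        (g : ℕ × ℕ → SymC 𝒱 →ₗ[F] SymC 𝒲 ⊗[F] SymC 𝒲) (s : Finset (ℕ × ℕ)),
        conv μ f (∑ k ∈ s, g k) = ∑ k ∈ s, conv μ f (g k) := by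
      intro μ f g s
      classical
      induction s using Finset.induction_on with
      | empty => simp [conv_zero_right]
      | insert a s ha ih => rw [Finset.sum_insert ha, Finset.sum_insert ha, conv_add_right, ih]
    have h1 : ((n + 1 : ℕ) : F) • (comul 𝒲 ∘ₗ p (n + 1)) =
        ∑ q ∈ Finset.HasAntidiagonal.antidiagonal n, (((q.1 + 1 : ℕ) : F) •
          TensorProduct.map (p (q.1 + 1)) (p q.2) ∘ₗ comul 𝒱) +
        ∑ q ∈ Finset.HasAntidiagonal.antidiagonal n, (((q.2 + 1 : ℕ) : F) •
          TensorProduct.map (p q.1) (p (q.2 + 1)) ∘ₗ comul 𝒱) := by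
      rw [← LinearMap.comp_smul, hp, smul_divPow_succ, comul_comp_conv, ih, hsum, hsum]
      congr 1
      · refine Finset.sum_congr rfl fun q _ => ?_
        rw [conv_gradedMul_left, ← smul_divPow_succ, TensorProduct.map_smul_left]
        rfl
      · refine Finset.sum_congr rfl fun q _ => ?_
        rw [conv_gradedMul_right ha (isDeg_divPow ha _), hid, ← smul_divPow_succ,
          TensorProduct.map_smul_right]
        rfl
    -- The weight n + 1 splits as q.1 + q.2. In each sum the term of weight zero drops out, and a
    -- shift of index yields the sums of `h1`.
    have h2 : ((n + 1 : ℕ) : F) • ∑ q ∈ Finset.HasAntidiagonal.antidiagonal (n + 1),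
          TensorProduct.map (p q.1) (p q.2) ∘ₗ comul 𝒱 =
        ∑ q ∈ Finset.HasAntidiagonal.antidiagonal (n + 1), ((q.1 : F) •
          TensorProduct.map (p q.1) (p q.2) ∘ₗ comul 𝒱) +
        ∑ q ∈ Finset.HasAntidiagonal.antidiagonal (n + 1), ((q.2 : F) •
          TensorProduct.map (p q.1) (p q.2) ∘ₗ comul 𝒱) := by
      rw [Finset.smul_sum, ← Finset.sum_add_distrib]
      refine Finset.sum_congr rfl fun q hq => ?_
      rw [← add_smul, ← Nat.cast_add, Finset.HasAntidiagonal.mem_antidiagonal.1 hq]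
    have e1 : ∑ q ∈ Finset.HasAntidiagonal.antidiagonal (n + 1), ((q.1 : F) •
        TensorProduct.map (p q.1) (p q.2) ∘ₗ comul 𝒱) =
        ∑ q ∈ Finset.HasAntidiagonal.antidiagonal n, (((q.1 + 1 : ℕ) : F) •
          TensorProduct.map (p (q.1 + 1)) (p q.2) ∘ₗ comul 𝒱) := by
      rw [Finset.Nat.sum_antidiagonal_succ]
      dsimp only
      rw [Nat.cast_zero, zero_smul, zero_add]
    have e2 : ∑ q ∈ Finset.HasAntidiagonal.antidiagonal (n + 1), ((q.2 : F) •
        TensorProduct.map (p q.1) (p q.2) ∘ₗ comul 𝒱) =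
        ∑ q ∈ Finset.HasAntidiagonal.antidiagonal n, (((q.2 + 1 : ℕ) : F) •
          TensorProduct.map (p q.1) (p (q.2 + 1)) ∘ₗ comul 𝒱) := by
      rw [Finset.Nat.sum_antidiagonal_succ']
      dsimp only
      rw [Nat.cast_zero, zero_smul, zero_add]
    rw [e1, e2, ← h1] at h2
    exact (smul_right_injective _ hne h2).symm

omit [DirectSum.Decomposition 𝒲] in
theorem counit_divPow (n : ℕ) : (counit 𝒲).toLinearMap ∘ₗ divPow (𝒲 := 𝒲) a n =
    if n = 0 then (counit 𝒱).toLinearMap else 0 := by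
  cases n with
  | zero => ext x; simp [divPow_zero_apply]
  | succ n =>
    rw [if_neg n.succ_ne_zero, divPow, LinearMap.comp_smul,
      comp_conv (μ' := LinearMap.mul F F) (f' := 0) (g' := (counit 𝒲).toLinearMap ∘ₗ divPow a n)
      (fun x y => by simp), conv_zero_left, smul_zero]

theorem proj_divPow (n : ℕ) : proj 𝒲 ∘ₗ divPow (𝒲 := 𝒲) a n = if n = 1 then a else 0 := by
  match n with
  | 0 => ext x; simp [divPow_zero_apply, proj_one]
  | 1 =>
    rw [if_pos rfl, divPow, LinearMap.comp_smul, proj_comp_conv a (counit_divPow 0)]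
    simp
  | n + 2 =>
    rw [if_neg (by omega), divPow, LinearMap.comp_smul,
      comp_conv (μ' := (LinearMap.lsmul F W).flip) (f' := a)
      (g' := (counit 𝒲).toLinearMap ∘ₗ divPow (𝒲 := 𝒲) a (n + 1))
      (fun x y => by simp [proj_ι_mul]), counit_divPow, if_neg n.succ_ne_zero, conv_zero_right,
      smul_zero]

/-- The convolution exponential: the morphism of coalgebras with projection `a` to the letters. -/
def coalgExp (a : SymC 𝒱 →ₗ[F] W) : SymC 𝒱 →ₗ[F] SymC 𝒲 :=
  total 𝒱 fun k => ∑ n ∈ Finset.range (k + 1), divPow (𝒲 := 𝒲) a n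

omit [DirectSum.Decomposition 𝒲] in
-- The freedom in N allows one truncation to serve for a word and for both factors of its coproduct.
theorem IsWord.coalgExp_eq (ha : a 1 = 0) {n N : ℕ} {m : ℤ} {x : SymC 𝒱} (hx : IsWord 𝒱 n m x)
    (h : n ≤ N) : coalgExp (𝒲 := 𝒲) a x = ∑ k ∈ Finset.range (N + 1), divPow (𝒲 := 𝒲) a k x := by
  rw [coalgExp, hx.total_eq, LinearMap.sum_apply]
  refine Finset.sum_subset (Finset.range_subset_range.2 (by omega)) fun k _ hk => ?_
  exact hx.divPow_eq_zero ha (by simpa using hk)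

omit [DirectSum.Decomposition 𝒲] in
theorem isDeg_coalgExp (ha : IsDeg (deg 𝒱) 𝒲 0 a) (ha1 : a 1 = 0) :
    IsDeg (deg 𝒱) (deg 𝒲) 0 (coalgExp (𝒲 := 𝒲) a) :=
  isDeg_of_word fun n m x hx => by
    rw [hx.coalgExp_eq ha1 le_rfl]
    exact Submodule.sum_mem _ fun k _ => isDeg_divPow ha k m x hx.mem_deg

omit [DirectSum.Decomposition 𝒲] in
theorem coalgExp_mem_filt (ha1 : a 1 = 0) (N : ℕ) :
    ∀ x ∈ filt 𝒱 N, coalgExp (𝒲 := 𝒲) a x ∈ filt 𝒲 N :=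
  mapsTo_filt fun n m x hn hx => by
    rw [hx.coalgExp_eq ha1 hn]
    exact Submodule.sum_mem _ fun k hk => filt_mono (by simp at hk; omega) (divPow_mem_filt k x)

theorem comul_coalgExp [CharZero F] (ha : IsDeg (deg 𝒱) 𝒲 0 a) (ha1 : a 1 = 0) :
    comul 𝒲 ∘ₗ coalgExp (𝒲 := 𝒲) a =
      TensorProduct.map (coalgExp (𝒲 := 𝒲) a) (coalgExp (𝒲 := 𝒲) a) ∘ₗ comul 𝒱 :=
  hom_ext_word fun N m x hx => by
    rw [LinearMap.comp_apply, hx.coalgExp_eq ha1 le_rfl, map_sum]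
    simp only [← LinearMap.comp_apply (comul 𝒲), comul_divPow ha]
    have h1 : ∑ k ∈ Finset.range (N + 1), (∑ p ∈ Finset.HasAntidiagonal.antidiagonal k,
        TensorProduct.map (divPow (𝒲 := 𝒲) a p.1) (divPow (𝒲 := 𝒲) a p.2) ∘ₗ comul 𝒱) x =
        (∑ k ∈ Finset.range (N + 1), ∑ p ∈ Finset.HasAntidiagonal.antidiagonal k,
        TensorProduct.map (divPow (𝒲 := 𝒲) a p.1) (divPow (𝒲 := 𝒲) a p.2)) (comul 𝒱 x) := by
      simp only [LinearMap.sum_apply, LinearMap.comp_apply]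
    rw [h1, LinearMap.comp_apply]
    refine hx.comul_congr fun n₁ n₂ m₁ m₂ y z hy hz hn _ => ?_
    rw [TensorProduct.map_tmul, hy.coalgExp_eq ha1 (N := N) (by omega),
      hz.coalgExp_eq ha1 (N := N) (by omega)]
    simp only [LinearMap.sum_apply, TensorProduct.map_tmul, TensorProduct.sum_tmul,
      TensorProduct.tmul_sum]
    rw [Finset.sum_comm, ← Finset.sum_product', ← Finset.sum_fiberwise_of_maps_to
      (s := Finset.range (N + 1) ×ˢ Finset.range (N + 1)) (t := Finset.range (2 * N + 1))
      (g := fun p => p.1 + p.2) (by simp; omega)]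
    -- The square of index pairs is sorted by p + q. Pairs with p + q > N vanish, since n₁ + n₂ = N
    -- forces p > n₁ or q > n₂.
    refine Finset.sum_subset_zero_on_sdiff (Finset.range_subset_range.2 (by omega)) ?_ ?_
    · intro k hk
      refine Finset.sum_eq_zero fun p hp => ?_
      simp only [Finset.mem_sdiff, Finset.mem_range, Finset.mem_filter, Finset.mem_product] at hk hp
      rcases lt_or_ge n₁ p.1 with h | h
      · rw [hy.divPow_eq_zero ha1 h, TensorProduct.zero_tmul]
      · rw [hz.divPow_eq_zero ha1 (k := p.2) (by omega), TensorProduct.tmul_zero]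
    · intro k hk
      refine Finset.sum_congr ?_ fun _ _ => rfl
      ext p
      simp only [Finset.mem_range, Finset.mem_filter, Finset.mem_product,
        Finset.HasAntidiagonal.mem_antidiagonal] at hk ⊢
      omega

omit [DirectSum.Decomposition 𝒲] in
theorem coalgExp_one (ha1 : a 1 = 0) : coalgExp (𝒲 := 𝒲) a 1 = 1 := by
  rw [IsWord.one.coalgExp_eq ha1 le_rfl]
  simp [divPow_zero_apply]

theorem counit_coalgExp (ha1 : a 1 = 0) :
    (counit 𝒲).toLinearMap ∘ₗ coalgExp (𝒲 := 𝒲) a = (counit 𝒱).toLinearMap :=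
  hom_ext_word fun n m x hx => by
    rw [LinearMap.comp_apply, hx.coalgExp_eq ha1 le_rfl, map_sum]
    simp only [← LinearMap.comp_apply (counit 𝒲).toLinearMap, counit_divPow]
    rw [Finset.sum_eq_single 0 (fun b _ hb => by simp [hb]) (by simp)]
    simp

theorem proj_coalgExp (ha1 : a 1 = 0) : proj 𝒲 ∘ₗ coalgExp (𝒲 := 𝒲) a = a :=
  hom_ext_word fun n m x hx => by
    rw [LinearMap.comp_apply, hx.coalgExp_eq ha1 (Nat.le_add_right n 1), map_sum]
    simp only [← LinearMap.comp_apply (proj 𝒲), proj_divPow]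
    rw [Finset.sum_eq_single 1 (fun b _ hb => by simp [hb]) (by simp)]
    simp

theorem isCoalgHom_coalgExp [CharZero F] (ha : IsDeg (deg 𝒱) 𝒲 0 a) (ha1 : a 1 = 0) :
    IsCoalgHom 𝒱 𝒲 (coalgExp (𝒲 := 𝒲) a) :=
  ⟨isDeg_coalgExp ha ha1, comul_coalgExp ha ha1, counit_coalgExp ha1, coalgExp_one ha1⟩

end SymC

/-- Quadrature: integration over `[0, 1]` of polynomials of bounded degree is a combination of
evaluations. -/
theorem exists_quadrature (F : Type*) [Field F] [CharZero F] (N : ℕ) :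
    ∃ w : ℕ → F, ∀ k ≤ N, ∑ j ∈ Finset.range (N + 1), w j * (j : F) ^ k = ((k : F) + 1)⁻¹ := by
  set I : F[X] →ₗ[F] F := SymC.polySum fun k => ((k : F) + 1)⁻¹ • LinearMap.id with hI
  -- The weights are the integrals of the Lagrange polynomials for the nodes 0, …, N, which are
  -- distinct in characteristic zero.
  refine ⟨fun j => I (Lagrange.basis (Finset.range (N + 1)) (fun j : ℕ => (j : F)) j),
    fun k hk => ?_⟩
  have h1 : (Polynomial.X ^ k : F[X]) = ∑ j ∈ Finset.range (N + 1),
      Polynomial.C ((j : F) ^ k) * Lagrange.basis (Finset.range (N + 1)) (fun j : ℕ => (j : F)) j := by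
    have := Lagrange.eq_interpolate (s := Finset.range (N + 1)) (v := fun j : ℕ => (j : F))
      (f := Polynomial.X ^ k) (Nat.cast_injective.injOn) (by
        rw [Polynomial.degree_X_pow, Finset.card_range]
        exact_mod_cast Nat.lt_succ_of_le hk)
    rw [this, Lagrange.interpolate_apply]
    simp
  have h2 : I (Polynomial.X ^ k) = ((k : F) + 1)⁻¹ := by
    rw [← Polynomial.monomial_one_right_eq_X_pow]
    exact (Polynomial.sum_monomial_index _ _ (by simp)).trans (by simp)
  rw [← h2, h1, map_sum]
  refine Finset.sum_congr rfl fun j _ => ?_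
  rw [← Polynomial.smul_eq_C_mul, map_smul, smul_eq_mul, mul_comm]

/-! ### Functoriality of S^c and the Leibniz rule -/

namespace SymC

variable {F V W : Type*} [Field F] [AddCommGroup V] [Module F V]
  [AddCommGroup W] [Module F W]
  {𝒱 : ℤ → Submodule F V} {𝒲 : ℤ → Submodule F W}

theorem map_ι {f : V →ₗ[F] W} (hf : IsDeg 𝒱 𝒲 0 f) (v : V) :
    map f hf (ι 𝒱 v) = ι 𝒲 (f v) := lift_ι _ _ _

theorem IsWord.map {f : V →ₗ[F] W} (hf : IsDeg 𝒱 𝒲 0 f) {n : ℕ} {m : ℤ} {x : SymC 𝒱}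
    (hx : IsWord 𝒱 n m x) : IsWord 𝒲 n m (SymC.map f hf x) := by
  induction hx with
  | one => rw [map_one]; exact IsWord.one
  | mul hv _ ih => rw [map_mul, map_ι]; exact IsWord.mul (hf.zero_mem hv) ih

theorem counit_map {f : V →ₗ[F] W} (hf : IsDeg 𝒱 𝒲 0 f) :
    (counit 𝒲).toLinearMap ∘ₗ (map f hf).toLinearMap = (counit 𝒱).toLinearMap := by
  have : (counit 𝒲).comp (map f hf) = counit 𝒱 := hom_ext fun v => by simp [map_ι, counit]
  rw [← this]
  rfl

section

variable [DirectSum.Decomposition 𝒱] [DirectSum.Decomposition 𝒲]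

omit [DirectSum.Decomposition 𝒲] in
theorem proj_map {f : V →ₗ[F] W} (hf : IsDeg 𝒱 𝒲 0 f) :
    proj 𝒲 ∘ₗ (map f hf).toLinearMap = f ∘ₗ proj 𝒱 :=
  hom_ext_ι_mul (by simp [proj_one]) fun i v hv x _ => by
    have := LinearMap.congr_fun (counit_map hf) x
    simp only [LinearMap.comp_apply, AlgHom.toLinearMap_apply] at this ⊢
    rw [map_mul, map_ι, proj_ι_mul, proj_ι_mul, this, map_smul]

omit [DirectSum.Decomposition 𝒲] in
omit [DirectSum.Decomposition 𝒱] in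
theorem isDeg_map {f : V →ₗ[F] W} (hf : IsDeg 𝒱 𝒲 0 f) :
    IsDeg (deg 𝒱) (deg 𝒲) 0 (map f hf).toLinearMap :=
  isDeg_of_word fun n m x hx => by
    rw [add_zero]
    exact (hx.map hf).mem_deg

omit [DirectSum.Decomposition 𝒲] in
theorem map_mem_filt {f : V →ₗ[F] W} (hf : IsDeg 𝒱 𝒲 0 f) (N : ℕ) :
    ∀ x ∈ filt 𝒱 N, (map f hf).toLinearMap x ∈ filt 𝒲 N :=
  mapsTo_filt fun _ _ _ hn hx => (hx.map hf).mem_filt hn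

theorem comul_map {f : V →ₗ[F] W} (hf : IsDeg 𝒱 𝒲 0 f) :
    comul 𝒲 ∘ₗ (map f hf).toLinearMap =
      TensorProduct.map (map f hf).toLinearMap (map f hf).toLinearMap ∘ₗ comul 𝒱 :=
  hom_ext_ι_mul (by simp) fun i v hv x ih => by
    have ht : twist (deg 𝒲) i ∘ₗ (map f hf).toLinearMap =
        (map f hf).toLinearMap ∘ₗ twist (deg 𝒱) i :=
      hom_ext_deg (𝒱 := deg 𝒱) fun j y hy => by
        have hy' : map f hf y ∈ deg 𝒲 j := (isDeg_map hf).zero_mem hy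
        simp [twist_apply hy, twist_apply hy']
    have hl : LinearMap.mulLeft F (ι 𝒲 (f v)) ∘ₗ (map f hf).toLinearMap =
        (map f hf).toLinearMap ∘ₗ LinearMap.mulLeft F (ι 𝒱 v) :=
      LinearMap.ext fun y => by simp [map_ι]
    simp only [LinearMap.comp_apply, AlgHom.toLinearMap_apply, map_mul, map_ι] at ih ⊢
    rw [comul_ι_mul (hf.zero_mem hv), ih, comul_ι_mul hv, map_add]
    simp only [← LinearMap.comp_apply (TensorProduct.map _ _) (TensorProduct.map _ _),
      ← TensorProduct.map_comp, hl, ht, LinearMap.id_comp, LinearMap.comp_id]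

/-- Both sides apply fd = d'f to one letter and f to all the others. -/
theorem coder_comp_map {f : V →ₗ[F] W} (hf : IsDeg 𝒱 𝒲 0 f) {d : V →ₗ[F] V} {d' : W →ₗ[F] W}
    (h : f ∘ₗ d = d' ∘ₗ f) :
    (map f hf).toLinearMap ∘ₗ coder 𝒱 (d ∘ₗ proj 𝒱) =
      coder 𝒲 (d' ∘ₗ proj 𝒲) ∘ₗ (map f hf).toLinearMap := by
  rw [coder_comp_hom (comul_map hf), LinearMap.comp_assoc, proj_map, ← LinearMap.comp_assoc _ f d',
    ← h, coder_eq_conv]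
  exact comp_conv fun x y => by simp [map_ι]

omit [DirectSum.Decomposition 𝒲] in
/-- The Leibniz rule. -/
theorem conv_proj_mul {k : ℤ} {f : V →ₗ[F] W} (hf : IsDeg 𝒱 𝒲 k f) (φ : SymC 𝒱 →ₐ[F] SymC 𝒲)
    (hφ : ∀ i, ∀ v ∈ 𝒱 i, φ (ι 𝒱 v) ∈ deg 𝒲 i) (x y : SymC 𝒱) :
    conv (LinearMap.mul F (SymC 𝒲)) (ι 𝒲 ∘ₗ f ∘ₗ proj 𝒱) φ.toLinearMap (x * y) =
      conv (LinearMap.mul F (SymC 𝒲)) (ι 𝒲 ∘ₗ f ∘ₗ proj 𝒱) φ.toLinearMap x * φ y +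
      φ (twist (deg 𝒱) k x) *
        conv (LinearMap.mul F (SymC 𝒲)) (ι 𝒲 ∘ₗ f ∘ₗ proj 𝒱) φ.toLinearMap y := by
  set D := conv (LinearMap.mul F (SymC 𝒲)) (ι 𝒲 ∘ₗ f ∘ₗ proj 𝒱) φ.toLinearMap with hD
  have h : D ∘ₗ LinearMap.mulRight F y = LinearMap.mulRight F (φ y) ∘ₗ D +
      LinearMap.mulRight F (D y) ∘ₗ φ.toLinearMap ∘ₗ twist (deg 𝒱) k := by
    refine hom_ext_word fun n m x hx => ?_
    induction hx with
    | one =>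
      have h1 : D 1 = 0 := by simp [hD, conv_apply_one, proj_one]
      simp [h1, twist_one]
    | @mul i m n v x hv hx ih =>
      simp only [LinearMap.comp_apply, LinearMap.add_apply, LinearMap.mulRight_apply,
        AlgHom.toLinearMap_apply] at ih ⊢
      rw [mul_assoc, hD, conv_proj_ι_mul hf φ hφ hv, ← hD, ih, conv_proj_ι_mul hf φ hφ hv, ← hD,
        twist_apply hx.mem_deg, twist_apply (IsWord.mul hv hx).mem_deg]
      simp only [map_smul, map_mul, mul_add, add_mul, smul_add, smul_mul_assoc, mul_smul_comm,
        smul_smul, mul_assoc, sgn_add, add_assoc]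
  simpa using LinearMap.congr_fun h x

omit [DirectSum.Decomposition 𝒲] in
theorem conv_proj_comp_conv {k : ℤ} {f : V →ₗ[F] W} (hf : IsDeg 𝒱 𝒲 k f)
    (φ : SymC 𝒱 →ₐ[F] SymC 𝒲) (hφ : ∀ i, ∀ v ∈ 𝒱 i, φ (ι 𝒱 v) ∈ deg 𝒲 i)
    {U : Type*} [AddCommGroup U] [Module F U] {𝒰 : ℤ → Submodule F U} [DirectSum.Decomposition 𝒰]
    (a b : SymC 𝒰 →ₗ[F] SymC 𝒱) :
    conv (LinearMap.mul F (SymC 𝒲)) (ι 𝒲 ∘ₗ f ∘ₗ proj 𝒱) φ.toLinearMap ∘ₗ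
        conv (LinearMap.mul F (SymC 𝒱)) a b =
      conv (LinearMap.mul F (SymC 𝒲))
        (conv (LinearMap.mul F (SymC 𝒲)) (ι 𝒲 ∘ₗ f ∘ₗ proj 𝒱) φ.toLinearMap ∘ₗ a)
        (φ.toLinearMap ∘ₗ b) +
      conv (LinearMap.mul F (SymC 𝒲)) (φ.toLinearMap ∘ₗ twist (deg 𝒱) k ∘ₗ a)
        (conv (LinearMap.mul F (SymC 𝒲)) (ι 𝒲 ∘ₗ f ∘ₗ proj 𝒱) φ.toLinearMap ∘ₗ b) := by
  refine hom_ext_word fun n m x hx => ?_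
  set D := conv (LinearMap.mul F (SymC 𝒲)) (ι 𝒲 ∘ₗ f ∘ₗ proj 𝒱) φ.toLinearMap with hD
  change (D ∘ₗ TensorProduct.lift (LinearMap.mul F (SymC 𝒱)) ∘ₗ TensorProduct.map a b)
      (comul 𝒰 x) =
    (TensorProduct.lift (LinearMap.mul F (SymC 𝒲)) ∘ₗ
      TensorProduct.map (D ∘ₗ a) (φ.toLinearMap ∘ₗ b) +
    TensorProduct.lift (LinearMap.mul F (SymC 𝒲)) ∘ₗ
      TensorProduct.map (φ.toLinearMap ∘ₗ twist (deg 𝒱) k ∘ₗ a) (D ∘ₗ b)) (comul 𝒰 x)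
  refine hx.comul_congr fun n₁ n₂ m₁ m₂ y z _ _ _ _ => ?_
  simp [conv_proj_mul hf φ hφ, hD]

omit [DirectSum.Decomposition 𝒲] in
theorem conv_proj_comp_ι (f : V →ₗ[F] W) (φ : SymC 𝒱 →ₐ[F] SymC 𝒲) :
    conv (LinearMap.mul F (SymC 𝒲)) (ι 𝒲 ∘ₗ f ∘ₗ proj 𝒱) φ.toLinearMap ∘ₗ ι 𝒱 = ι 𝒲 ∘ₗ f :=
  LinearMap.ext fun v => by simp [conv_apply_ι, proj_ι, proj_one]

end

/-! ### The symmetrized homotopy -/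

section Homotopy

variable [DirectSum.Decomposition 𝒱]

/-- The morphism `v ↦ v + t (P v - v)` on the letters. -/
def interp (P : V →ₗ[F] V) (t : F) : V →ₗ[F] V := LinearMap.id + t • (P - LinearMap.id)

omit [DirectSum.Decomposition 𝒱] in
theorem isDeg_interp {P : V →ₗ[F] V} (hP : IsDeg 𝒱 𝒱 0 P) (t : F) :
    IsDeg 𝒱 𝒱 0 (interp P t) := fun i x hx =>
  Submodule.add_mem _ (isDeg_id i x hx)
    (Submodule.smul_mem _ _ (Submodule.sub_mem _ (hP i x hx) (isDeg_id i x hx)))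

/-- The interpolation between `id` and `S^cP`. -/
def interpMap {P : V →ₗ[F] V} (hP : IsDeg 𝒱 𝒱 0 P) (t : F) : SymC 𝒱 →ₐ[F] SymC 𝒱 :=
  map (interp P t) (isDeg_interp hP t)

/-- The homotopy at the parameter `t`. -/
def homotopyAt (h : V →ₗ[F] V) {P : V →ₗ[F] V} (hP : IsDeg 𝒱 𝒱 0 P) (t : F) :
    SymC 𝒱 →ₗ[F] SymC 𝒱 :=
  conv (LinearMap.mul F (SymC 𝒱)) (ι 𝒱 ∘ₗ h ∘ₗ proj 𝒱) (interpMap hP t).toLinearMap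

variable {h d P : V →ₗ[F] V} (hP : IsDeg 𝒱 𝒱 0 P)

omit [DirectSum.Decomposition 𝒱] in
theorem interpMap_ι_mem (t : F) (i : ℤ) (v : V) (hv : v ∈ 𝒱 i) :
    interpMap hP t (ι 𝒱 v) ∈ deg 𝒱 i := by
  rw [interpMap, map_ι]
  exact ι_mem_deg 𝒱 ((isDeg_interp hP t).zero_mem hv)

/-- Independent parameters are required, because the square of the integral is a double integral. If
both h hit the same letter, hh = 0. Otherwise Ph = 0 and hP = 0 reduce the interpolations on the
marked letters to the scalars 1 - t and 1 - s, and the two odd marks cancel by antisymmetry. -/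
theorem homotopyAt_comp_homotopyAt [CharZero F] (hh : IsDeg 𝒱 𝒱 1 h) (hhh : h ∘ₗ h = 0)
    (hPh : P ∘ₗ h = 0) (hhP : h ∘ₗ P = 0) (s t : F) :
    homotopyAt h hP t ∘ₗ homotopyAt h hP s = 0 := by
  nth_rw 2 [homotopyAt]
  rw [homotopyAt, conv_proj_comp_conv hh _ (interpMap_ι_mem hP t), ← homotopyAt]
  have h1 : homotopyAt h hP t ∘ₗ ι 𝒱 ∘ₗ h ∘ₗ proj 𝒱 = 0 := by
    rw [← LinearMap.comp_assoc, homotopyAt, conv_proj_comp_ι, LinearMap.comp_assoc,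
      ← LinearMap.comp_assoc (proj 𝒱), hhh]
    simp
  have h2 : (interpMap hP t).toLinearMap ∘ₗ twist (deg 𝒱) 1 ∘ₗ ι 𝒱 ∘ₗ h ∘ₗ proj 𝒱 =
      -(1 - t) • (ι 𝒱 ∘ₗ (h ∘ₗ proj 𝒱) ∘ₗ parity (deg 𝒱)) :=
    hom_ext_deg (𝒱 := deg 𝒱) fun i x hx => by
      have hx1 := hh i _ (isDeg_proj.zero_mem hx)
      have hx2 : P (h (proj 𝒱 x)) = 0 := LinearMap.congr_fun hPh _
      simp only [LinearMap.comp_apply, AlgHom.toLinearMap_apply, twist_apply (ι_mem_deg 𝒱 hx1),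
        map_smul, interpMap, map_ι, interp, LinearMap.add_apply, LinearMap.id_apply,
        LinearMap.smul_apply, LinearMap.sub_apply, hx2, parity_apply hx, one_mul, sgn_add, sgn_one,
        zero_sub, smul_neg, map_add, map_neg]
      module
  have h3 : homotopyAt h hP t ∘ₗ (interpMap hP s).toLinearMap =
      (1 - s) • conv (LinearMap.mul F (SymC 𝒱)) (ι 𝒱 ∘ₗ h ∘ₗ proj 𝒱)
        ((interpMap hP t).toLinearMap ∘ₗ (interpMap hP s).toLinearMap) := by
    have hc : comul 𝒱 ∘ₗ (interpMap hP s).toLinearMap =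
        TensorProduct.map (interpMap hP s).toLinearMap (interpMap hP s).toLinearMap ∘ₗ comul 𝒱 :=
      comul_map _
    rw [homotopyAt, conv_comp_hom hc, ← conv_smul_left]
    congr 1
    have hp : proj 𝒱 ∘ₗ (interpMap hP s).toLinearMap = interp P s ∘ₗ proj 𝒱 := proj_map _
    have hs : h ∘ₗ interp P s = (1 - s) • h := by
      rw [interp, LinearMap.comp_add, LinearMap.comp_smul, LinearMap.comp_sub, hhP,
        LinearMap.comp_id]
      module
    rw [LinearMap.comp_assoc, LinearMap.comp_assoc, hp, ← LinearMap.comp_assoc (proj 𝒱), hs,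
      LinearMap.smul_comp, LinearMap.comp_smul]
  rw [h1, conv_zero_left, zero_add, h2, h3, conv_smul_left, conv_smul_right,
    conv_conv_self_of_odd odd_one (by simpa using hh.comp isDeg_proj), smul_zero, smul_zero]

/-- The differential commutes with the interpolation, so the terms where d misses the marked letter
cancel; on the marked letter dh + hd = P - id remains. -/
theorem coder_homotopyAt (hd : IsDeg 𝒱 𝒱 (-1) d) (hh : IsDeg 𝒱 𝒱 1 h) (hdP : P ∘ₗ d = d ∘ₗ P)
    (hdh : d ∘ₗ h + h ∘ₗ d = P - LinearMap.id) (t : F) :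
    coder 𝒱 (d ∘ₗ proj 𝒱) ∘ₗ homotopyAt h hP t + homotopyAt h hP t ∘ₗ coder 𝒱 (d ∘ₗ proj 𝒱) =
      homotopyAt (P - LinearMap.id) hP t := by
  set D := coder 𝒱 (d ∘ₗ proj 𝒱) with hD
  set φ := (interpMap hP t).toLinearMap with hφ
  have hdp : IsDeg (deg 𝒱) 𝒱 (-1) (d ∘ₗ proj 𝒱) := by simpa using hd.comp isDeg_proj
  have hDι : D ∘ₗ ι 𝒱 = ι 𝒱 ∘ₗ d := conv_proj_comp_ι d (AlgHom.id F (SymC 𝒱))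
  have hDφ : D ∘ₗ φ = φ ∘ₗ D := by
    refine (coder_comp_map _ ?_).symm
    rw [interp, LinearMap.add_comp, LinearMap.comp_add, LinearMap.smul_comp, LinearMap.comp_smul,
      LinearMap.sub_comp, LinearMap.comp_sub, hdP, LinearMap.comp_id, LinearMap.id_comp]
  have hpD : proj 𝒱 ∘ₗ D = d ∘ₗ proj 𝒱 := proj_comp_coder _
  have h1 : D ∘ₗ homotopyAt h hP t = conv (LinearMap.mul F (SymC 𝒱)) (D ∘ₗ ι 𝒱 ∘ₗ h ∘ₗ proj 𝒱) φ +
      conv (LinearMap.mul F (SymC 𝒱)) (twist (deg 𝒱) (-1) ∘ₗ ι 𝒱 ∘ₗ h ∘ₗ proj 𝒱) (D ∘ₗ φ) :=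
    conv_proj_comp_conv hd (AlgHom.id F (SymC 𝒱)) (fun i v hv => ι_mem_deg 𝒱 hv) _ _
  have h2 : homotopyAt h hP t ∘ₗ D =
      conv (LinearMap.mul F (SymC 𝒱)) ((ι 𝒱 ∘ₗ h ∘ₗ proj 𝒱) ∘ₗ D) φ +
      conv (LinearMap.mul F (SymC 𝒱)) ((ι 𝒱 ∘ₗ h ∘ₗ proj 𝒱) ∘ₗ parity (deg 𝒱)) (φ ∘ₗ D) := by
    refine (conv_comp_coderivation (E := LinearMap.id) ?_ _ _ _).trans ?_
    · rw [comul_comp_coder hdp, LinearMap.comp_id]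
    · simp only [LinearMap.comp_id]
      rfl
  have h3 : twist (deg 𝒱) (-1) ∘ₗ ι 𝒱 ∘ₗ h ∘ₗ proj 𝒱 =
      -((ι 𝒱 ∘ₗ h ∘ₗ proj 𝒱) ∘ₗ parity (deg 𝒱)) :=
    hom_ext_deg (𝒱 := deg 𝒱) fun i x hx => by
      have hx1 := hh i _ (isDeg_proj.zero_mem hx)
      simp only [LinearMap.comp_apply, twist_apply (ι_mem_deg 𝒱 hx1), parity_apply hx, map_smul,
        LinearMap.neg_apply, ← neg_smul]
      congr 1
      exact sgn_eq_neg (by simp [Int.even_add])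
  rw [h1, h2, h3, hDφ, conv_neg_left, homotopyAt, ← hφ, ← hdh]
  rw [show ∀ a b c : SymC 𝒱 →ₗ[F] SymC 𝒱, a + -b + (c + b) = a + c from fun a b c => by abel,
    ← conv_add_left]
  congr 1
  rw [← LinearMap.comp_assoc, hDι, LinearMap.comp_assoc, LinearMap.comp_assoc,
    LinearMap.comp_assoc, hpD, LinearMap.add_comp, LinearMap.comp_add]
  rfl

theorem IsWord.homotopyAt_mem_filt {n : ℕ} {m : ℤ} {x : SymC 𝒱} (hx : IsWord 𝒱 n m x) (t : F) :
    homotopyAt h hP t x ∈ filt 𝒱 n := by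
  have : homotopyAt h hP t x ∈ LinearMap.range (ι 𝒱) ^ n := by
    refine hx.conv_mem fun n₁ n₂ m₁ m₂ y z hy hz hn _ => ?_
    rcases eq_or_ne n₁ 1 with rfl | hn₁
    · rw [← hn, pow_add, pow_one]
      exact Submodule.mul_mem_mul ⟨_, rfl⟩ (hz.map _).mem_pow
    · simp [hy.proj_eq_zero hn₁]
  exact (le_iSup₂_of_le n le_rfl le_rfl : LinearMap.range (ι 𝒱) ^ n ≤ filt 𝒱 n) this

theorem isDeg_homotopyAt (hh : IsDeg 𝒱 𝒱 1 h) (t : F) :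
    IsDeg (deg 𝒱) (deg 𝒱) 1 (homotopyAt h hP t) := by
  have := isDeg_conv (𝒞 := deg 𝒱) (μ := LinearMap.mul F (SymC 𝒱))
    (fun i j x hx y hy => SetLike.GradedMul.mul_mem hx hy)
    (isDeg_ι.comp (hh.comp isDeg_proj)) (isDeg_map (isDeg_interp hP t))
  rwa [show (0 : ℤ) + 1 + 0 + 0 = 1 by norm_num] at this

end Homotopy

end SymC

namespace SymC

variable {F V : Type*} [Field F] [AddCommGroup V] [Module F V] {𝒱 : ℤ → Submodule F V}

/-! ### Quadrature for the symmetrized homotopy -/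

/-- Integration over `[0, 1]` of polynomials with coefficients in an algebra. -/
def integral (F : Type*) [Field F] {A : Type*} [Ring A] [Algebra F A] : A[X] →ₗ[F] A :=
  polySum fun k => ((k : F) + 1)⁻¹ • LinearMap.id

/-- Evaluation at a scalar of polynomials with coefficients in an algebra. -/
def evalAt {A : Type*} [Ring A] [Algebra F A] (t : F) : A[X] →ₐ[F] A :=
  Polynomial.eval₂AlgHom (AlgHom.id F A) (algebraMap F A t) fun a =>
    (Algebra.commutes t a).symm

section

variable {A : Type*} [Ring A] [Algebra F A]

theorem integral_monomial (k : ℕ) (a : A) :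
    integral F (Polynomial.monomial k a) = ((k : F) + 1)⁻¹ • a :=
  (Polynomial.sum_monomial_index _ _ (by simp)).trans (by simp)

theorem evalAt_monomial (t : F) (k : ℕ) (a : A) :
    evalAt t (Polynomial.monomial k a) = t ^ k • a := by
  rw [Algebra.smul_def, Algebra.commutes, map_pow]
  exact Polynomial.eval₂_monomial _ _

/-- Replacing the integral by evaluations at scalars allows identities to be proved for each fixed t
and then summed. -/
theorem integral_eq_sum {N : ℕ} {w : ℕ → F}
    (hw : ∀ k ≤ N, ∑ j ∈ Finset.range (N + 1), w j * (j : F) ^ k = ((k : F) + 1)⁻¹) {p : A[X]}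
    (hp : p.natDegree ≤ N) :
    integral F p = ∑ j ∈ Finset.range (N + 1), w j • evalAt (j : F) p := by
  rw [Polynomial.as_sum_range' p (N + 1) (Nat.lt_succ_of_le hp)]
  simp only [map_sum, integral_monomial, evalAt_monomial, Finset.smul_sum]
  rw [Finset.sum_comm]
  refine Finset.sum_congr rfl fun k hk => ?_
  rw [← hw k (Nat.lt_succ_iff.1 (Finset.mem_range.1 hk)), Finset.sum_smul]
  simp [smul_smul]

theorem integral_derivative [CharZero F] (p : A[X]) :
    integral F (Polynomial.derivative p) = evalAt (1 : F) p - evalAt (0 : F) p := by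
  induction p using Polynomial.induction_on' with
  | add p q hp hq => simp only [map_add, hp, hq]; abel
  | monomial k a =>
    rw [Polynomial.derivative_monomial, integral_monomial, evalAt_monomial, evalAt_monomial]
    rcases k with _ | k
    · simp
    · have hk : (k : F) + 1 ≠ 0 := Nat.cast_add_one_ne_zero k
      have h1 : a * ((k + 1 : ℕ) : A) = ((k : F) + 1) • a := by
        rw [Algebra.smul_def, Algebra.commutes]
        simp
      rw [h1, Nat.add_sub_cancel, smul_smul, inv_mul_cancel₀ hk]
      simp

end

variable {h P : V →ₗ[F] V} (hP : IsDeg 𝒱 𝒱 0 P)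

/-- The interpolation between `id` and `S^cP`, with polynomial parameter. -/
def interpPoly : SymC 𝒱 →ₐ[F] (SymC 𝒱)[X] :=
  lift ((Polynomial.monomial 0).restrictScalars F ∘ₗ ι 𝒱 +
      (Polynomial.monomial 1).restrictScalars F ∘ₗ ι 𝒱 ∘ₗ (P - LinearMap.id))
    fun i j x y hx hy => by
      have hx' := Submodule.sub_mem _ (hP.zero_mem hx) hx
      have hy' := Submodule.sub_mem _ (hP.zero_mem hy) hy
      simp only [LinearMap.add_apply, LinearMap.comp_apply, LinearMap.restrictScalars_apply,
        LinearMap.sub_apply, LinearMap.id_apply, add_mul, mul_add,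
        Polynomial.monomial_mul_monomial, ι_mul_ι hx hy, ι_mul_ι hx hy', ι_mul_ι hx' hy,
        ι_mul_ι hx' hy', Units.smul_def, map_zsmul, zsmul_add]
      abel

theorem interpPoly_ι (v : V) : interpPoly hP (ι 𝒱 v) =
    Polynomial.C (ι 𝒱 v) + Polynomial.monomial 1 (ι 𝒱 (P v - v)) := lift_ι _ _ _

theorem evalAt_interpPoly (t : F) (x : SymC 𝒱) :
    evalAt t (interpPoly hP x) = interpMap hP t x := by
  have : (evalAt t).comp (interpPoly hP) = interpMap hP t := hom_ext fun v => by
    rw [AlgHom.comp_apply, interpPoly_ι, map_add, ← Polynomial.monomial_zero_left,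
      evalAt_monomial, evalAt_monomial, interpMap, map_ι]
    simp [interp]
  rw [← this]
  rfl

theorem IsWord.natDegree_interpPoly {n : ℕ} {m : ℤ} {x : SymC 𝒱} (hx : IsWord 𝒱 n m x) :
    (interpPoly hP x).natDegree ≤ n := by
  induction hx with
  | one => simp
  | @mul i m n v x hv _ ih =>
    rw [map_mul, add_comm n 1]
    refine Polynomial.natDegree_mul_le_of_le ?_ ih
    rw [interpPoly_ι]
    exact Polynomial.natDegree_add_le_of_degree_le (by simp) (Polynomial.natDegree_monomial_le _)

section

variable [DirectSum.Decomposition 𝒱]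

/-- Differentiating an algebra morphism in t gives a derivation along it. Here its value on a letter
v is Pv - v, and this determines it. -/
theorem evalAt_derivative_interpPoly (t : F) (x : SymC 𝒱) :
    evalAt t (Polynomial.derivative (interpPoly hP x)) =
      homotopyAt (P - LinearMap.id) hP t x := by
  have hP1 : IsDeg 𝒱 𝒱 0 (P - LinearMap.id) := fun i x hx =>
    Submodule.sub_mem _ (hP i x hx) (isDeg_id i x hx)
  let f : SymC 𝒱 →ₗ[F] SymC 𝒱 := (evalAt t).toLinearMap ∘ₗ
    (Polynomial.derivative (R := SymC 𝒱)).restrictScalars F ∘ₗ (interpPoly hP).toLinearMap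
  have : f = homotopyAt (P - LinearMap.id) hP t :=
    hom_ext_ι_mul (by simp [f, homotopyAt, conv_apply_one, proj_one]) fun i v hv x ih => by
      have ih' : evalAt t (Polynomial.derivative (interpPoly hP x)) =
        homotopyAt (P - LinearMap.id) hP t x := ih
      have hd : evalAt t (Polynomial.derivative (interpPoly hP (ι 𝒱 v))) =
          ι 𝒱 ((P - LinearMap.id : V →ₗ[F] V) v) := by
        rw [interpPoly_ι, map_add, Polynomial.derivative_C, zero_add,
          Polynomial.derivative_monomial, evalAt_monomial]
        simp
      change evalAt t (Polynomial.derivative (interpPoly hP (ι 𝒱 v * x))) = _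
      rw [map_mul, Polynomial.derivative_mul, map_add, map_mul, map_mul, ih', hd,
        evalAt_interpPoly, evalAt_interpPoly, homotopyAt,
        conv_proj_ι_mul hP1 _ (interpMap_ι_mem hP t) hv, zero_mul, sgn_zero, one_smul]
  exact LinearMap.congr_fun this x

variable {N : ℕ} {w : ℕ → F}

/-- On words of length at most N the integrand has degree at most N in t, so quadrature with weights
independent of the word is exact. -/
theorem symHomotopy_eq_sum
    (hw : ∀ k ≤ N, ∑ j ∈ Finset.range (N + 1), w j * (j : F) ^ k = ((k : F) + 1)⁻¹) :
    ∀ x ∈ filt 𝒱 N, symHomotopy h P hP x =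
      (∑ j ∈ Finset.range (N + 1), w j • homotopyAt h hP (j : F)) x := by
  intro x hx
  rw [← sub_eq_zero, ← LinearMap.sub_apply, ← Submodule.mem_bot F]
  refine mapsTo_filt (fun n m x hn hx => ?_) x hx
  rw [Submodule.mem_bot, LinearMap.sub_apply, sub_eq_zero]
  have h1 : ∑ j ∈ Finset.range (N + 1), w j • homotopyAt h hP (j : F) =
      (∑ j ∈ Finset.range (N + 1), w j • (TensorProduct.lift (LinearMap.mul F (SymC 𝒱)) ∘ₗ
        TensorProduct.map (ι 𝒱 ∘ₗ h ∘ₗ proj 𝒱) (interpMap hP (j : F)).toLinearMap)) ∘ₗ comul 𝒱 := by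
    ext y
    simp only [LinearMap.sum_apply, LinearMap.comp_apply, LinearMap.smul_apply]
    rfl
  rw [h1]
  -- `interpPoly` is by definition the morphism φ inside `symHomotopy`.
  change (integral F ∘ₗ LinearMap.mul' F (SymC 𝒱)[X] ∘ₗ
    TensorProduct.map ((Polynomial.monomial 0).restrictScalars F ∘ₗ ι 𝒱 ∘ₗ h ∘ₗ proj 𝒱)
      (interpPoly hP).toLinearMap) (comul 𝒱 x) = _
  refine hx.comul_congr fun n₁ n₂ m₁ m₂ y z hy hz hn' _ => ?_
  have hdeg : (Polynomial.monomial 0 (ι 𝒱 (h (proj 𝒱 y))) * interpPoly hP z).natDegree ≤ N :=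
    (Polynomial.natDegree_mul_le_of_le (Polynomial.natDegree_monomial_le _)
      (hz.natDegree_interpPoly hP)).trans (by omega)
  simp only [LinearMap.comp_apply, TensorProduct.map_tmul, LinearMap.mul'_apply,
    LinearMap.restrictScalars_apply, AlgHom.toLinearMap_apply, integral_eq_sum hw hdeg,
    LinearMap.sum_apply, LinearMap.smul_apply, TensorProduct.lift.tmul, LinearMap.mul_apply',
    map_mul, evalAt_monomial, evalAt_interpPoly, pow_zero, one_smul]

/-- The fundamental theorem of calculus for the interpolation: it is the identity at t = 0 and S^cP
at t = 1. -/
theorem sum_homotopyAt_sub_id [CharZero F]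
    (hw : ∀ k ≤ N, ∑ j ∈ Finset.range (N + 1), w j * (j : F) ^ k = ((k : F) + 1)⁻¹) :
    ∀ x ∈ filt 𝒱 N,
      (∑ j ∈ Finset.range (N + 1), w j • homotopyAt (P - LinearMap.id) hP (j : F)) x =
        map P hP x - x := by
  intro x hx
  have key : (∑ j ∈ Finset.range (N + 1), w j • homotopyAt (P - LinearMap.id) hP (j : F)) x -
      ((map P hP).toLinearMap - LinearMap.id : SymC 𝒱 →ₗ[F] SymC 𝒱) x = 0 := by
    rw [← LinearMap.sub_apply, ← Submodule.mem_bot F]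
    refine mapsTo_filt (fun n m x hn hx => ?_) x hx
    have hdeg : (Polynomial.derivative (interpPoly hP x)).natDegree ≤ N :=
      (Polynomial.natDegree_derivative_le _).trans
        ((Nat.sub_le _ _).trans ((hx.natDegree_interpPoly hP).trans hn))
    have h0 : interpMap hP 0 = AlgHom.id F (SymC 𝒱) := hom_ext fun v => by
      simp [interpMap, map_ι, interp]
    have h1 : interpMap hP 1 = map P hP := hom_ext fun v => by
      simp [interpMap, map_ι, interp]
    rw [Submodule.mem_bot, LinearMap.sub_apply, sub_eq_zero]
    simp only [LinearMap.sum_apply, LinearMap.smul_apply, ← evalAt_derivative_interpPoly]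
    rw [← integral_eq_sum hw hdeg, integral_derivative, evalAt_interpPoly, evalAt_interpPoly,
      h0, h1]
    rfl
  exact sub_eq_zero.1 key

theorem symHomotopy_mem_filt [CharZero F] (n : ℕ) :
    ∀ x ∈ filt 𝒱 n, symHomotopy h P hP x ∈ filt 𝒱 n := by
  intro x hx
  obtain ⟨w, hw⟩ := exists_quadrature F n
  rw [symHomotopy_eq_sum hP hw x hx]
  refine mapsTo_filt (fun k m x hk hx => ?_) x hx
  rw [LinearMap.sum_apply]
  exact Submodule.sum_mem _ fun j _ => Submodule.smul_mem _ _
    (filt_mono hk (hx.homotopyAt_mem_filt hP _))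

theorem isDeg_symHomotopy [CharZero F] (hh : IsDeg 𝒱 𝒱 1 h) :
    IsDeg (deg 𝒱) (deg 𝒱) 1 (symHomotopy h P hP) :=
  isDeg_of_word fun n m x hx => by
    obtain ⟨w, hw⟩ := exists_quadrature F n
    rw [symHomotopy_eq_sum hP hw x (hx.mem_filt le_rfl), LinearMap.sum_apply]
    exact Submodule.sum_mem _ fun j _ => Submodule.smul_mem _ _
      (isDeg_homotopyAt hP hh _ _ _ hx.mem_deg)

theorem symHomotopy_comp_self [CharZero F] (hh : IsDeg 𝒱 𝒱 1 h) (hhh : h ∘ₗ h = 0)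
    (hPh : P ∘ₗ h = 0) (hhP : h ∘ₗ P = 0) :
    symHomotopy h P hP ∘ₗ symHomotopy h P hP = 0 :=
  LinearMap.ext fun x => by
    obtain ⟨n, hx⟩ := exists_mem_filt x
    obtain ⟨w, hw⟩ := exists_quadrature F n
    rw [LinearMap.comp_apply, symHomotopy_eq_sum hP hw _ (symHomotopy_mem_filt hP n x hx),
      symHomotopy_eq_sum hP hw x hx]
    simp only [LinearMap.sum_apply, LinearMap.smul_apply, map_sum, map_smul, LinearMap.zero_apply]
    refine Finset.sum_eq_zero fun i _ => ?_
    rw [Finset.sum_eq_zero, smul_zero]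
    intro j _
    rw [← LinearMap.comp_apply, homotopyAt_comp_homotopyAt hP hh hhh hPh hhP,
      LinearMap.zero_apply, smul_zero]

theorem coder_symHomotopy [CharZero F] {d : V →ₗ[F] V} (hd : IsDeg 𝒱 𝒱 (-1) d)
    (hh : IsDeg 𝒱 𝒱 1 h) (hdP : P ∘ₗ d = d ∘ₗ P)
    (hdh : d ∘ₗ h + h ∘ₗ d = P - LinearMap.id)
    (hfilt : ∀ n, ∀ x ∈ filt 𝒱 n, coder 𝒱 (d ∘ₗ proj 𝒱) x ∈ filt 𝒱 n) :
    coder 𝒱 (d ∘ₗ proj 𝒱) ∘ₗ symHomotopy h P hP + symHomotopy h P hP ∘ₗ coder 𝒱 (d ∘ₗ proj 𝒱) =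
      (map P hP).toLinearMap - LinearMap.id :=
  LinearMap.ext fun x => by
    obtain ⟨n, hx⟩ := exists_mem_filt x
    obtain ⟨w, hw⟩ := exists_quadrature F n
    have := sum_homotopyAt_sub_id hP hw x hx
    rw [LinearMap.add_apply, LinearMap.comp_apply, LinearMap.comp_apply,
      symHomotopy_eq_sum hP hw _ (hfilt n x hx), symHomotopy_eq_sum hP hw x hx]
    refine Eq.trans ?_ this
    simp only [← coder_homotopyAt hP hd hh hdP hdh]
    simp only [LinearMap.sum_apply, LinearMap.smul_apply, map_sum, map_smul, LinearMap.add_apply,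
      LinearMap.comp_apply, smul_add, Finset.sum_add_distrib]

section

variable {W : Type*} [AddCommGroup W] [Module F W] {𝒲 : ℤ → Submodule F W}

theorem map_comp_symHomotopy [CharZero F] {f : V →ₗ[F] W} (hf : IsDeg 𝒱 𝒲 0 f)
    (hfh : f ∘ₗ h = 0) : (map f hf).toLinearMap ∘ₗ symHomotopy h P hP = 0 :=
  LinearMap.ext fun x => by
    obtain ⟨n, hx⟩ := exists_mem_filt x
    obtain ⟨w, hw⟩ := exists_quadrature F n
    rw [LinearMap.comp_apply, symHomotopy_eq_sum hP hw x hx, LinearMap.sum_apply, map_sum,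
      LinearMap.zero_apply]
    refine Finset.sum_eq_zero fun j _ => ?_
    have : (map f hf).toLinearMap ∘ₗ homotopyAt h hP (j : F) = 0 := by
      rw [homotopyAt, ← conv_zero_left (LinearMap.mul F (SymC 𝒲))
        ((map f hf).toLinearMap ∘ₗ (interpMap hP (j : F)).toLinearMap)]
      refine comp_conv fun x y => ?_
      have : f (h (proj 𝒱 x)) = 0 := LinearMap.congr_fun hfh _
      simp [map_ι, this]
    rw [LinearMap.smul_apply, map_smul, ← LinearMap.comp_apply, this, LinearMap.zero_apply,
      smul_zero]

theorem symHomotopy_comp_eq_zero [CharZero F] (E : W →ₗ[F] SymC 𝒱)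
    (hE : ∀ t : F, homotopyAt h hP t ∘ₗ E = 0) : symHomotopy h P hP ∘ₗ E = 0 :=
  LinearMap.ext fun x => by
    obtain ⟨n, hx⟩ := exists_mem_filt (E x)
    obtain ⟨w, hw⟩ := exists_quadrature F n
    rw [LinearMap.comp_apply, symHomotopy_eq_sum hP hw _ hx, LinearMap.sum_apply,
      LinearMap.zero_apply]
    refine Finset.sum_eq_zero fun j _ => ?_
    rw [LinearMap.smul_apply, ← LinearMap.comp_apply, hE, LinearMap.zero_apply, smul_zero]

/-- The hypothesis is an equality of integrands; integrating over t gives the conclusion. It serves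
for A = ∂E with E the adjoint of τ. -/
theorem symHomotopy_comp_eq [CharZero F] (A E : W →ₗ[F] SymC 𝒱)
    (hE : ∀ t : F, homotopyAt h hP t ∘ₗ A = -(homotopyAt (P - LinearMap.id) hP t ∘ₗ E)) :
    symHomotopy h P hP ∘ₗ A = E - (map P hP).toLinearMap ∘ₗ E :=
  LinearMap.ext fun x => by
    obtain ⟨n₁, h₁⟩ := exists_mem_filt (A x)
    obtain ⟨n₂, h₂⟩ := exists_mem_filt (E x)
    -- One set of weights must serve both A x and E x.
    obtain ⟨w, hw⟩ := exists_quadrature F (max n₁ n₂)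
    rw [LinearMap.comp_apply,
      symHomotopy_eq_sum hP hw _ (filt_mono (le_max_left n₁ n₂) h₁), LinearMap.sum_apply]
    have := sum_homotopyAt_sub_id hP hw _ (filt_mono (le_max_right n₁ n₂) h₂)
    rw [LinearMap.sub_apply, LinearMap.comp_apply, AlgHom.toLinearMap_apply,
      ← neg_sub (map P hP (E x)), ← this, LinearMap.sum_apply, ← Finset.sum_neg_distrib]
    refine Finset.sum_congr rfl fun j _ => ?_
    rw [LinearMap.smul_apply, LinearMap.smul_apply, ← smul_neg, ← LinearMap.comp_apply, hE]
    rfl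

end

end

end SymC

/-! ### The perturbation lemma -/

/-- Here q and e are the old and new composites of inclusion and projection, and q b s = 0 expresses
that the projection needs no correction. The elements 1 - sb and 1 - bs have the one-sided inverses
1 + hb and 1 + bh; multiplying by them reduces the claim to the unperturbed relation. -/
theorem perturbed_homotopy {R : Type*} [Ring R] {d b s h q e : R} (hd : d * d = 0)
    (hdb : (d + b) * (d + b) = 0) (hs : d * s + s * d = q - 1) (he : e = q + s * b * e)
    (hq : q * b * s = 0) (h1 : h = s + s * b * h) (h2 : h = s + h * b * s) :
    (d + b) * h + h * (d + b) = e - 1 := by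
  set A := 1 - s * b with hA
  set B := 1 - b * s with hB
  have hAh : A * h = s := by
    rw [hA, sub_mul, one_mul, sub_eq_iff_eq_add]; exact h1
  have hhB : h * B = s := by
    rw [hB, mul_sub, mul_one, ← mul_assoc, sub_eq_iff_eq_add]; exact h2
  have hAe : A * e = q := by
    rw [hA, sub_mul, one_mul, sub_eq_iff_eq_add]; exact he
  have hA' : (1 + h * b) * A = 1 := by
    have : (1 + h * b) * A = 1 + (h - (s + h * b * s)) * b := by rw [hA]; noncomm_ring
    rw [this, ← h2, sub_self, zero_mul, add_zero]
  have hB' : B * (1 + b * h) = 1 := by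
    have : B * (1 + b * h) = 1 + b * (h - (s + s * b * h)) := by rw [hB]; noncomm_ring
    rw [this, ← h1, sub_self, mul_zero, add_zero]
  set Y := (d + b) * h + h * (d + b) - e + 1 with hY
  -- The relations A h = s, h B = s and A e = q eliminate h and e.
  have hAYB : A * Y * B = 0 := by
    have e1 : A * Y * B =
        A * (d + b) * (h * B) + (A * h) * (d + b) * B - (A * e) * B + A * B := by
      rw [hY]; noncomm_ring
    have e2 : A * (d + b) * s + s * (d + b) * B - q * B + A * B =
        (d * s + s * d - (q - 1)) + q * b * s - s * ((d + b) * (d + b) - d * d) * s := by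
      rw [hA, hB]; noncomm_ring
    rw [e1, hAh, hhB, hAe, e2, hs, hq, hdb, hd]
    simp
  have hY0 : Y = 0 := by
    have : Y = (1 + h * b) * (A * Y * B) * (1 + b * h) := by
      rw [← mul_assoc, ← mul_assoc, hA', one_mul, mul_assoc, hB', mul_one]
    rw [this, hAYB, mul_zero, zero_mul]
  rw [← sub_eq_zero, ← hY0, hY]
  abel

theorem commute_homotopy {R : Type*} [Ring R] {δ h : R} (hδ : δ * δ = 0) :
    δ * (δ * h + h * δ + 1) = (δ * h + h * δ + 1) * δ := by
  simp only [mul_add, add_mul, ← mul_assoc, hδ, zero_mul, mul_one, one_mul, zero_add]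
  rw [mul_assoc h, hδ, mul_zero, add_zero]

section Series

variable {F N : Type*} [Field F] [AddCommGroup N] [Module F N] {FN : ℕ → Submodule F N}
  {s b : Module.End F N}

/-- Each factor b s lowers the filtration by one and annihilates its bottom step. -/
theorem pow_apply_mem_filtration (hs : ∀ n, ∀ x ∈ FN n, s x ∈ FN n)
    (hb : ∀ n, ∀ x ∈ FN (n + 1), b x ∈ FN n) (hb0 : ∀ x ∈ FN 0, b x = 0) {n k : ℕ} {x : N}
    (hx : x ∈ FN n) (hk : n < k) : ((b * s) ^ k) x = 0 := by
  induction n generalizing k x with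
  | zero =>
    obtain ⟨k, rfl⟩ := Nat.exists_eq_add_of_lt hk
    rw [pow_succ, Module.End.mul_apply, Module.End.mul_apply, hb0 _ (hs 0 x hx), map_zero]
  | succ n ih =>
    obtain ⟨k, rfl⟩ := Nat.exists_eq_add_of_lt hk
    rw [pow_succ, Module.End.mul_apply, Module.End.mul_apply]
    exact ih (hb n _ (hs _ x hx)) (by omega)

/-- The perturbation series of a homotopy. -/
theorem exists_perturbation_series (hmono : Monotone FN) (hex : ∀ x, ∃ n, x ∈ FN n)
    (hs : ∀ n, ∀ x ∈ FN n, s x ∈ FN n)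
    (hb : ∀ n, ∀ x ∈ FN (n + 1), b x ∈ FN n) (hb0 : ∀ x ∈ FN 0, b x = 0) :
    ∃ h : Module.End F N, ∀ n, ∀ x ∈ FN n, ∀ m > n,
      h x = ∑ k ∈ Finset.range m, (s * (b * s) ^ k) x := by
  choose ν hν using hex
  -- The sum does not depend on the truncation once it is long enough; hence the nonlinear choice of
  -- ν still defines a linear map.
  have key : ∀ n, ∀ x ∈ FN n, ∀ m > n, ∑ k ∈ Finset.range (ν x + 1), (s * (b * s) ^ k) x =
      ∑ k ∈ Finset.range m, (s * (b * s) ^ k) x := by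
    have aux : ∀ n, ∀ x ∈ FN n, ∀ m m', n < m → m ≤ m' →
        ∑ k ∈ Finset.range m, (s * (b * s) ^ k) x =
          ∑ k ∈ Finset.range m', (s * (b * s) ^ k) x := by
      intro n x hx m m' hm hm'
      refine Finset.sum_subset (Finset.range_subset_range.2 hm') fun k _ hk => ?_
      rw [Module.End.mul_apply, pow_apply_mem_filtration hs hb hb0 hx
        (hm.trans_le (by simpa using hk)), map_zero]
    intro n x hx m hm
    rcases le_total (ν x + 1) m with h | h
    · exact aux _ x (hν x) _ _ (Nat.lt_succ_self _) h
    · exact (aux _ x hx _ _ hm h).symm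
  refine ⟨⟨⟨fun x => ∑ k ∈ Finset.range (ν x + 1), (s * (b * s) ^ k) x, fun x y => ?_⟩,
    fun c x => ?_⟩, fun n x hx m hm => key n x hx m hm⟩
  · set n := max (ν x) (ν y)
    have hx : x ∈ FN n := hmono (le_max_left _ _) (hν x)
    have hy : y ∈ FN n := hmono (le_max_right _ _) (hν y)
    rw [key n _ (Submodule.add_mem _ hx hy) (n + 1) n.lt_succ_self, key n x hx (n + 1) n.lt_succ_self,
      key n y hy (n + 1) n.lt_succ_self, ← Finset.sum_add_distrib]
    exact Finset.sum_congr rfl fun k _ => map_add _ _ _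
  · change ∑ k ∈ Finset.range (ν (c • x) + 1), (s * (b * s) ^ k) (c • x) =
      c • ∑ k ∈ Finset.range (ν x + 1), (s * (b * s) ^ k) x
    rw [key _ _ (Submodule.smul_mem _ c (hν x)) _ (Nat.lt_succ_self _),
      Finset.smul_sum]
    exact Finset.sum_congr rfl fun k _ => map_smul _ _ _

variable {h : Module.End F N}

theorem perturbation_series_eq_left (hh : ∀ n, ∀ x ∈ FN n, ∀ m > n,
      h x = ∑ k ∈ Finset.range m, (s * (b * s) ^ k) x)
    (hex : ∀ x, ∃ n, x ∈ FN n) : h = s + s * b * h := by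
  refine LinearMap.ext fun x => ?_
  obtain ⟨n, hx⟩ := hex x
  -- Truncation at n + 2 leaves n + 1 terms after k = 0 is split off, as many as in the expansion of
  -- the other h.
  refine (hh n x hx (n + 2) (by omega)).trans ?_
  rw [LinearMap.add_apply, Module.End.mul_apply, hh n x hx (n + 1) (by omega), Finset.sum_range_succ', map_sum, add_comm]
  congr 1
  refine Finset.sum_congr rfl fun k _ => ?_
  rw [← Module.End.mul_apply, pow_succ']
  simp only [mul_assoc]

theorem perturbation_series_eq_right (hh : ∀ n, ∀ x ∈ FN n, ∀ m > n,
      h x = ∑ k ∈ Finset.range m, (s * (b * s) ^ k) x)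
    (hex : ∀ x, ∃ n, x ∈ FN n)
    (hbs : ∀ n, ∀ x ∈ FN n, b (s x) ∈ FN n) : h = s + h * b * s := by
  refine LinearMap.ext fun x => ?_
  obtain ⟨n, hx⟩ := hex x
  rw [LinearMap.add_apply, Module.End.mul_apply, Module.End.mul_apply,
    hh n x hx (n + 2) (by omega), hh n _ (hbs n x hx) (n + 1) (by omega),
    Finset.sum_range_succ', add_comm]
  congr 1

theorem perturbation_series_mem (hh : ∀ n, ∀ x ∈ FN n, ∀ m > n,
      h x = ∑ k ∈ Finset.range m, (s * (b * s) ^ k) x)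
    (hs : ∀ n, ∀ x ∈ FN n, s x ∈ FN n)
    (hbs : ∀ n, ∀ x ∈ FN n, b (s x) ∈ FN n) (n : ℕ) : ∀ x ∈ FN n, h x ∈ FN n := by
  intro x hx
  rw [hh n x hx (n + 1) n.lt_succ_self]
  refine Submodule.sum_mem _ fun k hk => hs n _ ?_
  clear hk
  induction k with
  | zero => exact hx
  | succ k ih => rw [pow_succ']; exact hbs n _ ih

theorem isDeg_perturbation_series (hh : ∀ n, ∀ x ∈ FN n, ∀ m > n,
      h x = ∑ k ∈ Finset.range m, (s * (b * s) ^ k) x)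
    (hex : ∀ x, ∃ n, x ∈ FN n) {𝒩 : ℤ → Submodule F N}
    (hs : IsDeg 𝒩 𝒩 1 s) (hb : IsDeg 𝒩 𝒩 (-1) b) : IsDeg 𝒩 𝒩 1 h := by
  intro i x hx
  obtain ⟨n, hn⟩ := hex x
  rw [hh n x hn (n + 1) n.lt_succ_self]
  refine Submodule.sum_mem _ fun k hk => hs i _ ?_
  clear hk
  induction k with
  | zero => exact hx
  | succ k ih =>
    rw [pow_succ']
    have := hb _ _ (hs _ _ ih)
    rwa [add_neg_cancel_right] at this

end Series

/-! ### The twisting cochain -/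

section Tau

open SymC

variable {F g H : Type*} [Field F] [AddCommGroup g] [Module F g] [AddCommGroup H] [Module F H]
  {𝒢 : ℤ → Submodule F g} {L : DGLA 𝒢}

theorem isDeg_tauComp [DirectSum.Decomposition 𝒢] {𝓗 : ℤ → Submodule F H}
    [DirectSum.Decomposition 𝓗] (C : Contraction 𝓗 𝒢 0 L.d) (k : ℕ) :
    IsDeg (deg (susp 𝓗)) 𝒢 (-1) (C.tauComp k) := by
  induction k using Nat.strong_induction_on with
  | _ k ih =>
    match k with
    | 0 => intro i x _; rw [Contraction.tauComp]; exact Submodule.zero_mem _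
    | 1 => rw [Contraction.tauComp]; exact C.incl_deg.comp (isDeg_univ (𝒢 := 𝓗))
    | b + 2 =>
      rw [Contraction.tauComp]
      have hs : IsDeg (deg (susp 𝓗)) 𝒢 (-2) (∑ i : Fin (b + 1),
          L.cup (C.tauComp (i + 1)) (C.tauComp (b + 1 - i))) :=
        IsDeg.sum fun i _ => isDeg_cup L (ih _ (by omega)) (ih _ (by omega))
      exact (C.h_deg.comp hs).smul _

variable [DirectSum.Decomposition 𝒢] {𝓗 : ℤ → Submodule F H} [DirectSum.Decomposition 𝓗]
  (C : Contraction 𝓗 𝒢 0 L.d)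

omit [DirectSum.Decomposition 𝒢] in
-- In [τⁱ, τᵏ⁻ⁱ] the two factors of Δ must have lengths i and k - i, so the support on length k
-- propagates along the recursion.
theorem tauComp_eq_zero_of_isWord {n k : ℕ} {m : ℤ} {x : SymC (susp 𝓗)}
    (hx : IsWord (susp 𝓗) n m x) (h : n ≠ k) : C.tauComp k x = 0 := by
  induction k using Nat.strong_induction_on generalizing n m x with
  | _ k ih =>
    match k with
    | 0 => rw [Contraction.tauComp]; rfl
    | 1 =>
      rw [Contraction.tauComp, LinearMap.comp_apply, univ, hx.proj_eq_zero h, map_zero]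
    | b + 2 =>
      have : ∀ i : Fin (b + 1), L.cup (C.tauComp (i + 1)) (C.tauComp (b + 1 - i)) x = 0 := by
        intro i
        refine (Submodule.mem_bot F).1 (hx.conv_mem fun n₁ n₂ m₁ m₂ y z hy hz hn _ => ?_)
        rw [Submodule.mem_bot, LinearMap.comp_apply, parity_apply hy.mem_deg, map_smul]
        have hi := i.2
        rcases eq_or_ne n₁ (i + 1) with h1 | h1
        · rw [ih (b + 1 - i) (by omega) hz (by omega), map_zero]
        · rw [ih (i + 1) (by omega) hy h1, smul_zero, map_zero, LinearMap.zero_apply]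
      rw [Contraction.tauComp, LinearMap.smul_apply, LinearMap.comp_apply, LinearMap.sum_apply,
        Finset.sum_eq_zero fun i _ => this i, map_zero, smul_zero]

omit [DirectSum.Decomposition 𝒢] in
theorem tau_eq_of_isWord {n : ℕ} {m : ℤ} {x : SymC (susp 𝓗)} (hx : IsWord (susp 𝓗) n m x) :
    C.tau x = C.tauComp n x := hx.total_eq _

theorem isDeg_tau : IsDeg (deg (susp 𝓗)) 𝒢 (-1) C.tau :=
  isDeg_of_word fun n m x hx => by
    rw [tau_eq_of_isWord C hx]
    exact isDeg_tauComp C n m x hx.mem_deg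

omit [DirectSum.Decomposition 𝒢] in
theorem tau_one : C.tau 1 = 0 := by
  rw [tau_eq_of_isWord C (IsWord.one (𝒱 := susp 𝓗)), Contraction.tauComp]
  rfl

omit [DirectSum.Decomposition 𝒢] in
-- A splitting into lengths n₁ + n₂ = n is seen only by i = n₁; the splittings with an empty factor
-- vanish since τ⁰ = 0.
theorem cup_tau_eq_of_isWord {n : ℕ} {m : ℤ} {x : SymC (susp 𝓗)} (hx : IsWord (susp 𝓗) n m x) :
    L.cup C.tau C.tau x = ∑ i ∈ Finset.Ico 1 n, L.cup (C.tauComp i) (C.tauComp (n - i)) x := by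
  let Φ (a b : SymC (susp 𝓗) →ₗ[F] g) : SymC (susp 𝓗) ⊗[F] SymC (susp 𝓗) →ₗ[F] g :=
    TensorProduct.lift L.bracket ∘ₗ TensorProduct.map (a ∘ₗ parity (deg (susp 𝓗))) b
  have h1 : ∑ i ∈ Finset.Ico 1 n, L.cup (C.tauComp i) (C.tauComp (n - i)) x =
      (∑ i ∈ Finset.Ico 1 n, Φ (C.tauComp i) (C.tauComp (n - i))) (comul _ x) := by
    rw [LinearMap.sum_apply]
    rfl
  rw [h1]
  change Φ C.tau C.tau (comul _ x) = _
  refine hx.comul_congr fun n₁ n₂ m₁ m₂ y z hy hz hn _ => ?_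
  simp only [Φ, LinearMap.sum_apply, LinearMap.comp_apply, TensorProduct.map_tmul,
    TensorProduct.lift.tmul, parity_apply hy.mem_deg, map_smul, LinearMap.smul_apply,
    tau_eq_of_isWord C hy, tau_eq_of_isWord C hz]
  rw [← Finset.smul_sum]
  congr 1
  by_cases hn₁ : n₁ ∈ Finset.Ico 1 n
  · rw [Finset.sum_eq_single n₁, ← hn, Nat.add_sub_cancel_left]
    · intro i _ hi
      rw [tauComp_eq_zero_of_isWord C hy hi.symm, map_zero, LinearMap.zero_apply]
    · exact fun h => absurd hn₁ h
  · rw [Finset.sum_eq_zero]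
    · rw [Finset.mem_Ico] at hn₁
      rcases Nat.eq_zero_or_pos n₁ with rfl | h
      · rw [Contraction.tauComp]; simp
      · obtain rfl : n₂ = 0 := by omega
        rw [Contraction.tauComp]; simp
    · intro i hi
      rw [tauComp_eq_zero_of_isWord C hy (by rintro rfl; exact hn₁ hi), map_zero,
        LinearMap.zero_apply]

/-- The obstruction `½[τ, τ]`. -/
def halfCup : SymC (susp 𝓗) →ₗ[F] g := (2 : F)⁻¹ • L.cup C.tau C.tau

theorem isDeg_halfCup : IsDeg (deg (susp 𝓗)) 𝒢 (-2) (halfCup C) :=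
  (isDeg_cup L (isDeg_tau C) (isDeg_tau C)).smul _

omit [DirectSum.Decomposition 𝒢] in
-- The recursion summed over all lengths. The later arguments use this closed equation in place of
-- the components.
theorem tau_eq : C.tau = C.incl ∘ₗ univ 𝓗 + C.h ∘ₗ halfCup C :=
  hom_ext_word fun n m x hx => by
    rw [tau_eq_of_isWord C hx, LinearMap.add_apply, LinearMap.comp_apply, LinearMap.comp_apply,
      halfCup, LinearMap.smul_apply, cup_tau_eq_of_isWord C hx]
    match n with
    | 0 => rw [Contraction.tauComp]; simp [univ, hx.proj_eq_zero]
    | 1 => rw [Contraction.tauComp]; simp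
    | b + 2 =>
      rw [Contraction.tauComp, univ, hx.proj_eq_zero (by omega), map_zero, zero_add,
        LinearMap.smul_apply, LinearMap.comp_apply, LinearMap.sum_apply, map_smul,
        Finset.sum_Ico_eq_sum_range, Fin.sum_univ_eq_sum_range
          (fun i => L.cup (C.tauComp (i + 1)) (C.tauComp (b + 1 - i)) x) (b + 1)]
      congr 2
      refine Finset.sum_congr rfl fun i _ => ?_
      rw [add_comm 1 i, show b + 2 - (i + 1) = b + 1 - i by omega]

omit [DirectSum.Decomposition 𝒢] in
theorem D_eq : C.D = coder (susp 𝓗) (C.π ∘ₗ halfCup C) := by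
  rw [Contraction.D]
  congr 1
  refine hom_ext_word fun n m x hx => ?_
  rw [hx.total_eq, LinearMap.smul_apply, LinearMap.comp_apply, LinearMap.comp_apply,
    halfCup, LinearMap.smul_apply, cup_tau_eq_of_isWord C hx, LinearMap.sum_apply, map_smul]

omit [DirectSum.Decomposition 𝒢] in
theorem π_comp_tau : C.π ∘ₗ C.tau = univ 𝓗 := by
  rw [tau_eq, LinearMap.comp_add, ← LinearMap.comp_assoc, ← LinearMap.comp_assoc, C.π_incl, C.π_h]
  simp

omit [DirectSum.Decomposition 𝒢] in
theorem h_comp_tau : C.h ∘ₗ C.tau = 0 := by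
  rw [tau_eq, LinearMap.comp_add, ← LinearMap.comp_assoc, ← LinearMap.comp_assoc, C.h_incl, C.h_h]
  simp

end Tau

/-! ### Assembly of the perturbed contraction -/

section Main

open SymC

variable {F g H : Type*} [Field F] [CharZero F] [AddCommGroup g] [Module F g] [AddCommGroup H]
  [Module F H] {𝒢 : ℤ → Submodule F g} [DirectSum.Decomposition 𝒢]

/-! ### The differential and the filtration -/

section Filtration

variable (L : DGLA 𝒢)

omit [CharZero F] in
theorem dS_mem_filt (n : ℕ) : ∀ x ∈ filt (susp 𝒢) n, L.dS x ∈ filt (susp 𝒢) n :=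
  mapsTo_filt fun k m x hk hx => by
    refine filt_mono hk ?_
    refine (le_iSup₂_of_le k le_rfl le_rfl :
      LinearMap.range (ι (susp 𝒢)) ^ k ≤ filt (susp 𝒢) k) ?_
    refine hx.conv_mem fun n₁ n₂ m₁ m₂ y z hy hz hn _ => ?_
    rcases eq_or_ne n₁ 1 with rfl | hn₁
    · rw [← hn, pow_add, pow_one]
      exact Submodule.mul_mem_mul ⟨_, rfl⟩ hz.mem_pow
    · simp [univ, hy.proj_eq_zero hn₁]

omit [CharZero F] in
theorem cup_univ_eq_zero {n : ℕ} {m : ℤ} {x : SymC (susp 𝒢)} (hx : IsWord (susp 𝒢) n m x)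
    (hn : n ≠ 2) : L.cup (univ 𝒢) (univ 𝒢) x = 0 := by
  refine (Submodule.mem_bot F).1 (hx.conv_mem fun n₁ n₂ m₁ m₂ y z hy hz hn' _ => ?_)
  rw [Submodule.mem_bot, LinearMap.comp_apply, parity_apply hy.mem_deg, map_smul]
  rcases eq_or_ne n₁ 1 with h1 | h1
  · rw [univ, hz.proj_eq_zero (by omega), map_zero]
  · rw [univ, hy.proj_eq_zero h1, smul_zero, map_zero, LinearMap.zero_apply]

omit [CharZero F] in
-- The bracket merges two letters into one; this makes the perturbation series locally finite.
theorem partial_mem_filt (n : ℕ) :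
    ∀ x ∈ filt (susp 𝒢) (n + 1), L.partial x ∈ filt (susp 𝒢) n :=
  mapsTo_filt fun k m x hk hx => by
    refine hx.conv_mem fun n₁ n₂ m₁ m₂ y z hy hz hn _ => ?_
    rcases eq_or_ne n₁ 2 with h1 | h1
    · refine filt_mono (show 1 + n₂ ≤ n by omega) ?_
      refine (le_iSup₂_of_le (1 + n₂) le_rfl le_rfl :
        LinearMap.range (ι (susp 𝒢)) ^ (1 + n₂) ≤ filt (susp 𝒢) (1 + n₂)) ?_
      rw [pow_add, pow_one]
      exact Submodule.mul_mem_mul ⟨_, rfl⟩ hz.mem_pow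
    · rw [LinearMap.comp_apply, LinearMap.smul_apply, cup_univ_eq_zero L hy h1]
      simp

omit [CharZero F] in
theorem partial_eq_zero : ∀ x ∈ filt (susp 𝒢) 0, L.partial x = 0 := fun x hx => by
  refine (Submodule.mem_bot F).1 (mapsTo_filt (fun k m x hk hx => ?_) x hx)
  refine hx.conv_mem fun n₁ n₂ m₁ m₂ y z hy hz hn _ => ?_
  rw [LinearMap.comp_apply, LinearMap.smul_apply, cup_univ_eq_zero L hy (by omega)]
  simp

omit [CharZero F] in
theorem isDeg_half_cup_univ :
    IsDeg (deg (susp 𝒢)) (susp 𝒢) (-1) ((2 : F)⁻¹ • L.cup (univ 𝒢) (univ 𝒢)) :=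
  isDeg_susp ((isDeg_cup L isDeg_univ isDeg_univ).smul _) (by norm_num)

omit [CharZero F] in
theorem isDeg_partial : IsDeg (deg (susp 𝒢)) (deg (susp 𝒢)) (-1) L.partial :=
  isDeg_coder (isDeg_half_cup_univ L)

end Filtration

variable {L : DGLA 𝒢} {𝓗 : ℤ → Submodule F H} [DirectSum.Decomposition 𝓗]
  (C : Contraction 𝓗 𝒢 0 L.d)

/-! ### The linear contraction of the symmetric coalgebras -/

/-- `S^c∇ : S^c[sH] → S^c[sg]`. -/
def Sincl : SymC (susp 𝓗) →ₗ[F] SymC (susp 𝒢) := (map C.incl C.incl_deg.susp).toLinearMap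

omit [CharZero F] [DirectSum.Decomposition 𝒢] [DirectSum.Decomposition 𝓗] in
theorem Sincl_comp_Sπ : Sincl C ∘ₗ C.Sπ =
    (map (C.incl ∘ₗ C.π) (C.incl_deg.comp_zero C.π_deg).susp).toLinearMap := by
  have : (map C.incl C.incl_deg.susp).comp (map C.π C.π_deg.susp) =
      map (C.incl ∘ₗ C.π) (C.incl_deg.comp_zero C.π_deg).susp :=
    hom_ext fun v => by simp [map_ι]
  exact congrArg AlgHom.toLinearMap this

omit [CharZero F] [DirectSum.Decomposition 𝒢] [DirectSum.Decomposition 𝓗] in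
theorem π_comp_d : C.π ∘ₗ L.d = 0 := by rw [C.π_chain, LinearMap.zero_comp]

omit [CharZero F] [DirectSum.Decomposition 𝒢] [DirectSum.Decomposition 𝓗] in
theorem d_comp_incl : L.d ∘ₗ C.incl = 0 := by rw [← C.incl_chain, LinearMap.comp_zero]

omit [CharZero F] in
theorem Sπ_comp_dS : C.Sπ ∘ₗ L.dS = 0 := by
  have := coder_comp_map C.π_deg.susp (d := L.d) (d' := 0) (by rw [π_comp_d, LinearMap.zero_comp])
  refine this.trans ?_
  rw [LinearMap.zero_comp, coder_zero, LinearMap.zero_comp]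

omit [DirectSum.Decomposition 𝓗] in
theorem dS_comp_Sh : L.dS ∘ₗ C.Sh + C.Sh ∘ₗ L.dS = Sincl C ∘ₗ C.Sπ - LinearMap.id := by
  rw [Sincl_comp_Sπ]
  refine coder_symHomotopy _ L.isDifferential.deg.susp C.h_deg.susp ?_ C.homotopy (dS_mem_filt L)
  rw [LinearMap.comp_assoc, π_comp_d, ← LinearMap.comp_assoc, d_comp_incl, LinearMap.comp_zero,
    LinearMap.zero_comp]

omit [DirectSum.Decomposition 𝓗] in
theorem Sh_comp_Sh : C.Sh ∘ₗ C.Sh = 0 :=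
  symHomotopy_comp_self _ C.h_deg.susp C.h_h (by rw [LinearMap.comp_assoc, C.π_h, LinearMap.comp_zero])
    (by rw [← LinearMap.comp_assoc, C.h_incl, LinearMap.zero_comp])

omit [DirectSum.Decomposition 𝓗] in
theorem Sπ_comp_Sh : C.Sπ ∘ₗ C.Sh = 0 := map_comp_symHomotopy _ C.π_deg.susp C.π_h

omit [DirectSum.Decomposition 𝓗] in
theorem Sh_mem_filt (n : ℕ) : ∀ x ∈ filt (susp 𝒢) n, C.Sh x ∈ filt (susp 𝒢) n :=
  symHomotopy_mem_filt _ n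

omit [DirectSum.Decomposition 𝓗] in
theorem isDeg_Sh : IsDeg (deg (susp 𝒢)) (deg (susp 𝒢)) 1 C.Sh :=
  isDeg_symHomotopy _ C.h_deg.susp

theorem Sh_comp_Sincl : C.Sh ∘ₗ Sincl C = 0 :=
  symHomotopy_comp_eq_zero _ _ fun t => by
    have h1 : proj (susp 𝒢) ∘ₗ Sincl C = C.incl ∘ₗ proj (susp 𝓗) := proj_map C.incl_deg.susp
    rw [homotopyAt, Sincl, conv_comp_hom (comul_map C.incl_deg.susp), LinearMap.comp_assoc,
      LinearMap.comp_assoc, ← Sincl, h1, ← LinearMap.comp_assoc _ C.incl, C.h_incl,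
      LinearMap.zero_comp, LinearMap.comp_zero, conv_zero_left]

/-! ### The adjoint of the twisting cochain -/

/-- `(S^c∇)_∂`, the adjoint of the twisting cochain `τ`. -/
def tauAdjoint : SymC (susp 𝓗) →ₗ[F] SymC (susp 𝒢) := coalgExp (𝒲 := susp 𝒢) C.tau

theorem isCoalgHom_tauAdjoint : IsCoalgHom (susp 𝓗) (susp 𝒢) (tauAdjoint C) :=
  isCoalgHom_coalgExp (isDeg_susp (isDeg_tau C) (by norm_num)) (tau_one C)

omit [CharZero F] in
theorem univ_comp_tauAdjoint : univ 𝒢 ∘ₗ tauAdjoint C = C.tau := proj_coalgExp (tau_one C)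

theorem parity_comp_tauAdjoint : parity (deg (susp 𝒢)) ∘ₗ tauAdjoint C =
    tauAdjoint C ∘ₗ parity (deg (susp 𝓗)) := by
  rw [parity_comp (isCoalgHom_tauAdjoint C).deg, sgn_zero]
  exact one_smul F (tauAdjoint C ∘ₗ parity (deg (susp 𝓗)))

theorem cup_univ_comp_tauAdjoint :
    ((2 : F)⁻¹ • L.cup (univ 𝒢) (univ 𝒢)) ∘ₗ tauAdjoint C = halfCup C := by
  rw [LinearMap.smul_comp, halfCup, L.cup_eq_conv, L.cup_eq_conv,
    conv_comp_hom (isCoalgHom_tauAdjoint C).comul_comp, LinearMap.comp_assoc,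
    parity_comp_tauAdjoint, ← LinearMap.comp_assoc, univ_comp_tauAdjoint]

theorem partial_comp_tauAdjoint : L.partial ∘ₗ tauAdjoint C =
    conv (LinearMap.mul F (SymC (susp 𝒢))) (ι (susp 𝒢) ∘ₗ halfCup C) (tauAdjoint C) := by
  rw [DGLA.partial, coder_comp_hom (isCoalgHom_tauAdjoint C).comul_comp, cup_univ_comp_tauAdjoint]

/-- Both sides are coalgebra morphisms, and their projections to the letters agree because πτ = τ_H.
-/
theorem Sπ_comp_tauAdjoint : C.Sπ ∘ₗ tauAdjoint C = LinearMap.id := by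
  refine coalgHom_ext ?_ ?_ ?_ ?_ ?_
  · rw [← LinearMap.comp_assoc, Contraction.Sπ, comul_map, LinearMap.comp_assoc,
      (isCoalgHom_tauAdjoint C).comul_comp, ← LinearMap.comp_assoc, ← TensorProduct.map_comp]
  · rw [TensorProduct.map_id, LinearMap.comp_id, LinearMap.id_comp]
  · rw [← LinearMap.comp_assoc, Contraction.Sπ, counit_map,
      (isCoalgHom_tauAdjoint C).counit_comp, LinearMap.comp_id]
  · rw [LinearMap.comp_apply, (isCoalgHom_tauAdjoint C).map_one]
    exact map_one (map C.π C.π_deg.susp)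
  · rw [← LinearMap.comp_assoc, Contraction.Sπ, proj_map, LinearMap.comp_assoc]
    exact (congrArg (C.π ∘ₗ ·) (univ_comp_tauAdjoint C)).trans (π_comp_tau C)

theorem map_comp_tauAdjoint :
    (map (C.incl ∘ₗ C.π) (C.incl_deg.comp_zero C.π_deg).susp).toLinearMap ∘ₗ tauAdjoint C =
      Sincl C := by
  rw [← Sincl_comp_Sπ, LinearMap.comp_assoc, Sπ_comp_tauAdjoint, LinearMap.comp_id]

/-- ∂E is the convolution of ½[τ,τ] with E. Applying the multiplicative S^cπ, and S^cπ E = id, turns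
it into the coderivation with projection π(½[τ,τ]). -/
theorem D_eq_Sπ_partial_tauAdjoint : C.D = C.Sπ ∘ₗ L.partial ∘ₗ tauAdjoint C := by
  rw [partial_comp_tauAdjoint, D_eq, coder_eq_conv, ← Sπ_comp_tauAdjoint C]
  exact (comp_conv fun x y => by simp [Contraction.Sπ, map_ι]).symm

/-- At each t, hτ = 0 leaves in H_t ∂ E only the convolution of h(½[τ,τ]) with the interpolation of
E. Since (P - id)τ = -h(½[τ,τ]), this is minus the t-derivative of the interpolation of E, and
integration finishes. -/
theorem Sh_partial_tauAdjoint : C.Sh ∘ₗ L.partial ∘ₗ tauAdjoint C = tauAdjoint C - Sincl C := by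
  rw [← map_comp_tauAdjoint]
  refine symHomotopy_comp_eq _ _ _ fun t => ?_
  have hE := (isCoalgHom_tauAdjoint C).comul_comp
  have hD : comul (susp 𝒢) ∘ₗ L.partial ∘ₗ tauAdjoint C =
      (TensorProduct.map (L.partial ∘ₗ tauAdjoint C) (tauAdjoint C) +
        TensorProduct.map (parity (deg (susp 𝒢)) ∘ₗ tauAdjoint C) (L.partial ∘ₗ tauAdjoint C)) ∘ₗ
        comul (susp 𝓗) := by
    rw [← LinearMap.comp_assoc, DGLA.partial, comul_comp_coder (isDeg_half_cup_univ L),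
      LinearMap.comp_assoc, hE, ← LinearMap.comp_assoc, LinearMap.add_comp,
      ← TensorProduct.map_comp, ← TensorProduct.map_comp, LinearMap.id_comp]
  have h1 : proj (susp 𝒢) ∘ₗ L.partial ∘ₗ tauAdjoint C = halfCup C := by
    rw [← LinearMap.comp_assoc, DGLA.partial, proj_comp_coder, cup_univ_comp_tauAdjoint]
  have h2 : C.h ∘ₗ proj (susp 𝒢) ∘ₗ parity (deg (susp 𝒢)) ∘ₗ tauAdjoint C = 0 := by
    rw [parity_comp_tauAdjoint, ← LinearMap.comp_assoc (parity _) (tauAdjoint C),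
      ← LinearMap.comp_assoc]
    have : C.h ∘ₗ proj (susp 𝒢) ∘ₗ tauAdjoint C = 0 :=
      (congrArg (C.h ∘ₗ ·) (univ_comp_tauAdjoint C)).trans (h_comp_tau C)
    rw [this, LinearMap.zero_comp]
  have h3 : (C.incl ∘ₗ C.π - LinearMap.id) ∘ₗ proj (susp 𝒢) ∘ₗ tauAdjoint C =
      -(C.h ∘ₗ halfCup C) := by
    refine (congrArg ((C.incl ∘ₗ C.π - LinearMap.id) ∘ₗ ·) (univ_comp_tauAdjoint C)).trans ?_
    rw [LinearMap.sub_comp, LinearMap.comp_assoc, π_comp_tau, tau_eq, LinearMap.id_comp]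
    abel
  rw [homotopyAt, homotopyAt, conv_comp_coderivation hD, conv_comp_hom hE]
  simp only [LinearMap.comp_assoc]
  rw [h1, h2, h3, LinearMap.comp_zero, conv_zero_left, add_zero, LinearMap.comp_neg,
    conv_neg_left, neg_neg]

/-! ### The perturbed contraction -/

omit [CharZero F] in
omit [DirectSum.Decomposition 𝒢] in
theorem tauAdjoint_mem_filt (n : ℕ) :
    ∀ x ∈ filt (susp 𝓗) n, tauAdjoint C x ∈ filt (susp 𝒢) n :=
  coalgExp_mem_filt (tau_one C) n

omit [CharZero F] in
theorem partial_mem_filt_self (L : DGLA 𝒢) (n : ℕ) (x : SymC (susp 𝒢))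
    (hx : x ∈ filt (susp 𝒢) n) : L.partial x ∈ filt (susp 𝒢) n :=
  partial_mem_filt L n x (filt_mono n.le_succ hx)

theorem D_eq_and_hasPerturbedContraction {D' : SymC (susp 𝓗) →ₗ[F] SymC (susp 𝓗)}
    (hD' : C.Sπ ∘ₗ L.partial = D' ∘ₗ C.Sπ) : C.D = D' ∧ C.HasPerturbedContraction C.Sπ := by
  have hDD' : C.D = D' := by
    rw [D_eq_Sπ_partial_tauAdjoint, ← LinearMap.comp_assoc, hD', LinearMap.comp_assoc,
      Sπ_comp_tauAdjoint, LinearMap.comp_id]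
  refine ⟨hDD', ?_⟩
  subst hDD'
  obtain ⟨h', hh'⟩ := exists_perturbation_series (FN := filt (susp 𝒢)) (s := C.Sh)
    (b := L.partial) (fun m n h => filt_mono h) exists_mem_filt (Sh_mem_filt C)
    (partial_mem_filt L) (partial_eq_zero L)
  have hbs : ∀ n, ∀ x ∈ filt (susp 𝒢) n, L.partial (C.Sh x) ∈ filt (susp 𝒢) n :=
    fun n x hx => partial_mem_filt_self L n _ (Sh_mem_filt C n x hx)
  have hl := perturbation_series_eq_left hh' exists_mem_filt
  have hr := perturbation_series_eq_right hh' exists_mem_filt hbs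
  have hδ := L.isDifferential_dS_add_partial
  -- In E = S^c∇ + S^ch ∂ E both summands are killed by S^ch.
  have hsE : C.Sh ∘ₗ tauAdjoint C = 0 := by
    have : tauAdjoint C = Sincl C + C.Sh ∘ₗ L.partial ∘ₗ tauAdjoint C := by
      rw [Sh_partial_tauAdjoint]; abel
    rw [this, LinearMap.comp_add, Sh_comp_Sincl, ← LinearMap.comp_assoc, Sh_comp_Sh,
      LinearMap.zero_comp, zero_add]
  have hπδ : C.Sπ ∘ₗ (L.dS + L.partial) = C.D ∘ₗ C.Sπ := by
    rw [LinearMap.comp_add, Sπ_comp_dS, zero_add, hD']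
  have hsurj : ∀ (f f' : SymC (susp 𝓗) →ₗ[F] SymC (susp 𝓗)), f ∘ₗ C.Sπ = f' ∘ₗ C.Sπ → f = f' :=
    fun f f' h => by
      rw [← LinearMap.comp_id f, ← LinearMap.comp_id f', ← Sπ_comp_tauAdjoint C,
        ← LinearMap.comp_assoc, h, LinearMap.comp_assoc]
  have hhom : (L.dS + L.partial) * h' + h' * (L.dS + L.partial) = tauAdjoint C ∘ₗ C.Sπ - 1 := by
    refine perturbed_homotopy (q := Sincl C ∘ₗ C.Sπ) L.dS_comp_dS hδ.sq (dS_comp_Sh C) ?_ ?_ hl hr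
    · change tauAdjoint C ∘ₗ C.Sπ =
        Sincl C ∘ₗ C.Sπ + (C.Sh ∘ₗ L.partial ∘ₗ tauAdjoint C) ∘ₗ C.Sπ
      rw [Sh_partial_tauAdjoint, LinearMap.sub_comp]
      abel
    · change Sincl C ∘ₗ (C.Sπ ∘ₗ L.partial) ∘ₗ C.Sh = 0
      rw [hD', LinearMap.comp_assoc, Sπ_comp_Sh, LinearMap.comp_zero, LinearMap.comp_zero]
  -- E S^cπ is homotopic to the identity, so it commutes with d + ∂; composing with E on the right
  -- removes S^cπ.
  have hchain : tauAdjoint C ∘ₗ C.D = (L.dS + L.partial) ∘ₗ tauAdjoint C := by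
    have h1 : (L.dS + L.partial) ∘ₗ (tauAdjoint C ∘ₗ C.Sπ) =
        (tauAdjoint C ∘ₗ C.Sπ) ∘ₗ (L.dS + L.partial) := by
      have hsq : (L.dS + L.partial) * (L.dS + L.partial) = 0 := hδ.sq
      have e : tauAdjoint C ∘ₗ C.Sπ =
          (L.dS + L.partial) * h' + h' * (L.dS + L.partial) + 1 := by rw [hhom]; abel
      rw [e]
      exact commute_homotopy hsq
    rw [LinearMap.comp_assoc, hπδ] at h1
    have h2 := congrArg (· ∘ₗ tauAdjoint C) h1
    simp only [LinearMap.comp_assoc, Sπ_comp_tauAdjoint, LinearMap.comp_id] at h2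
    exact h2.symm
  have hDdiff : IsDifferential (deg (susp 𝓗)) C.D := by
    constructor
    · rw [D_eq]
      exact isDeg_coder (isDeg_susp (C.π_deg.comp (isDeg_halfCup C)) (by norm_num))
    -- S^cπ intertwines d + ∂ with D, so D² S^cπ = S^cπ (d + ∂)² = 0.
    · refine hsurj _ _ ?_
      rw [LinearMap.comp_assoc, ← hπδ, ← LinearMap.comp_assoc, ← hπδ, LinearMap.comp_assoc,
        hδ.sq, LinearMap.comp_zero, LinearMap.zero_comp]
  have hsπ : C.Sπ ∘ₗ h' = 0 := by
    rw [hl]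
    change C.Sπ ∘ₗ (C.Sh + C.Sh ∘ₗ L.partial ∘ₗ h') = 0
    rw [LinearMap.comp_add, ← LinearMap.comp_assoc, Sπ_comp_Sh, LinearMap.zero_comp, zero_add]
  have hhE : h' ∘ₗ tauAdjoint C = 0 := by
    rw [hr]
    change (C.Sh + h' ∘ₗ L.partial ∘ₗ C.Sh) ∘ₗ tauAdjoint C = 0
    simp only [LinearMap.add_comp, LinearMap.comp_assoc, hsE, LinearMap.comp_zero, zero_add]
  have hhh : h' * h' = 0 := by
    have hss : C.Sh * C.Sh = 0 := Sh_comp_Sh C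
    have hsh : C.Sh * h' = 0 := by
      rw [hl, mul_add, mul_assoc, ← mul_assoc, hss, zero_mul, zero_add]
    refine (congrArg (· * h') hr).trans ?_
    change (C.Sh + h' * L.partial * C.Sh) * h' = 0
    rw [add_mul, mul_assoc, hsh, mul_zero, zero_add]
  refine ⟨⟨C.Sπ, tauAdjoint C, h', hDdiff, hδ, isDeg_map _, (isCoalgHom_tauAdjoint C).deg,
    isDeg_perturbation_series hh' exists_mem_filt (isDeg_Sh C) (isDeg_partial L), hπδ, hchain,
    Sπ_comp_tauAdjoint C, hhom, hsπ, hhE, hhh⟩,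
    ⟨?_, ?_, ?_, ?_, ?_⟩, rfl, isCoalgHom_tauAdjoint C, univ_comp_tauAdjoint C, ?_⟩
  · intro n x hx
    rw [D_eq_Sπ_partial_tauAdjoint]
    exact map_mem_filt _ n _ (partial_mem_filt_self L n _ (tauAdjoint_mem_filt C n x hx))
  · exact fun n x hx => Submodule.add_mem _ (dS_mem_filt L n x hx) (partial_mem_filt_self L n x hx)
  · exact fun n x hx => map_mem_filt _ n x hx
  · exact fun n x hx => tauAdjoint_mem_filt C n x hx
  · exact perturbation_series_mem hh' (Sh_mem_filt C) hbs
  · intro x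
    obtain ⟨n, hn⟩ := exists_mem_filt x
    exact ⟨n + 1, fun m hm => hh' n x hn m hm⟩

omit [CharZero F] [DirectSum.Decomposition 𝓗] in
theorem Sπ_comp_partial_eq_zero (h : ∀ x y : g, C.π (L.bracket x y) = 0) :
    C.Sπ ∘ₗ L.partial = 0 := by
  have h1 : C.π ∘ₗ L.cup (univ 𝒢) (univ 𝒢) = 0 := by
    rw [L.cup_eq_conv, comp_conv (μ' := (0 : g →ₗ[F] g →ₗ[F] H)) (f' := 0) (g' := univ 𝒢)
      fun x y => h _ _, conv_zero_left]
  have h2 : ∀ x, C.π (L.cup (univ 𝒢) (univ 𝒢) x) = 0 := fun x => LinearMap.congr_fun h1 x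
  rw [DGLA.partial, coder_eq_conv,
    comp_conv (μ' := LinearMap.mul F (SymC (susp 𝓗))) (f' := 0) (g' := C.Sπ)
      fun x y => by simp [Contraction.Sπ, map_ι, h2], conv_zero_left]

end Main

end HPT

end

theorem mainTheorem6 {F g H : Type*} [Field F] [CharZero F]
    [AddCommGroup g] [Module F g] [AddCommGroup H] [Module F H]
    (𝒢 : ℤ → Submodule F g) [DirectSum.Decomposition 𝒢]
    (𝓗 : ℤ → Submodule F H) [DirectSum.Decomposition 𝓗]
    (L : HPT.DGLA 𝒢) (C : HPT.Contraction 𝓗 𝒢 0 L.d) :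
    (∀ D' : HPT.SymC (HPT.susp 𝓗) →ₗ[F] HPT.SymC (HPT.susp 𝓗),
      HPT.SymC.IsCoalgDifferential (HPT.susp 𝓗) D' →
      C.Sπ ∘ₗ L.partial = D' ∘ₗ C.Sπ →
        C.D = D' ∧ C.HasPerturbedContraction C.Sπ) ∧
    (C.Sπ ∘ₗ L.partial = 0 → C.D = 0 ∧ C.HasPerturbedContraction C.Sπ) ∧
    ((∀ x y : g, C.π (L.bracket x y) = 0) →
      C.Sπ ∘ₗ L.partial = 0 ∧ C.D = 0 ∧ C.HasPerturbedContraction C.Sπ) := by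
  have hb : C.Sπ ∘ₗ L.partial = 0 → C.D = 0 ∧ C.HasPerturbedContraction C.Sπ := fun h =>
    HPT.D_eq_and_hasPerturbedContraction C (by rw [h, LinearMap.zero_comp])
  exact ⟨fun D' _ hD' => HPT.D_eq_and_hasPerturbedContraction C hD', hb,
    fun h => ⟨HPT.Sπ_comp_partial_eq_zero C h, hb (HPT.Sπ_comp_partial_eq_zero C h)⟩⟩
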